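/- All manifolds are smooth, finite dimensional, Hausdorff and second countable. Let $D_N\subset TN\oplus T^*N$ be a Dirac structure on a manifold $N$, that is, a smooth subbundle with $D_N=D_N^\perp$ for the pairing $\langle\!\langle (u,\alpha),(v,\beta)\rangle\!\rangle=\alpha(v)+\beta(u)$, and assume that $D_N$ is integrable: its smooth local sections are closed under the Courant bracket $[(X,\alpha),(Y,\beta)]=([X,Y],\pounds_X\beta-i_Y d\alpha)$. Put $F=\mathrm{pr}_1(D_N)\subset TN$. Let $\pi\colon M\to N$ be a surjective submersion and let $E\colon M\to\mathbb R$ be a weak Morse family over $\pi$, that is, a smooth function such that $(\ker T\pi)^\circ\cap dE(M)$ is a submanifold of $T^*M$ whose tangent space at each of its points is $T(\ker T\pi)^\circ\cap T(dE(M))$. Let $S_E=\mathfrak j_\pi\big(dE(M)\cap(\ker T\pi)^\circ\big)\subset T^*N$, where $\langle\mathfrak j_\pi(\eta),T\pi(v)\rangle=\langle\eta,v\rangle$ (an immersed Lagrangian submanifold). Let $S^0=\{v\in TN : (v,\alpha)\in D_N \text{ for some }\alpha\in S_E\}$, $N^k=\tau_N(S^k)$ and $S^{k+1}=S^k\cap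 TN^k$, where $\tau_N\colon TN\to N$ is the projection. Assume that the $N^k$ are (immersed) submanifolds of $N$ for $k\le k_f$, that the algorithm stabilizes at $k_f$, i.e. $S^{k_f+1}=S^{k_f}$, and that $N_{k_f}=N^{k_f}$ is nonempty. Let $z\in N_{k_f}$ and let $\mathcal H^f_z$ be the leaf through $z$ of the distribution $F\cap TN_{k_f}$ on $N_{k_f}$, i.e. a connected immersed submanifold of $N_{k_f}$ through $z$ with $T_y\mathcal H^f_z=F_y\cap T_yN_{k_f}$ for all its points $y$, which contains every other such submanifold through $z$. Let $\omega^f_z$ be the 2-form induced by $D_N$ on $\mathcal H^f_z$: $\omega^f_z(u,w)=\alpha(w)$ for $u,w\in T_y\mathcal H^f_z$ and any $\alpha\in T_y^*N$ with $(u,\alpha)\in D_N$. Assume that $\omega^f_z$ is smooth. Let $X$ be a smooth vector field on $\mathcal H^f_z$ for which there is a smooth 1-form $\mu$ along $\mathcal H^f_z$ (a smooth section of $T^*N$ over $\mathcal H^f_z$) with values in $S_E$ such that $i_X\omega^f_z=\mu$ on $T\mathcal H^f_z$. Then $\pounds_X\omega^f_z=0$. In particular, the flow of $X$ preserves $\omega^f_z$: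 if $J\ni 0$ is an open interval, $U\subset\mathcal H^f_z$ is open and $\Phi\colon J\times U\to\mathcal H^f_z$ is a smooth local flow of $X$, then $(\Phi_t^*\omega^f_z)_y=(\omega^f_z)_y$ for all $t\in J$ and $y\in U$. -/

import Mathlib

open scoped Manifold ContDiff
open Bundle

universe u v

noncomputable section

namespace DiracSystem

/-! ### Cotangent bundles, smooth fields -/

/-- The model space of an `n`-dimensional manifold. -/
abbrev Euc (n : ℕ) : Type := EuclideanSpace ℝ (Fin n)

/-- The cotangent space `T*_x P` of an `n`-dimensional manifold. -/
abbrev Cotangent (n : ℕ) {P : Type u} [TopologicalSpace P] [ChartedSpace (Euc n) P] (x : P) : Type :=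
  TangentSpace (𝓡 n) x →L[ℝ] Bundle.Trivial P ℝ x

/-- The cotangent bundle `T*P`, with the vector bundle (hence manifold) structure of Mathlib. -/
abbrev CotangentBundle (n : ℕ) (P : Type u) [TopologicalSpace P] [ChartedSpace (Euc n) P]
    [IsManifold (𝓡 n) ∞ P] : Type u :=
  TotalSpace (Euc n →L[ℝ] ℝ) (fun x : P => Cotangent n x)

/-- The model with corners of `T*P`. -/
abbrev cotangentModel (n : ℕ) := (𝓡 n).prod 𝓘(ℝ, Euc n →L[ℝ] ℝ)

section Fields

variable {n : ℕ} {P : Type u} [TopologicalSpace P] [ChartedSpace (Euc n) P]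
  [IsManifold (𝓡 n) ∞ P]

/-- `X` is a smooth vector field on the set `U`. -/
def SmoothVectorFieldOn (X : ∀ x : P, TangentSpace (𝓡 n) x) (U : Set P) : Prop :=
  ContMDiffOn (𝓡 n) (𝓡 n).tangent ∞ (fun x => (TotalSpace.mk' (Euc n) x (X x) : TangentBundle (𝓡 n) P)) U

/-- `α` is a smooth differential 1-form on the set `U`. -/
def SmoothOneFormOn (α : ∀ x : P, Cotangent n x) (U : Set P) : Prop :=
  ContMDiffOn (𝓡 n) (cotangentModel n) ∞
    (fun x => (TotalSpace.mk' (Euc n →L[ℝ] ℝ) x (α x) : CotangentBundle n P)) U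

/-- The value `α(v) ∈ ℝ` of a covector on a vector. -/
def eval {x : P} (α : Cotangent n x) (v : TangentSpace (𝓡 n) x) : ℝ := α v

/-- The derivative `v(f)` of a function `f` along a tangent vector `v` at `x`. -/
def dirDeriv (f : P → ℝ) (x : P) (v : TangentSpace (𝓡 n) x) : ℝ := mfderiv (𝓡 n) 𝓘(ℝ, ℝ) f x v

/-- The Lie bracket `[X, Y]` at `x`. -/
abbrev bracket (X Y : ∀ x : P, TangentSpace (𝓡 n) x) (x : P) : TangentSpace (𝓡 n) x :=
  VectorField.mlieBracket (𝓡 n) X Y x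

/-- A field of real-valued functions of two tangent vectors is smooth (as a covariant 2-tensor):
its values on smooth local vector fields are smooth. -/
def IsSmoothTwoTensor (Ω : ∀ x : P, TangentSpace (𝓡 n) x → TangentSpace (𝓡 n) x → ℝ) : Prop :=
  ∀ (U : Set P), IsOpen U → ∀ Y Z : ∀ x : P, TangentSpace (𝓡 n) x,
    SmoothVectorFieldOn Y U → SmoothVectorFieldOn Z U →
      ContMDiffOn (𝓡 n) 𝓘(ℝ, ℝ) ∞ (fun x => Ω x (Y x) (Z x)) U

/-- The Lie derivative of a covariant 2-tensor, evaluated on two vector fields: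
`(£_X Ω)(Y, Z) = X(Ω(Y, Z)) - Ω([X, Y], Z) - Ω(Y, [X, Z])`. -/
def lieDerivative (X : ∀ x : P, TangentSpace (𝓡 n) x)
    (Ω : ∀ x : P, TangentSpace (𝓡 n) x → TangentSpace (𝓡 n) x → ℝ)
    (Y Z : ∀ x : P, TangentSpace (𝓡 n) x) (x : P) : ℝ :=
  dirDeriv (fun x' => Ω x' (Y x') (Z x')) x (X x)
    - Ω x (bracket X Y x) (Z x) - Ω x (Y x) (bracket X Z x)

/-- `(£_X β)(Z) = X(β(Z)) - β([X, Z])` at `x`. -/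
def lieDerivativeOneForm (X : ∀ x : P, TangentSpace (𝓡 n) x) (β : ∀ x : P, Cotangent n x)
    (Z : ∀ x : P, TangentSpace (𝓡 n) x) (x : P) : ℝ :=
  dirDeriv (fun x' => eval (β x') (Z x')) x (X x) - eval (β x) (bracket X Z x)

/-- `dα(Y, Z) = Y(α(Z)) - Z(α(Y)) - α([Y, Z])` at `x`. -/
def extDerivative (α : ∀ x : P, Cotangent n x) (Y Z : ∀ x : P, TangentSpace (𝓡 n) x) (x : P) : ℝ :=
  dirDeriv (fun x' => eval (α x') (Z x')) x (Y x)
    - dirDeriv (fun x' => eval (α x') (Y x')) x (Z x) - eval (α x) (bracket Y Z x)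

end Fields

/-! ### Dirac structures -/

section Dirac

variable (n : ℕ) (N : Type u) [TopologicalSpace N] [ChartedSpace (Euc n) N]
  [IsManifold (𝓡 n) ∞ N]

/-- A Dirac structure on `N`: a smooth subbundle `D ⊆ TN ⊕ T*N` with `D_x = D_x^⊥` for the pairing
`⟪(u, α), (v, β)⟫ = α(v) + β(u)`. (The rank of `D` is then `n`, and the local generating sections
below form a frame.) -/
structure DiracStructure where
  /-- The fibre over `x`. -/
  fiber : ∀ x : N, Submodule ℝ (TangentSpace (𝓡 n) x × Cotangent n x)
  lagrangian : ∀ (x : N) (a : TangentSpace (𝓡 n) x × Cotangent n x),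
    a ∈ fiber x ↔ ∀ b ∈ fiber x, eval a.2 b.1 + eval b.2 a.1 = 0
  smooth : ∀ x : N, ∃ U : Set N, IsOpen U ∧ x ∈ U ∧
    ∃ (X : Fin n → ∀ y : N, TangentSpace (𝓡 n) y) (α : Fin n → ∀ y : N, Cotangent n y),
      (∀ i, SmoothVectorFieldOn (X i) U) ∧ (∀ i, SmoothOneFormOn (α i) U) ∧
      ∀ y ∈ U, fiber y = Submodule.span ℝ (Set.range fun i => (X i y, α i y))

variable {n N}

/-- `D` is integrable: its smooth local sections are closed under the Courant bracket
`[(X, α), (Y, β)] = ([X, Y], £_X β - i_Y dα)`. The covector `γ` is the value at `x` of the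
1-form `£_X β - i_Y dα`. -/
def DiracStructure.Integrable (D : DiracStructure n N) : Prop :=
  ∀ (U : Set N), IsOpen U → ∀ (X Y : ∀ x : N, TangentSpace (𝓡 n) x) (α β : ∀ x : N, Cotangent n x),
    SmoothVectorFieldOn X U → SmoothOneFormOn α U → SmoothVectorFieldOn Y U → SmoothOneFormOn β U →
    (∀ x ∈ U, (X x, α x) ∈ D.fiber x) → (∀ x ∈ U, (Y x, β x) ∈ D.fiber x) →
    ∀ x ∈ U, ∃ γ : Cotangent n x, (bracket X Y x, γ) ∈ D.fiber x ∧
      ∀ (V : Set N), IsOpen V → x ∈ V → ∀ Z : ∀ x : N, TangentSpace (𝓡 n) x,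
        SmoothVectorFieldOn Z V →
          eval γ (Z x) = lieDerivativeOneForm X β Z x - extDerivative α Y Z x

/-- The characteristic distribution `F = pr₁(D) ⊆ TN`. -/
def DiracStructure.char (D : DiracStructure n N) (x : N) : Submodule ℝ (TangentSpace (𝓡 n) x) :=
  (D.fiber x).map (LinearMap.fst ℝ (TangentSpace (𝓡 n) x) (Cotangent n x))

open Classical in
/-- The 2-form induced by `D` on a manifold `H` mapped into `N` by `f` tangentially to `pr₁(D)`:
`Ω_y(u, w) = α(Tf w)` for any covector `α` with `(Tf u, α) ∈ D`
(see `inducedForm_eq` for the independence of the choice of `α`). -/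
def DiracStructure.inducedForm (D : DiracStructure n N) {d : ℕ} {H : Type u} [TopologicalSpace H]
    [ChartedSpace (Euc d) H] (f : H → N) (y : H) (u w : TangentSpace (𝓡 d) y) : ℝ :=
  if h : ∃ α : Cotangent n (f y), (mfderiv (𝓡 d) (𝓡 n) f y u, α) ∈ D.fiber (f y)
  then eval h.choose (mfderiv (𝓡 d) (𝓡 n) f y w) else 0

theorem DiracStructure.inducedForm_eq (D : DiracStructure n N) {d : ℕ} {H : Type u}
    [TopologicalSpace H] [ChartedSpace (Euc d) H] (f : H → N) (y : H)
    (u w : TangentSpace (𝓡 d) y) (α : Cotangent n (f y))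
    (hu : (mfderiv (𝓡 d) (𝓡 n) f y u, α) ∈ D.fiber (f y))
    (hw : mfderiv (𝓡 d) (𝓡 n) f y w ∈ D.char (f y)) :
    D.inducedForm f y u w = eval α (mfderiv (𝓡 d) (𝓡 n) f y w) := by
  have h : ∃ α : Cotangent n (f y), (mfderiv (𝓡 d) (𝓡 n) f y u, α) ∈ D.fiber (f y) := ⟨α, hu⟩
  obtain ⟨b, hb, hbw⟩ := hw
  have hbw' : b.1 = mfderiv (𝓡 d) (𝓡 n) f y w := hbw
  have h1 := (D.lagrangian _ _).1 h.choose_spec b hb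
  have h2 := (D.lagrangian _ _).1 hu b hb
  simp only [hbw'] at h1 h2
  rw [DiracStructure.inducedForm, dif_pos h]
  linarith

end Dirac

/-! ### Submanifolds and leaves -/

section Submanifolds

variable {E : Type*} [NormedAddCommGroup E] [NormedSpace ℝ E] {G : Type*} [TopologicalSpace G]

/-- An immersed submanifold of `P` (Hausdorff, second countable, without boundary, of some
dimension `dim`), given by an injective immersion. -/
structure ImmersedSubmanifold (I : ModelWithCorners ℝ E G) (P : Type u) [TopologicalSpace P]
    [ChartedSpace G P] where
  dim : ℕ
  carrier : Type u
  [top : TopologicalSpace carrier]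
  [charted : ChartedSpace (Euc dim) carrier]
  [manifold : IsManifold (𝓡 dim) ∞ carrier]
  [t2 : T2Space carrier]
  [secondCountable : SecondCountableTopology carrier]
  incl : carrier → P
  incl_smooth : ContMDiff (𝓡 dim) I ∞ incl
  incl_injective : Function.Injective incl
  incl_immersion : ∀ y, Function.Injective (mfderiv (𝓡 dim) I incl y)

attribute [instance] ImmersedSubmanifold.top ImmersedSubmanifold.charted
  ImmersedSubmanifold.manifold ImmersedSubmanifold.t2 ImmersedSubmanifold.secondCountable

variable {I : ModelWithCorners ℝ E G} {P : Type u} [TopologicalSpace P] [ChartedSpace G P]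

/-- The tangent bundle of an immersed submanifold, as a subset of `TP`. -/
def ImmersedSubmanifold.tangentSet (A : ImmersedSubmanifold I P) : Set (TangentBundle I P) :=
  Set.range (tangentMap (𝓡 A.dim) I A.incl)

variable (I) in
/-- `A ⊆ P` is an embedded submanifold (its dimension may vary between components). -/
def IsEmbeddedSubmanifold (A : Set P) : Prop :=
  ∀ x ∈ A, ∃ U : Set P, IsOpen U ∧ x ∈ U ∧ ∃ C : ImmersedSubmanifold I P,
    Topology.IsEmbedding C.incl ∧ Set.range C.incl = A ∩ U

variable (I) in
/-- The vectors tangent to a subset `A ⊆ P` at `x`: velocities of smooth curves in `A`. For an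
embedded submanifold `A` this is the tangent space `T_x A`. -/
def tangentVectors (A : Set P) (x : P) : Set (TangentSpace I x) :=
  {w | ∃ c : ℝ → P, c 0 = x ∧ ContMDiffAt 𝓘(ℝ, ℝ) I ∞ c 0 ∧ (∀ᶠ t in nhds (0 : ℝ), c t ∈ A) ∧
    (TotalSpace.mk' E (c 0) (mfderiv 𝓘(ℝ, ℝ) I c 0 (1 : ℝ)) : TangentBundle I P)
      = TotalSpace.mk' E x w}

variable (I) in
/-- `A` and `B` are weakly transverse (intersect cleanly): `A ∩ B` is a submanifold and
`T(A ∩ B) = TA ∩ TB`. -/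
def WeaklyTransverse (A B : Set P) : Prop :=
  IsEmbeddedSubmanifold I (A ∩ B) ∧
    ∀ x ∈ A ∩ B, tangentVectors I (A ∩ B) x = tangentVectors I A x ∩ tangentVectors I B x

/-- `H` is a connected integral manifold of the (possibly singular) distribution `Δ`. -/
structure IsConnectedIntegralManifold (Δ : ∀ x : P, Submodule ℝ (TangentSpace I x))
    (H : ImmersedSubmanifold I P) : Prop where
  connected : ConnectedSpace H.carrier
  tangent : ∀ (y : H.carrier) (v : TangentSpace I (H.incl y)),
    v ∈ Set.range (mfderiv (𝓡 H.dim) I H.incl y) ↔ v ∈ Δ (H.incl y)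

/-- `H` is the leaf of `Δ` through `z`: the maximal connected integral manifold through `z`. -/
structure IsLeaf (Δ : ∀ x : P, Submodule ℝ (TangentSpace I x)) (z : P)
    (H : ImmersedSubmanifold I P) : Prop where
  integral : IsConnectedIntegralManifold Δ H
  mem : z ∈ Set.range H.incl
  maximal : ∀ K : ImmersedSubmanifold I P, IsConnectedIntegralManifold Δ K →
    z ∈ Set.range K.incl → Set.range K.incl ⊆ Set.range H.incl

end Submanifolds

/-! ### Weak Morse families -/

section Morse

variable {m n : ℕ} {M : Type v} [TopologicalSpace M] [ChartedSpace (Euc m) M]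
  [IsManifold (𝓡 m) ∞ M] {N : Type u} [TopologicalSpace N] [ChartedSpace (Euc n) N]
  [IsManifold (𝓡 n) ∞ N]

variable (m n) in
/-- `pr` is a surjective submersion. -/
structure IsSurjectiveSubmersion (pr : M → N) : Prop where
  smooth : ContMDiff (𝓡 m) (𝓡 n) ∞ pr
  surjective : Function.Surjective pr
  submersion : ∀ p, Function.Surjective (mfderiv (𝓡 m) (𝓡 n) pr p)

variable (m) in
/-- The differential `dE`, as a section of `T*M`. -/
def differential (E : M → ℝ) (p : M) : CotangentBundle m M :=
  TotalSpace.mk' (Euc m →L[ℝ] ℝ) p (mfderiv (𝓡 m) 𝓘(ℝ, ℝ) E p)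

variable (m n) in
/-- The conormal bundle `(ker Tpr)° ⊆ T*M`. -/
def conormal (pr : M → N) : Set (CotangentBundle m M) :=
  {η | ∀ v : TangentSpace (𝓡 m) η.proj, mfderiv (𝓡 m) (𝓡 n) pr η.proj v = 0 → eval η.2 v = 0}

variable (m n) in
/-- `E` is a weak Morse family over `pr`: `(ker Tpr)°` and `dE(M)` are weakly transverse in `T*M`. -/
structure IsWeakMorseFamily (pr : M → N) (E : M → ℝ) : Prop where
  smooth : ContMDiff (𝓡 m) 𝓘(ℝ, ℝ) ∞ E
  weaklyTransverse :
    WeaklyTransverse (cotangentModel m) (conormal m n pr) (Set.range (differential m E))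

variable (m n) in
/-- `S_E = j_pr(dE(M) ∩ (ker Tpr)°) ⊆ T*N`, where `j_pr(η)` is the covector `β` at the image point
determined by `β(Tpr v) = η(v)`. -/
def lagrangianOf (pr : M → N) (E : M → ℝ) : Set (CotangentBundle n N) :=
  {ν | ∃ η ∈ Set.range (differential m E) ∩ conormal m n pr, ∃ β : Cotangent n (pr η.proj),
    (∀ v : TangentSpace (𝓡 m) η.proj, eval β (mfderiv (𝓡 m) (𝓡 n) pr η.proj v) = eval η.2 v) ∧
      ν = TotalSpace.mk' (Euc n →L[ℝ] ℝ) (pr η.proj) β}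

end Morse

/-! ### The integrability algorithm -/

section Algorithm

variable {n : ℕ} {N : Type u} [TopologicalSpace N] [ChartedSpace (Euc n) N]
  [IsManifold (𝓡 n) ∞ N]

/-- `S_{D,E} = {v ∈ TN | ∃ α ∈ S_E, (v, α) ∈ D}`. -/
def implicitEquation (D : DiracStructure n N) (S : Set (CotangentBundle n N)) :
    Set (TangentBundle (𝓡 n) N) :=
  {v | ∃ α : Cotangent n v.proj,
    TotalSpace.mk' (Euc n →L[ℝ] ℝ) v.proj α ∈ S ∧ (v.2, α) ∈ D.fiber v.proj}

/-- `S⁰ = S`, `S^{k+1} = S^k ∩ TN^k`, for the submanifolds `N^k`. -/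
def algorithmStep (S : Set (TangentBundle (𝓡 n) N)) (Nk : ℕ → ImmersedSubmanifold (𝓡 n) N) :
    ℕ → Set (TangentBundle (𝓡 n) N)
  | 0 => S
  | k + 1 => algorithmStep S Nk k ∩ (Nk k).tangentSet

/-- The integrability algorithm for `S` runs through submanifolds `N^k = τ(S^k)` and stabilizes
at the index `kf`. -/
structure AlgorithmStabilizes (S : Set (TangentBundle (𝓡 n) N))
    (Nk : ℕ → ImmersedSubmanifold (𝓡 n) N) (kf : ℕ) : Prop where
  base : ∀ k ≤ kf, Set.range (Nk k).incl = TotalSpace.proj '' algorithmStep S Nk k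
  stable : algorithmStep S Nk (kf + 1) = algorithmStep S Nk kf

/-- The distribution `F ∩ TA` on an immersed submanifold `A`, where `F = pr₁(D)`. -/
def restrictedDistribution (D : DiracStructure n N) (A : ImmersedSubmanifold (𝓡 n) N)
    (y : A.carrier) : Submodule ℝ (TangentSpace (𝓡 A.dim) y) :=
  (D.char (A.incl y)).comap (mfderiv (𝓡 A.dim) (𝓡 n) A.incl y).toLinearMap

end Algorithm

end DiracSystem

end

noncomputable section

namespace DiracSystem

/-! ### Inverse functions, left inverses, maps of constant rank -/

section Calculus

set_option linter.unusedSectionVars false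

open Filter Topology

variable {E F G : Type*} [NormedAddCommGroup E] [NormedSpace ℝ E] [FiniteDimensional ℝ E]
  [NormedAddCommGroup F] [NormedSpace ℝ F] [FiniteDimensional ℝ F]
  [NormedAddCommGroup G] [NormedSpace ℝ G] [FiniteDimensional ℝ G]

/-! By Cartan's formula `£_X ω = i_X dω + d i_X ω`, so it suffices that `ω` is closed and that `i_X
ω`, which is the pullback of `μ` to the leaf, is closed. Both facts are proved in charts of the leaf
and combined in `fderiv_form_invariant`; `flow_preserves` then integrates the infinitesimal
invariance along the flow.

Closedness of `ω` comes from the integrability of `D`. Where the rank of `F` along the leaf is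
locally maximal, the coordinate fields of the leaf extend to the vector parts of local sections of
`D` (`DiracStructure.exists_adapted_sections`). These fields commute along the leaf, and pairing the
Courant bracket of two such sections with a third gives `dω = 0`
(`DiracStructure.fderiv_form_cyclic_of_rank`). If `dω` were nonzero somewhere, it would be nonzero
on an open set, and that set would contain a point of maximal rank, a contradiction
(`DiracStructure.fderiv_form_cyclic`).

Closedness of the pullback of `μ` expresses that `S_E` is isotropic. If `μ` lifts to a smooth family
`Q` of fibrewise critical points of `E` over the leaf, then the pullback is `d(E ∘ Q)`
(`fderiv_symm_of_lift`). The difficulty is the lift: `S_E` is only the image of the critical set,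
and `μ` may move between its sheets. The map from the critical set to `T*N` is isotropic, hence of
rank at most `n`; cleanness forces rank at least `n` at the chosen point. So the rank is locally
constant and the map has smooth local sections over its image (`exists_critical_section`). Countably
many of these cover the critical set, and by Baire's theorem every nonempty open part of the leaf
contains a smaller one on which a single section lifts `μ` (`exists_eventually_of_countable_cover`).
The locus where the pullback fails to be closed is open, so it is empty (`fderiv_pullback_symm`). -/

theorem isInvertible_of_bijective {A : E →L[ℝ] F} (hA : Function.Bijective A) :
    A.IsInvertible :=
  ⟨(LinearEquiv.ofBijective A.toLinearMap hA).toContinuousLinearEquiv, by ext; rfl⟩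

theorem eventually_isInvertible {X : Type*} [TopologicalSpace X] {A : X → E →L[ℝ] F} {x₀ : X}
    (hA : ContinuousAt A x₀) (h : (A x₀).IsInvertible) : ∀ᶠ x in 𝓝 x₀, (A x).IsInvertible := by
  obtain ⟨e, he⟩ := h
  have := hA.eventually (he ▸ ContinuousLinearEquiv.nhds e)
  filter_upwards [this] with x hx
  obtain ⟨e', he'⟩ := hx
  exact ⟨e', he'⟩

theorem contDiffAt_inverse_comp {n : WithTop ℕ∞} {A : G → E →L[ℝ] F} {x₀ : G}
    (hA : ContDiffAt ℝ n A x₀) (h : (A x₀).IsInvertible) :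
    ContDiffAt ℝ n (fun x => (A x).inverse) x₀ := by
  have : CompleteSpace E := FiniteDimensional.complete ℝ E
  obtain ⟨e, he⟩ := h
  exact ContDiffAt.comp (f := A) x₀ (he ▸ contDiffAt_map_inverse e) hA

/-- The inverse function theorem, with the regularity of the inverse on a neighbourhood. -/
theorem exists_local_inverse {n : WithTop ℕ∞} (hn : n ≠ 0) {f : E → F} {a : E}
    (hf : ∀ᶠ x in 𝓝 a, ContDiffAt ℝ n f x) (hf' : Function.Bijective (fderiv ℝ f a)) :
    ∃ g : F → E, g (f a) = a ∧ (∀ᶠ y in 𝓝 (f a), ContDiffAt ℝ n g y) ∧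
      (∀ᶠ x in 𝓝 a, g (f x) = x) ∧ ∀ᶠ y in 𝓝 (f a), f (g y) = y := by
  have : CompleteSpace E := FiniteDimensional.complete ℝ E
  have hfa := hf.self_of_nhds
  obtain ⟨e, he⟩ := isInvertible_of_bijective hf'
  have hd : HasFDerivAt f (e : E →L[ℝ] F) a := he ▸ (hfa.differentiableAt hn).hasFDerivAt
  let Φ := hfa.toOpenPartialHomeomorph f hd hn
  have ha : a ∈ Φ.source := hfa.mem_toOpenPartialHomeomorph_source hd hn
  have hfa' : f a ∈ Φ.target := hfa.image_mem_toOpenPartialHomeomorph_target hd hn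
  have hinv : Φ.symm (f a) = a := Φ.left_inv ha
  have hcont : Tendsto Φ.symm (𝓝 (f a)) (𝓝 a) := by
    have := Φ.continuousAt_symm hfa'
    rwa [ContinuousAt, hinv] at this
  refine ⟨Φ.symm, hinv, ?_, ?_, ?_⟩
  -- Smoothness of the inverse at a nearby point needs an invertible derivative there too, so
  -- invertibility is first spread from `a` to a neighbourhood.
  · have h1 : ∀ᶠ x in 𝓝 a, (fderiv ℝ f x).IsInvertible :=
      eventually_isInvertible ((hfa.fderiv_right (m := 0) (by
        simpa using ENat.one_le_iff_ne_zero_withTop.mpr hn)).continuousAt) ⟨e, he⟩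
    filter_upwards [hcont.eventually h1, hcont.eventually hf, Φ.open_target.mem_nhds hfa']
      with y hy1 hy2 hy3
    obtain ⟨e', he'⟩ := hy1
    exact Φ.contDiffAt_symm (f₀' := e') hy3 (he' ▸ (hy2.differentiableAt hn).hasFDerivAt) hy2
  · filter_upwards [Φ.open_source.mem_nhds ha] with x hx using Φ.left_inv hx
  · filter_upwards [Φ.open_target.mem_nhds hfa'] with x hx using Φ.right_inv hx

/-- An immersion has a smooth local left inverse. -/
theorem exists_local_left_inverse {n : WithTop ℕ∞} (hn : n ≠ 0) {f : E → F} {a : E}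
    (hf : ∀ᶠ x in 𝓝 a, ContDiffAt ℝ n f x) (hf' : Function.Injective (fderiv ℝ f a)) :
    ∃ g : F → E, g (f a) = a ∧ (∀ᶠ y in 𝓝 (f a), ContDiffAt ℝ n g y) ∧
      ∀ᶠ x in 𝓝 a, g (f x) = x := by
  -- Composing `f` with a linear left inverse `L` of its derivative gives a map with derivative the
  -- identity at `a`, to which the inverse function theorem applies.
  obtain ⟨L, hL⟩ := LinearMap.exists_leftInverse_of_injective (fderiv ℝ f a).toLinearMap
    (LinearMap.ker_eq_bot.2 hf')
  let Lc : F →L[ℝ] E := L.toContinuousLinearMap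
  have hd : fderiv ℝ (fun x => Lc (f x)) a = ContinuousLinearMap.id ℝ E := by
    rw [fderiv_fun_comp a Lc.differentiableAt (hf.self_of_nhds.differentiableAt hn), Lc.fderiv]
    ext v
    exact LinearMap.congr_fun hL v
  obtain ⟨g, hg1, hg2, hg3, -⟩ := exists_local_inverse (f := fun x => Lc (f x)) (a := a) hn
    (hf.mono fun x hx => Lc.contDiff.contDiffAt.comp x hx)
    (by rw [hd]; exact Function.bijective_id)
  refine ⟨fun y => g (Lc y), hg1, ?_, hg3⟩
  have := (Lc.continuous.tendsto (f a)).eventually hg2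
  filter_upwards [this] with y hy
  exact ContDiffAt.comp y hy Lc.contDiff.contDiffAt

/-- Surjectivity of `p ∘ T` and the rank bound give `dim ker (p ∘ T) ≤ dim ker T`; the reverse
inclusion of kernels is automatic, so the two kernels coincide. -/
theorem eq_zero_of_finrank_range_le {T : E →ₗ[ℝ] F} {p : F →ₗ[ℝ] G}
    (hs : Function.Surjective (p ∘ₗ T))
    (hr : Module.finrank ℝ (LinearMap.range T) ≤ Module.finrank ℝ G) {v : E} (hv : p (T v) = 0) :
    T v = 0 := by
  have h1 := LinearMap.finrank_range_add_finrank_ker T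
  have h2 := LinearMap.finrank_range_add_finrank_ker (p ∘ₗ T)
  rw [LinearMap.range_eq_top.2 hs, finrank_top] at h2
  have hle : LinearMap.ker T ≤ LinearMap.ker (p ∘ₗ T) := LinearMap.ker_le_ker_comp T p
  have := Submodule.eq_of_le_of_finrank_le hle (by omega)
  have hv' : v ∈ LinearMap.ker (p ∘ₗ T) := hv
  rw [← this] at hv'
  exact hv'

/-- If the rank of `B x` does not increase near `x₀`, a projection to the range of `B x₀` is
bijective on the range of `B x` near `x₀`. -/
theorem exists_projection_range {X : Type*} [TopologicalSpace X] {B : X → E →L[ℝ] F} {x₀ : X}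
    (hB : ContinuousAt B x₀)
    (hr : ∀ᶠ x in 𝓝 x₀, Module.finrank ℝ (LinearMap.range (B x).toLinearMap) ≤
      Module.finrank ℝ (LinearMap.range (B x₀).toLinearMap)) :
    ∃ (p : F →L[ℝ] LinearMap.range (B x₀).toLinearMap)
      (s : LinearMap.range (B x₀).toLinearMap →L[ℝ] E),
      p ∘L B x₀ ∘L s = ContinuousLinearMap.id ℝ _ ∧
      (∀ᶠ x in 𝓝 x₀, (p ∘L B x ∘L s).IsInvertible) ∧
      ∀ᶠ x in 𝓝 x₀, ∀ v, p (B x v) = 0 → B x v = 0 := by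
  obtain ⟨p, hp⟩ := (LinearMap.range (B x₀).toLinearMap).exists_isCompl
  let P : F →ₗ[ℝ] LinearMap.range (B x₀).toLinearMap :=
    Submodule.projectionOnto _ _ hp
  obtain ⟨s, hs⟩ := LinearMap.exists_rightInverse_of_surjective (B x₀).toLinearMap.rangeRestrict
    (LinearMap.range_rangeRestrict _)
  have hid : P.toContinuousLinearMap ∘L B x₀ ∘L s.toContinuousLinearMap
      = ContinuousLinearMap.id ℝ _ := by
    ext1 v
    have h1 : (B x₀).toLinearMap.rangeRestrict (s v) = v := LinearMap.congr_fun hs v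
    have h2 : B x₀ (s v) = v := congrArg Subtype.val h1
    change P (B x₀ (s v)) = v
    rw [h2]
    exact Submodule.projectionOnto_apply_left hp v
  have hinv : ∀ᶠ x in 𝓝 x₀,
      (P.toContinuousLinearMap ∘L B x ∘L s.toContinuousLinearMap).IsInvertible := by
    apply eventually_isInvertible
    · exact continuousAt_const.clm_comp (hB.clm_comp continuousAt_const)
    · rw [hid]
      exact ⟨ContinuousLinearEquiv.refl ℝ _, rfl⟩
  refine ⟨P.toContinuousLinearMap, s.toContinuousLinearMap, hid, hinv, ?_⟩
  filter_upwards [hinv, hr] with x hx hrx v hv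
  -- Invertibility of `P ∘ B x ∘ s` makes `P ∘ B x` surjective, and the rank bound then makes `P`
  -- injective on the range of `B x`.
  refine eq_zero_of_finrank_range_le (T := (B x).toLinearMap) (p := P) ?_ hrx hv
  intro r
  obtain ⟨e, he⟩ := hx
  refine ⟨s (e.symm r), ?_⟩
  have := DFunLike.congr_fun he (e.symm r)
  simpa using this.symm

/-- A family of linear maps whose rank does not increase near `x₀` has a family of generalized
inverses of the same regularity. -/
theorem exists_generalized_inverse {B : G → E →L[ℝ] F} {x₀ : G} {n : WithTop ℕ∞}
    (hB : ∀ᶠ x in 𝓝 x₀, ContDiffAt ℝ n B x)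
    (hr : ∀ᶠ x in 𝓝 x₀, Module.finrank ℝ (LinearMap.range (B x).toLinearMap) ≤
      Module.finrank ℝ (LinearMap.range (B x₀).toLinearMap)) :
    ∃ S : G → F →L[ℝ] E, (∀ᶠ x in 𝓝 x₀, ContDiffAt ℝ n S x) ∧
      ∀ᶠ x in 𝓝 x₀, ∀ v, B x (S x (B x v)) = B x v := by
  obtain ⟨p, s, -, hinv, hker⟩ := exists_projection_range hB.self_of_nhds.continuousAt hr
  refine ⟨fun x => s ∘L (p ∘L B x ∘L s).inverse ∘L p, ?_, ?_⟩
  · filter_upwards [hB, hinv] with x hx hi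
    exact contDiffAt_const.clm_comp ((contDiffAt_inverse_comp
      (contDiffAt_const.clm_comp (hx.clm_comp contDiffAt_const)) hi).clm_comp contDiffAt_const)
  · filter_upwards [hinv, hker] with x hi hk v
    obtain ⟨e, he⟩ := hi
    -- The difference of the two sides lies in the range of `B x`, where `p` is injective, so the
    -- identity may be checked after applying `p`.
    rw [← sub_eq_zero, ← map_sub]
    apply hk
    rw [map_sub, map_sub, sub_eq_zero]
    have h1 : ∀ r, p (B x (s r)) = e r := fun r => (DFunLike.congr_fun he r).symm
    simp only [ContinuousLinearMap.comp_apply, ← he, ContinuousLinearMap.inverse_equiv, h1]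
    simp

/-- The constant rank theorem: near `u₀` the image of `f` is the image of a section. -/
theorem exists_local_section {f : E → F} {u₀ : E} {n : WithTop ℕ∞} (hn : n ≠ 0)
    (hf : ∀ᶠ u in 𝓝 u₀, ContDiffAt ℝ n f u)
    (hr : ∀ᶠ u in 𝓝 u₀, Module.finrank ℝ (LinearMap.range (fderiv ℝ f u).toLinearMap) ≤
      Module.finrank ℝ (LinearMap.range (fderiv ℝ f u₀).toLinearMap)) :
    ∃ s : F → E, s (f u₀) = u₀ ∧ (∀ᶠ z in 𝓝 (f u₀), ContDiffAt ℝ n s z) ∧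
      ∀ᶠ u in 𝓝 u₀, f (s (f u)) = f u := by
  have hcont : ContinuousAt (fderiv ℝ f) u₀ :=
    (hf.self_of_nhds.fderiv_right (m := 0) (by
        simpa using ENat.one_le_iff_ne_zero_withTop.mpr hn)).continuousAt
  obtain ⟨p, s, hps, -, hker⟩ := exists_projection_range hcont hr
  obtain ⟨K', hK'⟩ := (LinearMap.ker (fderiv ℝ f u₀).toLinearMap).exists_isCompl
  let k : E →L[ℝ] LinearMap.ker (fderiv ℝ f u₀).toLinearMap :=
    (Submodule.projectionOnto _ _ hK').toContinuousLinearMap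
  -- `Φ` straightens `f`: its first component sees the range of the derivative at `u₀`, its second
  -- the kernel, and the dimensions match by rank-nullity.
  let Φ : E → LinearMap.range (fderiv ℝ f u₀).toLinearMap ×
    LinearMap.ker (fderiv ℝ f u₀).toLinearMap := fun u => (p (f u), k u)
  have hΦ : ∀ᶠ u in 𝓝 u₀, ContDiffAt ℝ n Φ u := hf.mono fun u hu =>
    (p.contDiff.contDiffAt.comp u hu).prodMk k.contDiff.contDiffAt
  have hΦ' : fderiv ℝ Φ u₀ = (p ∘L fderiv ℝ f u₀).prod k := by
    have h1 : HasFDerivAt f (fderiv ℝ f u₀) u₀ :=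
      (hf.self_of_nhds.differentiableAt hn).hasFDerivAt
    exact ((p.hasFDerivAt.comp u₀ h1).prodMk k.hasFDerivAt).fderiv
  have hbij : Function.Bijective (fderiv ℝ Φ u₀) := by
    rw [hΦ']
    have hinj : Function.Injective ((p ∘L fderiv ℝ f u₀).prod k).toLinearMap := by
      rw [← LinearMap.ker_eq_bot, LinearMap.ker_eq_bot']
      intro v hv
      have hv1 : p (fderiv ℝ f u₀ v) = 0 := congrArg Prod.fst hv
      have hv2 : k v = 0 := congrArg Prod.snd hv
      have hv3 : v ∈ LinearMap.ker (fderiv ℝ f u₀).toLinearMap := hker.self_of_nhds v hv1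
      have := Submodule.projectionOnto_apply_left hK' ⟨v, hv3⟩
      have h4 : k v = ⟨v, hv3⟩ := this
      rw [hv2] at h4
      exact (congrArg Subtype.val h4).symm
    refine ⟨hinj, (LinearMap.injective_iff_surjective_of_finrank_eq_finrank ?_).1 hinj⟩
    rw [Module.finrank_prod, LinearMap.finrank_range_add_finrank_ker]
  obtain ⟨g, hg1, hg2, hg3, hg4⟩ := exists_local_inverse hn hΦ hbij
  have hgc : Tendsto g (𝓝 (Φ u₀)) (𝓝 u₀) := by
    have := hg2.self_of_nhds.continuousAt
    rwa [ContinuousAt, hg1] at this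
  -- `f ∘ g` does not depend on the second variable
  have hall : ∀ᶠ z in 𝓝 (Φ u₀), ContDiffAt ℝ n g z ∧ Φ (g z) = z ∧ ContDiffAt ℝ n f (g z) ∧
      ∀ v, p (fderiv ℝ f (g z) v) = 0 → fderiv ℝ f (g z) v = 0 :=
    hg2.and (hg4.and ((hgc.eventually hf).and (hgc.eventually hker)))
  obtain ⟨ε, hε, hball⟩ := Metric.eventually_nhds_iff_ball.1 hall
  have hconst : ∀ a ∈ Metric.ball (p (f u₀)) ε, ∀ b ∈ Metric.ball (k u₀) ε,
      f (g (a, b)) = f (g (a, k u₀)) := by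
    intro a ha b hb
    have hmem : ∀ b ∈ Metric.ball (k u₀) ε, (a, b) ∈ Metric.ball (Φ u₀) ε := fun b hb => by
      rw [← ball_prod_same]
      exact ⟨ha, hb⟩
    have hder : ∀ b ∈ Metric.ball (k u₀) ε, HasFDerivAt (fun b => f (g (a, b)))
        (0 : LinearMap.ker (fderiv ℝ f u₀).toLinearMap →L[ℝ] F) b := by
      intro b hb
      obtain ⟨h1, -, h3, h4⟩ := hball _ (hmem b hb)
      have hgd : HasFDerivAt g (fderiv ℝ g (a, b)) (a, b) :=
        (h1.differentiableAt hn).hasFDerivAt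
      have hfd : HasFDerivAt f (fderiv ℝ f (g (a, b))) (g (a, b)) :=
        (h3.differentiableAt hn).hasFDerivAt
      have hpair := hasFDerivAt_prodMk_right (𝕜 := ℝ) a b
      have hcomp := hfd.comp b (hgd.comp b hpair)
      -- `p ∘ f ∘ g` is the first coordinate, hence constant in `b`. As `p` is injective on the
      -- range of the derivative of `f`, the partial derivative of `f ∘ g` in `b` vanishes as well.
      have hp0 : HasFDerivAt (fun b => p (f (g (a, b))))
          (0 : LinearMap.ker (fderiv ℝ f u₀).toLinearMap →L[ℝ] _) b := by
        have : (fun b => p (f (g (a, b)))) =ᶠ[𝓝 b] fun _ => a := by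
          filter_upwards [Metric.isOpen_ball.mem_nhds hb] with b' hb'
          exact congrArg Prod.fst (hball _ (hmem b' hb')).2.1
        exact (hasFDerivAt_const a b).congr_of_eventuallyEq this
      have huniq := hp0.unique (p.hasFDerivAt.comp b hcomp)
      convert! hcomp using 1
      ext1 v
      exact (h4 _ (DFunLike.congr_fun huniq v).symm).symm
    refine (convex_ball (k u₀) ε).is_const_of_fderivWithin_eq_zero (𝕜 := ℝ)
      (f := fun b => f (g (a, b))) (fun b hb => (hder b hb).differentiableAt.differentiableWithinAt)
      (fun b hb => ?_) hb (Metric.mem_ball_self hε)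
    rw [fderivWithin_of_isOpen Metric.isOpen_ball hb, (hder b hb).fderiv]
  -- The section freezes the irrelevant kernel coordinate at its value at `u₀`.
  refine ⟨fun z => g (p z, k u₀), hg1, ?_, ?_⟩
  · have hc : Tendsto (fun z => (p z, k u₀)) (𝓝 (f u₀)) (𝓝 (Φ u₀)) :=
      Continuous.tendsto (by fun_prop) _
    filter_upwards [hc.eventually hg2] with z hz
    exact ContDiffAt.comp z hz (p.contDiff.contDiffAt.prodMk contDiffAt_const)
  · have hΦc : Tendsto Φ (𝓝 u₀) (𝓝 (Φ u₀)) := hΦ.self_of_nhds.continuousAt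
    filter_upwards [hg3, hΦc.eventually (Metric.ball_mem_nhds _ hε)] with u hu hu'
    replace hu' : Φ u ∈ Metric.ball (Φ u₀) ε := hu'
    rw [show Φ u₀ = (p (f u₀), k u₀) from rfl, ← ball_prod_same] at hu'
    have := hconst _ hu'.1 _ hu'.2
    change f (g (Φ u)) = _ at this
    rw [hu] at this
    exact this.symm

end Calculus

/-! ### Critical points along the fibres of a submersion, in coordinates -/

section LinearAlgebra

open Module

set_option linter.unusedSectionVars false

variable {U F : Type*} [AddCommGroup U] [Module ℝ U] [FiniteDimensional ℝ U]
  [AddCommGroup F] [Module ℝ F] [FiniteDimensional ℝ F]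

/-- Rank-nullity for `A`, for `(A, B)` and for `B` restricted to `ker A`; the last two maps have the
same kernel. -/
theorem finrank_range_prod (A : U →ₗ[ℝ] F) (B : U →ₗ[ℝ] Dual ℝ F) :
    finrank ℝ (LinearMap.range (A.prod B)) = finrank ℝ (LinearMap.range A) +
      finrank ℝ ((LinearMap.ker A).map B) := by
  have h1 := LinearMap.finrank_range_add_finrank_ker (A.prod B)
  have h2 := LinearMap.finrank_range_add_finrank_ker A
  have h3 := LinearMap.finrank_range_add_finrank_ker (B ∘ₗ (LinearMap.ker A).subtype)
  rw [LinearMap.range_comp, Submodule.range_subtype] at h3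
  have h4 : finrank ℝ (LinearMap.ker (B ∘ₗ (LinearMap.ker A).subtype)) =
      finrank ℝ (LinearMap.ker (A.prod B)) := by
    rw [LinearMap.ker_prod, LinearMap.ker_comp]
    rw [← Submodule.map_comap_subtype]
    exact (Submodule.finrank_map_subtype_eq _ _).symm
  omega

/-- An isotropic subspace of `F × F*` has at most the dimension of `F`. -/
theorem finrank_range_prod_le {A : U →ₗ[ℝ] F} {B : U →ₗ[ℝ] Dual ℝ F}
    (h : ∀ v w, B v (A w) = B w (A v)) : finrank ℝ (LinearMap.range (A.prod B)) ≤ finrank ℝ F := by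
  -- Isotropy says exactly that `B` sends `ker A` into the annihilator of the range of `A`, whose
  -- dimension is the codimension of that range.
  have hle : (LinearMap.ker A).map B ≤ (LinearMap.range A).dualAnnihilator := by
    rintro _ ⟨v, hv, rfl⟩
    rw [Submodule.mem_dualAnnihilator]
    rintro _ ⟨w, rfl⟩
    rw [h, LinearMap.mem_ker.1 hv, map_zero]
  rw [finrank_range_prod, ← Subspace.finrank_add_finrank_dualAnnihilator_eq (LinearMap.range A)]
  exact Nat.add_le_add_left (Submodule.finrank_mono hle) _

/-- The hypothesis is the coisotropic counterpart: the annihilator of the range of `A` is contained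
in `B (ker A)`. Together with the isotropic bound it makes the rank of `(A, B)` equal to `dim F`. -/
theorem le_finrank_range_prod {A : U →ₗ[ℝ] F} {B : U →ₗ[ℝ] Dual ℝ F}
    (h : ∀ b : Dual ℝ F, (∀ v, b (A v) = 0) → ∃ v, A v = 0 ∧ B v = b) :
    finrank ℝ F ≤ finrank ℝ (LinearMap.range (A.prod B)) := by
  have hle : (LinearMap.range A).dualAnnihilator ≤ (LinearMap.ker A).map B := by
    intro b hb
    rw [Submodule.mem_dualAnnihilator] at hb
    obtain ⟨v, hv, hv'⟩ := h b fun v => hb _ ⟨v, rfl⟩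
    exact ⟨v, hv, hv'⟩
  rw [finrank_range_prod, ← Subspace.finrank_add_finrank_dualAnnihilator_eq (LinearMap.range A)]
  exact Nat.add_le_add_left (Submodule.finrank_mono hle) _

/-- If a functional vanishes on the `Q`-orthogonal of `K`, it is `Q κ` for some `κ ∈ K`. -/
theorem exists_mem_eq_of_orthogonal (Q : U →ₗ[ℝ] Dual ℝ U) (hQ : ∀ v w, Q v w = Q w v)
    (K : Submodule ℝ U) (b : Dual ℝ U) (hb : ∀ ξ, (∀ κ ∈ K, Q ξ κ = 0) → b ξ = 0) :
    ∃ κ ∈ K, Q κ = b := by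
  -- By symmetry of `Q`, its orthogonal of `K` is the coannihilator of `Q(K)`; a double annihilator
  -- in finite dimension gives back `Q(K)`.
  have : b ∈ (K.map Q).dualCoannihilator.dualAnnihilator := by
    rw [Submodule.mem_dualAnnihilator]
    intro ξ hξ
    rw [Submodule.mem_dualCoannihilator] at hξ
    exact hb ξ fun κ hκ => by rw [hQ]; exact hξ _ ⟨κ, hκ, rfl⟩
  rw [Subspace.dualCoannihilator_dualAnnihilator_eq] at this
  obtain ⟨κ, hκ, h⟩ := this
  exact ⟨κ, hκ, h⟩

end LinearAlgebra

/-! ### Lagrange multipliers on a clean fibrewise critical set -/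

section Multipliers

open Filter Topology

variable {V F : Type*} [NormedAddCommGroup V] [NormedSpace ℝ V] [FiniteDimensional ℝ V]
  [NormedAddCommGroup F] [NormedSpace ℝ F] [FiniteDimensional ℝ F]

/-- `x` is a critical point of `e` on the fibre of `P`, with Lagrange multiplier `β`. -/
def IsMultiplier (P : V → F) (e : V → ℝ) (x : V) (β : F →L[ℝ] ℝ) : Prop :=
  fderiv ℝ e x = β ∘L fderiv ℝ P x

/-- The fibrewise critical set of `e` is near `x₀` a manifold parametrized by `ψ`, and its
tangent space at `x₀` is given by the linearized equations. -/
structure IsCleanParam (P : V → F) (e : V → ℝ) {d : ℕ} (ψ : Euc d → V) (u₀ : Euc d) : Prop where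
  smooth : ContDiffAt ℝ 3 ψ u₀
  mem : ∀ᶠ u in 𝓝 u₀, ∃ β, IsMultiplier P e (ψ u) β
  image : ∀ W ∈ 𝓝 u₀, ∀ᶠ x in 𝓝 (ψ u₀), (∃ β, IsMultiplier P e x β) → x ∈ ψ '' W
  tangent : ∀ ξ b β, IsMultiplier P e (ψ u₀) β →
    fderiv ℝ (fderiv ℝ e) (ψ u₀) ξ =
      b ∘L fderiv ℝ P (ψ u₀) + β ∘L fderiv ℝ (fderiv ℝ P) (ψ u₀) ξ →
    ξ ∈ Set.range (fderiv ℝ ψ u₀)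

/-- The Lagrange multiplier is a smooth function of the point. -/
theorem exists_multiplier_function {P : V → F} {e : V → ℝ} {x₀ : V} (hP : ContDiffAt ℝ 3 P x₀)
    (he : ContDiffAt ℝ 3 e x₀) (hs : Function.Surjective (fderiv ℝ P x₀)) :
    ∃ b : V → F →L[ℝ] ℝ, (∀ᶠ x in 𝓝 x₀, ContDiffAt ℝ 2 b x) ∧
      ∀ᶠ x in 𝓝 x₀, ∀ β, IsMultiplier P e x β → b x = β := by
  have hP' : ∀ᶠ x in 𝓝 x₀, ContDiffAt ℝ 2 (fderiv ℝ P) x :=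
    (hP.eventually (by simp)).mono fun x hx => hx.fderiv_right (by norm_num)
  have he' : ∀ᶠ x in 𝓝 x₀, ContDiffAt ℝ 2 (fderiv ℝ e) x :=
    (he.eventually (by simp)).mono fun x hx => hx.fderiv_right (by norm_num)
  have hsurj : ∀ᶠ x in 𝓝 x₀, Function.Surjective (fderiv ℝ P x) := by
    obtain ⟨s, hs'⟩ := LinearMap.exists_rightInverse_of_surjective (fderiv ℝ P x₀).toLinearMap
      (LinearMap.range_eq_top.2 hs)
    have h1 : (fderiv ℝ P x₀) ∘L s.toContinuousLinearMap = ContinuousLinearMap.id ℝ F := by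
      ext1 v
      exact LinearMap.congr_fun hs' v
    have h2 : ∀ᶠ x in 𝓝 x₀, ((fderiv ℝ P x) ∘L s.toContinuousLinearMap).IsInvertible := by
      apply eventually_isInvertible
      · exact hP'.self_of_nhds.continuousAt.clm_comp continuousAt_const
      · rw [h1]
        exact ⟨ContinuousLinearEquiv.refl ℝ _, rfl⟩
    filter_upwards [h2] with x hx v
    obtain ⟨w, hw⟩ := hx.bijective.2 v
    exact ⟨_, hw⟩
  obtain ⟨R, hR1, hR2⟩ := exists_generalized_inverse hP' (Eventually.of_forall fun x => by
    rw [LinearMap.range_eq_top.2 hs, finrank_top]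
    exact Submodule.finrank_le _)
  -- Where the derivative of `P` is surjective, `R x` is a right inverse of it, so `de = β ∘ dP`
  -- forces `β = de ∘ R`. One derivative is lost, hence `C²`.
  refine ⟨fun x => fderiv ℝ e x ∘L R x, ?_, ?_⟩
  · filter_upwards [he', hR1] with x h1 h2 using h1.clm_comp h2
  · filter_upwards [hR2, hsurj] with x h1 h2 β hβ
    ext v
    obtain ⟨w, rfl⟩ := h2 v
    rw [hβ]
    simp [h1]

/-- Near a point where the fibrewise critical set is clean, points of it with prescribed value and
multiplier can be chosen smoothly. -/
theorem exists_critical_section {P : V → F} {e : V → ℝ} {d : ℕ} {ψ : Euc d → V} {u₀ : Euc d}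
    (hP : ContDiffAt ℝ 3 P (ψ u₀)) (he : ContDiffAt ℝ 3 e (ψ u₀))
    (hs : Function.Surjective (fderiv ℝ P (ψ u₀))) (hψ : IsCleanParam P e ψ u₀) :
    ∃ q : F × (F →L[ℝ] ℝ) → V, ∀ᶠ x in 𝓝 (ψ u₀), ∀ β, IsMultiplier P e x β →
      ContDiffAt ℝ 2 q (P x, β) ∧ P (q (P x, β)) = P x ∧ IsMultiplier P e (q (P x, β)) β ∧
      ContDiffAt ℝ 3 P (q (P x, β)) ∧ ContDiffAt ℝ 3 e (q (P x, β)) := by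
  obtain ⟨b, hb1, hb2⟩ := exists_multiplier_function hP he hs
  have hψc : Tendsto ψ (𝓝 u₀) (𝓝 (ψ u₀)) := hψ.smooth.continuousAt
  have h32 : (2 : WithTop ℕ∞) ≤ 3 := by norm_num
  -- everything that holds near `u₀`
  have hall : ∀ᶠ u in 𝓝 u₀, ContDiffAt ℝ 3 ψ u ∧ ContDiffAt ℝ 3 P (ψ u) ∧
      ContDiffAt ℝ 3 e (ψ u) ∧ ContDiffAt ℝ 2 b (ψ u) ∧ IsMultiplier P e (ψ u) (b (ψ u)) := by
    filter_upwards [hψ.smooth.eventually (by simp), hψc.eventually (hP.eventually (by simp)),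
      hψc.eventually (he.eventually (by simp)), hψc.eventually hb1, hψc.eventually hb2, hψ.mem]
      with u h1 h2 h3 h4 h5 h6
    obtain ⟨β, hβ⟩ := h6
    exact ⟨h1, h2, h3, h4, by rw [h5 β hβ]; exact hβ⟩
  -- In coordinates `f` is the map from the critical set to `T*N` whose image is `S_E`. It is shown
  -- to have constant rank `dim F`.
  let f : Euc d → F × (F →L[ℝ] ℝ) := fun u => (P (ψ u), b (ψ u))
  let A : Euc d → (Euc d →L[ℝ] F) := fun u => fderiv ℝ (fun u => P (ψ u)) u
  let B : Euc d → (Euc d →L[ℝ] (F →L[ℝ] ℝ)) := fun u => fderiv ℝ (fun u => b (ψ u)) u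
  have hA : ∀ᶠ u in 𝓝 u₀, ContDiffAt ℝ 3 (fun u => P (ψ u)) u :=
    hall.mono fun u hu => ContDiffAt.comp u hu.2.1 hu.1
  have hB : ∀ᶠ u in 𝓝 u₀, ContDiffAt ℝ 2 (fun u => b (ψ u)) u :=
    hall.mono fun u hu => ContDiffAt.comp u hu.2.2.2.1 (hu.1.of_le h32)
  have hf : ∀ᶠ u in 𝓝 u₀, ContDiffAt ℝ 2 f u := by
    filter_upwards [hA, hB] with u h1 h2 using (h1.of_le h32).prodMk h2
  have hf' : ∀ᶠ u in 𝓝 u₀, fderiv ℝ f u = (A u).prod (B u) := by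
    filter_upwards [hA, hB] with u h1 h2
    exact ((h1.differentiableAt (by simp)).hasFDerivAt.prodMk
      (h2.differentiableAt (by simp)).hasFDerivAt).fderiv
  have hAψ : ∀ᶠ u in 𝓝 u₀, A u = fderiv ℝ P (ψ u) ∘L fderiv ℝ ψ u := by
    filter_upwards [hall] with u hu
    exact fderiv_comp u (hu.2.1.differentiableAt (by simp)) (hu.1.differentiableAt (by simp))
  let toDual : (F →L[ℝ] ℝ) →ₗ[ℝ] Module.Dual ℝ F := LinearMap.toContinuousLinearMap.symm.toLinearMap
  -- the rank of `f` is that of the pair `(A, B)` with values in `F × F*`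
  have hrank : ∀ᶠ u in 𝓝 u₀, Module.finrank ℝ (LinearMap.range (fderiv ℝ f u).toLinearMap) =
      Module.finrank ℝ (LinearMap.range
        ((A u).toLinearMap.prod (toDual ∘ₗ (B u).toLinearMap))) := by
    filter_upwards [hf'] with u hu
    have : (A u).toLinearMap.prod (toDual ∘ₗ (B u).toLinearMap) =
        ((LinearEquiv.refl ℝ F).prodCongr (LinearMap.toContinuousLinearMap (𝕜 := ℝ) (E := F)
          (F' := ℝ)).symm).toLinearMap ∘ₗ (fderiv ℝ f u).toLinearMap := by
      rw [hu]; rfl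
    rw [this, LinearMap.range_comp, LinearEquiv.finrank_map_eq]
  -- isotropy bounds the rank near `u₀`
  have hiso : ∀ᶠ u in 𝓝 u₀, ∀ v w, B u v (A u w) = B u w (A u v) := by
    filter_upwards [hA.eventually_nhds, hB, hall.eventually_nhds] with u h1 h2 h3 v w
    -- On the critical set `d(e ∘ ψ) = b · d(P ∘ ψ)`: the tautological form pulls back to an exact
    -- form. Symmetry of the second derivatives, minus the symmetric term with the second derivative
    -- of `P ∘ ψ`, is isotropy.
    have hderiv : ∀ᶠ y in 𝓝 u, HasFDerivAt (fun u => e (ψ u)) (b (ψ y) ∘L A y) y := by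
      filter_upwards [h3, h1] with y hy hy'
      have h5 := (hy.2.2.1.differentiableAt (by simp)).hasFDerivAt.comp y
        (hy.1.differentiableAt (by simp)).hasFDerivAt
      have h6 : A y = fderiv ℝ P (ψ y) ∘L fderiv ℝ ψ y :=
        fderiv_comp y (hy.2.1.differentiableAt (by simp)) (hy.1.differentiableAt (by simp))
      have h7 : fderiv ℝ e (ψ y) = _ := hy.2.2.2.2
      rw [h6, ← ContinuousLinearMap.comp_assoc, ← h7]
      exact h5
    have hA' : HasFDerivAt A (fderiv ℝ A u) u :=
      ((h1.self_of_nhds.fderiv_right (m := 2) (by norm_num)).differentiableAt (by simp)).hasFDerivAt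
    have hB' : HasFDerivAt (fun u => b (ψ u)) (B u) u :=
      (h2.differentiableAt (by simp)).hasFDerivAt
    have hsymm := second_derivative_symmetric_of_eventually hderiv (hB'.clm_comp hA') v w
    have hsymmA : fderiv ℝ A u v w = fderiv ℝ A u w v :=
      (h1.self_of_nhds.of_le h32).isSymmSndFDerivAt (by simp) v w
    simp only [add_apply, ContinuousLinearMap.comp_apply,
      ContinuousLinearMap.compL_apply, ContinuousLinearMap.flip_apply] at hsymm
    rw [hsymmA] at hsymm
    linarith
  have hle : ∀ᶠ u in 𝓝 u₀, Module.finrank ℝ (LinearMap.range (fderiv ℝ f u).toLinearMap) ≤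
      Module.finrank ℝ F := by
    filter_upwards [hrank, hiso] with u h1 h2
    rw [h1]
    exact finrank_range_prod_le h2
  -- cleanness gives the rank at `u₀`
  have hge : Module.finrank ℝ F ≤
      Module.finrank ℝ (LinearMap.range (fderiv ℝ f u₀).toLinearMap) := by
    rw [hrank.self_of_nhds]
    apply le_finrank_range_prod
    intro c hc
    have hm : IsMultiplier P e (ψ u₀) (b (ψ u₀)) := hall.self_of_nhds.2.2.2.2
    -- `Q` is the Hessian of `e - β ∘ P` with the multiplier frozen. The linearized critical
    -- equations for `ξ` say that `Q ξ` factors through the derivative of `P`.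
    let Q : V →L[ℝ] V →L[ℝ] ℝ := fderiv ℝ (fderiv ℝ e) (ψ u₀) -
      (ContinuousLinearMap.compL ℝ V F ℝ (b (ψ u₀))) ∘L fderiv ℝ (fderiv ℝ P) (ψ u₀)
    have hQapp : ∀ ξ, fderiv ℝ (fderiv ℝ e) (ψ u₀) ξ =
        Q ξ + b (ψ u₀) ∘L fderiv ℝ (fderiv ℝ P) (ψ u₀) ξ := by
      intro ξ
      simp [Q]
    have hQs : ∀ v w, Q v w = Q w v := by
      intro v w
      have h1 : fderiv ℝ (fderiv ℝ e) (ψ u₀) v w = fderiv ℝ (fderiv ℝ e) (ψ u₀) w v :=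
        (he.of_le h32).isSymmSndFDerivAt (by simp) v w
      have h2 : fderiv ℝ (fderiv ℝ P) (ψ u₀) v w = fderiv ℝ (fderiv ℝ P) (ψ u₀) w v :=
        (hP.of_le h32).isSymmSndFDerivAt (by simp) v w
      simp [Q, h1, h2]
    have hQψ : ∀ v, Q (fderiv ℝ ψ u₀ v) = B u₀ v ∘L fderiv ℝ P (ψ u₀) := by
      intro v
      have hψd := (hψ.smooth.differentiableAt (by simp)).hasFDerivAt
      have h1 : HasFDerivAt (fun u => fderiv ℝ e (ψ u)) _ u₀ :=
        ((he.fderiv_right (m := 2) (by norm_num)).differentiableAt (by simp)).hasFDerivAt.comp u₀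
          hψd
      have h2 : HasFDerivAt (fun u => fderiv ℝ P (ψ u)) _ u₀ :=
        ((hP.fderiv_right (m := 2) (by norm_num)).differentiableAt (by simp)).hasFDerivAt.comp u₀
          hψd
      have h3 : HasFDerivAt (fun u => b (ψ u)) (B u₀) u₀ :=
        (hB.self_of_nhds.differentiableAt (by simp)).hasFDerivAt
      have h4 := h1.unique ((h3.clm_comp h2).congr_of_eventuallyEq
        (hall.mono fun u hu => hu.2.2.2.2))
      have h5 := DFunLike.congr_fun h4 v
      simp only [add_apply, ContinuousLinearMap.comp_apply,
        ContinuousLinearMap.compL_apply, ContinuousLinearMap.flip_apply, hQapp] at h5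
      rw [add_comm] at h5
      exact add_left_cancel h5
    -- Cleanness enters twice. If `Q ξ` kills `ker dP`, it factors through `dP`, so `ξ` is tangent
    -- to the critical set and `c (dP ξ) = 0` by the choice of `c`. Hence `c ∘ dP = Q κ` with `κ` in
    -- `ker dP`. Then `κ` is itself tangent, and it is the vector on which `A` vanishes and `B`
    -- equals `c`.
    obtain ⟨κ, hκ, hκc⟩ := exists_mem_eq_of_orthogonal
      ((LinearMap.toContinuousLinearMap (𝕜 := ℝ) (E := V) (F' := ℝ)).symm.toLinearMap
        ∘ₗ Q.toLinearMap) hQs (LinearMap.ker (fderiv ℝ P (ψ u₀)).toLinearMap)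
      (c ∘ₗ (fderiv ℝ P (ψ u₀)).toLinearMap) (by
        intro ξ hξ
        obtain ⟨s, hs'⟩ := LinearMap.exists_rightInverse_of_surjective
          (fderiv ℝ P (ψ u₀)).toLinearMap (LinearMap.range_eq_top.2 hs)
        have hs'' : ∀ w, fderiv ℝ P (ψ u₀) (s w) = w := LinearMap.congr_fun hs'
        obtain ⟨v, rfl⟩ := hψ.tangent ξ (Q ξ ∘L s.toContinuousLinearMap) _ hm (by
          rw [hQapp]
          congr 1
          ext w
          have := hξ (w - s (fderiv ℝ P (ψ u₀) w)) (by simp [hs''])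
          rw [map_sub, sub_eq_zero] at this
          exact this)
        have := hc v
        rwa [hAψ.self_of_nhds] at this)
    have hκc' : ∀ w, Q κ w = c (fderiv ℝ P (ψ u₀) w) := LinearMap.congr_fun hκc
    obtain ⟨v, rfl⟩ := hψ.tangent κ c.toContinuousLinearMap _ hm (by
      rw [hQapp]
      congr 1
      ext w
      exact hκc' w)
    refine ⟨v, ?_, ?_⟩
    · rw [hAψ.self_of_nhds]
      exact hκ
    · ext y
      obtain ⟨w, rfl⟩ := hs y
      rw [← hκc', hQψ]
      rfl
  obtain ⟨s, hs1, hs2, hs3⟩ := exists_local_section (n := 2) (by simp) hf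
    (hle.mono fun u hu => hu.trans hge)
  have hfc : Tendsto f (𝓝 u₀) (𝓝 (f u₀)) := hf.self_of_nhds.continuousAt
  have hsc : Tendsto s (𝓝 (f u₀)) (𝓝 u₀) := by
    have := hs2.self_of_nhds.continuousAt
    rwa [ContinuousAt, hs1] at this
  have hW : ∀ᶠ u in 𝓝 u₀, ContDiffAt ℝ 2 s (f u) ∧ f (s (f u)) = f u ∧
      (ContDiffAt ℝ 3 ψ (s (f u)) ∧ ContDiffAt ℝ 3 P (ψ (s (f u))) ∧
      ContDiffAt ℝ 3 e (ψ (s (f u))) ∧ ContDiffAt ℝ 2 b (ψ (s (f u))) ∧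
      IsMultiplier P e (ψ (s (f u))) (b (ψ (s (f u))))) :=
    (hfc.eventually hs2).and (hs3.and ((hsc.comp hfc).eventually hall))
  refine ⟨fun z => ψ (s z), ?_⟩
  -- Every critical point near `ψ u₀` is parametrized from inside the neighbourhood where the
  -- section `s` is controlled.
  filter_upwards [hb2, hψ.image _ hW] with x h1 h2 β hβ
  obtain ⟨u, ⟨hu1, hu2, hu3⟩, rfl⟩ := h2 ⟨β, hβ⟩
  have hfu : f u = (P (ψ u), β) := Prod.ext rfl (h1 β hβ)
  rw [hfu] at hu1 hu2 hu3
  have hu5 : b (ψ (s (P (ψ u), β))) = β := congrArg Prod.snd hu2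
  refine ⟨ContDiffAt.comp _ (hu3.1.of_le h32) hu1, congrArg Prod.fst hu2, ?_, hu3.2.1, hu3.2.2.1⟩
  have := hu3.2.2.2.2
  rwa [hu5] at this

end Multipliers

/-! ### Charts, coordinates of covectors -/

section Charts

set_option linter.unusedSectionVars false

open Filter Topology

variable {n : ℕ} {P : Type u} [TopologicalSpace P] [ChartedSpace (Euc n) P]
  [IsManifold (𝓡 n) ∞ P]

theorem contMDiffAt_chart_symm {p : P} {x : Euc n} (hx : x ∈ (extChartAt (𝓡 n) p).target) :
    ContMDiffAt 𝓘(ℝ, Euc n) (𝓡 n) ∞ (extChartAt (𝓡 n) p).symm x :=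
  (contMDiffOn_extChartAt_symm p).contMDiffAt ((isOpen_extChartAt_target p).mem_nhds hx)

theorem contMDiffAt_chart {p y : P} (hy : y ∈ (extChartAt (𝓡 n) p).source) :
    ContMDiffAt (𝓡 n) 𝓘(ℝ, Euc n) ∞ (extChartAt (𝓡 n) p) y :=
  contMDiffAt_extChartAt' (by rwa [extChartAt_source] at hy)

theorem mdifferentiableAt_chart_symm {p : P} {x : Euc n}
    (hx : x ∈ (extChartAt (𝓡 n) p).target) :
    MDifferentiableAt 𝓘(ℝ, Euc n) (𝓡 n) (extChartAt (𝓡 n) p).symm x :=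
  (contMDiffAt_chart_symm hx).mdifferentiableAt (by simp)

theorem mdifferentiableAt_chart {p y : P} (hy : y ∈ (extChartAt (𝓡 n) p).source) :
    MDifferentiableAt (𝓡 n) 𝓘(ℝ, Euc n) (extChartAt (𝓡 n) p) y :=
  (contMDiffAt_chart hy).mdifferentiableAt (by simp)

/-- The differential of the chart at `p`. -/
def toCoord (p y : P) : TangentSpace (𝓡 n) y →L[ℝ] Euc n :=
  mfderiv (𝓡 n) 𝓘(ℝ, Euc n) (extChartAt (𝓡 n) p) y

/-- The inverse of the differential of the chart at `p`. -/
def ofCoord (p y : P) : Euc n →L[ℝ] TangentSpace (𝓡 n) y :=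
  (mfderiv 𝓘(ℝ, Euc n) (𝓡 n) (extChartAt (𝓡 n) p).symm (extChartAt (𝓡 n) p y) :
    Euc n →L[ℝ] Euc n)

theorem toCoord_ofCoord {p y : P} (hy : y ∈ (extChartAt (𝓡 n) p).source) (v : Euc n) :
    toCoord p y (ofCoord p y v) = v := by
  have h := mfderiv_extChartAt_comp_mfderivWithin_extChartAt_symm' hy
  have hr : Set.range (𝓡 n) = Set.univ := by simp
  rw [hr, mfderivWithin_univ] at h
  exact DFunLike.congr_fun h v

theorem ofCoord_toCoord {p y : P} (hy : y ∈ (extChartAt (𝓡 n) p).source)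
    (v : TangentSpace (𝓡 n) y) : ofCoord p y (toCoord p y v) = v := by
  have h := mfderivWithin_extChartAt_symm_comp_mfderiv_extChartAt' hy
  have hr : Set.range (𝓡 n) = Set.univ := by simp
  rw [hr, mfderivWithin_univ] at h
  exact DFunLike.congr_fun h v

theorem mfderiv_chart_symm {p : P} {x : Euc n} (hx : x ∈ (extChartAt (𝓡 n) p).target)
    (v : Euc n) : mfderiv 𝓘(ℝ, Euc n) (𝓡 n) (extChartAt (𝓡 n) p).symm x v =
      ofCoord p ((extChartAt (𝓡 n) p).symm x) v := by
  -- The two base points agree only propositionally and the tangent space depends on them, so the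
  -- equality is stated in `Euc n` and proved by substitution.
  have h : ∀ x', x' = x → (mfderiv 𝓘(ℝ, Euc n) (𝓡 n) (extChartAt (𝓡 n) p).symm x v : Euc n) =
      (mfderiv 𝓘(ℝ, Euc n) (𝓡 n) (extChartAt (𝓡 n) p).symm x' v : Euc n) := by
    rintro _ rfl; rfl
  exact h _ ((extChartAt (𝓡 n) p).right_inv hx)

/-- The coordinates of a covector in the chart at `p`. -/
def covectorCoord (p : P) {y : P} (α : Cotangent n y) : Euc n →L[ℝ] ℝ :=
  ContinuousLinearMap.comp (α : TangentSpace (𝓡 n) y →L[ℝ] ℝ) (ofCoord p y)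

/-- The covector with coordinates `(x, ζ)` in the chart at `p`. -/
def covectorAt (p : P) (z : Euc n × (Euc n →L[ℝ] ℝ)) : CotangentBundle n P :=
  TotalSpace.mk' (Euc n →L[ℝ] ℝ) ((extChartAt (𝓡 n) p).symm z.1)
    (ContinuousLinearMap.comp z.2 (toCoord p ((extChartAt (𝓡 n) p).symm z.1)) :
      TangentSpace (𝓡 n) ((extChartAt (𝓡 n) p).symm z.1) →L[ℝ] ℝ)

theorem inCoordinates_eq_covectorCoord {p y : P} (hy : y ∈ (extChartAt (𝓡 n) p).source)
    (α : Cotangent n y) :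
    ContinuousLinearMap.inCoordinates (Euc n) (fun x : P => TangentSpace (𝓡 n) x) ℝ
      (Bundle.Trivial P ℝ) p y p y α = covectorCoord p α := by
  rw [extChartAt_source] at hy
  have h1 := TangentBundle.symmL_trivializationAt (𝕜 := ℝ) (I := 𝓡 n) hy
  have hr : Set.range (𝓡 n) = Set.univ := by simp
  rw [hr, mfderivWithin_univ] at h1
  ext v
  have h2 : (trivializationAt (Euc n) (fun x : P => TangentSpace (𝓡 n) x) p).symmL ℝ y v =
      ofCoord p y v := DFunLike.congr_fun h1 v
  change (trivializationAt ℝ (Bundle.Trivial P ℝ) p).continuousLinearMapAt ℝ y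
    (α ((trivializationAt (Euc n) (fun x : P => TangentSpace (𝓡 n) x) p).symmL ℝ y v)) =
      α (ofCoord p y v)
  rw [h2]
  exact DFunLike.congr_fun
    (Bundle.Trivial.continuousLinearMapAt_trivialization ℝ P ℝ y) _

/-- The hom-bundle trivialization at the base point of `f q` is given by chart coordinates, so
smoothness into `T*P` splits into smoothness of the base point and of the covector's coordinates. -/
theorem contMDiffAt_cotangent_iff {E' H' Q : Type*} [NormedAddCommGroup E'] [NormedSpace ℝ E']
    [TopologicalSpace H'] {I : ModelWithCorners ℝ E' H'} [TopologicalSpace Q] [ChartedSpace H' Q]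
    {k : WithTop ℕ∞} {f : Q → CotangentBundle n P} {q : Q} :
    ContMDiffAt I (cotangentModel n) k f q ↔
      ContMDiffAt I (𝓡 n) k (fun x => (f x).proj) q ∧
      ContMDiffAt I 𝓘(ℝ, Euc n →L[ℝ] ℝ) k (fun x => covectorCoord (f q).proj (f x).2) q := by
  rw [contMDiffAt_hom_bundle]
  refine and_congr_right fun h => Filter.EventuallyEq.contMDiffAt_iff ?_
  have : (extChartAt (𝓡 n) (f q).proj).source ∈ 𝓝 (f q).proj := extChartAt_source_mem_nhds _
  filter_upwards [h.continuousAt.preimage_mem_nhds this] with x hx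
  exact inCoordinates_eq_covectorCoord hx _

/-- The point is restricted to the centre of the chart because smoothness in `T*P` is tested in the
trivialization at the image's own base point, which is then `p`; there the fibre coordinate is just
the second projection. -/
theorem contMDiffAt_covectorAt (p : P) (ζ : Euc n →L[ℝ] ℝ) :
    ContMDiffAt 𝓘(ℝ, Euc n × (Euc n →L[ℝ] ℝ)) (cotangentModel n) ∞ (covectorAt p)
      (extChartAt (𝓡 n) p p, ζ) := by
  have hp : extChartAt (𝓡 n) p p ∈ (extChartAt (𝓡 n) p).target := mem_extChartAt_target p
  have hp' : (extChartAt (𝓡 n) p).symm (extChartAt (𝓡 n) p p) = p := extChartAt_to_inv p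
  rw [contMDiffAt_cotangent_iff]
  constructor
  · exact ContMDiffAt.comp (I' := 𝓘(ℝ, Euc n)) (g := (extChartAt (𝓡 n) p).symm) (f := Prod.fst)
      (extChartAt (𝓡 n) p p, ζ) (contMDiffAt_chart_symm hp) contDiff_fst.contMDiff.contMDiffAt
  · have h : (covectorAt p (extChartAt (𝓡 n) p p, ζ)).proj = p := hp'
    rw [h]
    refine ContMDiffAt.congr_of_eventuallyEq (f := fun z => z.2)
      contDiff_snd.contMDiff.contMDiffAt ?_
    have ho := ((isOpen_extChartAt_target (I := 𝓡 n) p).preimage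
      (continuous_fst (Y := Euc n →L[ℝ] ℝ))).mem_nhds (x := (extChartAt (𝓡 n) p p, ζ)) hp
    filter_upwards [ho] with z hz
    ext v
    exact congrArg z.2 (toCoord_ofCoord ((extChartAt (𝓡 n) p).map_target hz) v)

/-- The velocity of a curve. -/
def velocity {E' H' Q : Type*} [NormedAddCommGroup E'] [NormedSpace ℝ E']
    [TopologicalSpace H'] (I : ModelWithCorners ℝ E' H') [TopologicalSpace Q] [ChartedSpace H' Q]
    (c : ℝ → Q) : TangentBundle I Q :=
  TotalSpace.mk' E' (c 0) (mfderiv 𝓘(ℝ, ℝ) I c 0 (1 : ℝ))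

theorem velocity_comp {E' H' Q E'' H'' R : Type*} [NormedAddCommGroup E'] [NormedSpace ℝ E']
    [TopologicalSpace H'] {I : ModelWithCorners ℝ E' H'} [TopologicalSpace Q] [ChartedSpace H' Q]
    [NormedAddCommGroup E''] [NormedSpace ℝ E'']
    [TopologicalSpace H''] {J : ModelWithCorners ℝ E'' H''} [TopologicalSpace R]
    [ChartedSpace H'' R] {c : ℝ → Q} {g : Q → R} (hg : MDifferentiableAt I J g (c 0))
    (hc : MDifferentiableAt 𝓘(ℝ, ℝ) I c 0) :
    velocity J (fun t => g (c t)) = tangentMap I J g (velocity I c) := by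
  unfold velocity tangentMap
  have h := mfderiv_comp (0 : ℝ) hg hc
  have h' : (mfderiv 𝓘(ℝ, ℝ) J (fun t => g (c t)) 0 (1 : ℝ)) =
    mfderiv I J g (c 0) (mfderiv 𝓘(ℝ, ℝ) I c 0 (1 : ℝ)) := DFunLike.congr_fun h 1
  rw [h']

theorem velocity_eq_of_hasDerivAt {E' : Type*} [NormedAddCommGroup E'] [NormedSpace ℝ E']
    {c : ℝ → E'} {v : E'} (hc : HasDerivAt c v 0) :
    velocity 𝓘(ℝ, E') c = TotalSpace.mk' E' (c 0) v := by
  unfold velocity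
  have : mfderiv 𝓘(ℝ, ℝ) 𝓘(ℝ, E') c 0 (1 : ℝ) = v := by
    rw [mfderiv_eq_fderiv]
    exact hc.deriv
  rw [this]

end Charts

/-! ### Weak Morse families in coordinates -/

section MorseCoordinates

set_option linter.unusedSectionVars false

open Filter Topology

variable {m n : ℕ} {M : Type v} [TopologicalSpace M] [ChartedSpace (Euc m) M]
  [IsManifold (𝓡 m) ∞ M] {N : Type u} [TopologicalSpace N] [ChartedSpace (Euc n) N]
  [IsManifold (𝓡 n) ∞ N]

/-- The coordinate expression of a function in the chart at `p`. -/
def localFun (p : M) (E : M → ℝ) (x : Euc m) : ℝ := E ((extChartAt (𝓡 m) p).symm x)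

variable (n) in
/-- The coordinate expression of a map in the charts at `p` and `q`. -/
def localMap (p : M) (q : N) (f : M → N) (x : Euc m) : Euc n :=
  extChartAt (𝓡 n) q (f ((extChartAt (𝓡 m) p).symm x))

variable {p : M} {q : N} {x : Euc m}

theorem contDiffAt_localFun {E : M → ℝ} (hx : x ∈ (extChartAt (𝓡 m) p).target)
    (hE : ContMDiffAt (𝓡 m) 𝓘(ℝ, ℝ) ∞ E ((extChartAt (𝓡 m) p).symm x)) :
    ContDiffAt ℝ ∞ (localFun p E) x :=
  contMDiffAt_iff_contDiffAt.1 (ContMDiffAt.comp x hE (contMDiffAt_chart_symm hx))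

theorem fderiv_localFun {E : M → ℝ} (hx : x ∈ (extChartAt (𝓡 m) p).target)
    (hE : MDifferentiableAt (𝓡 m) 𝓘(ℝ, ℝ) E ((extChartAt (𝓡 m) p).symm x)) (v : Euc m) :
    fderiv ℝ (localFun p E) x v = mfderiv (𝓡 m) 𝓘(ℝ, ℝ) E ((extChartAt (𝓡 m) p).symm x)
      (ofCoord p ((extChartAt (𝓡 m) p).symm x) v) := by
  have h := DFunLike.congr_fun (mfderiv_comp x hE (mdifferentiableAt_chart_symm hx)) v
  rw [← mfderiv_chart_symm hx, ← mfderiv_eq_fderiv]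
  exact h

theorem contDiffAt_localMap {f : M → N} (hx : x ∈ (extChartAt (𝓡 m) p).target)
    (hf : ContMDiffAt (𝓡 m) (𝓡 n) ∞ f ((extChartAt (𝓡 m) p).symm x))
    (hq : f ((extChartAt (𝓡 m) p).symm x) ∈ (extChartAt (𝓡 n) q).source) :
    ContDiffAt ℝ ∞ (localMap n p q f) x :=
  contMDiffAt_iff_contDiffAt.1 (ContMDiffAt.comp x (contMDiffAt_chart hq)
    (ContMDiffAt.comp x hf (contMDiffAt_chart_symm hx)))

theorem fderiv_localMap {f : M → N} (hx : x ∈ (extChartAt (𝓡 m) p).target)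
    (hf : MDifferentiableAt (𝓡 m) (𝓡 n) f ((extChartAt (𝓡 m) p).symm x))
    (hq : f ((extChartAt (𝓡 m) p).symm x) ∈ (extChartAt (𝓡 n) q).source) (v : Euc m) :
    fderiv ℝ (localMap n p q f) x v = toCoord q (f ((extChartAt (𝓡 m) p).symm x))
      (mfderiv (𝓡 m) (𝓡 n) f ((extChartAt (𝓡 m) p).symm x)
        (ofCoord p ((extChartAt (𝓡 m) p).symm x) v)) := by
  have hs := mdifferentiableAt_chart_symm hx
  have h1 := DFunLike.congr_fun (mfderiv_comp x hf hs) v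
  have h2 := DFunLike.congr_fun (mfderiv_comp x (mdifferentiableAt_chart hq) (hf.comp x hs)) v
  rw [← mfderiv_chart_symm hx, ← mfderiv_eq_fderiv]
  exact h2.trans (congrArg _ h1)

theorem differential_eq_covectorAt {E : M → ℝ} (hx : x ∈ (extChartAt (𝓡 m) p).target)
    (hE : MDifferentiableAt (𝓡 m) 𝓘(ℝ, ℝ) E ((extChartAt (𝓡 m) p).symm x)) :
    differential m E ((extChartAt (𝓡 m) p).symm x) =
      covectorAt p (x, fderiv ℝ (localFun p E) x) := by
  unfold differential covectorAt
  congr 1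
  ext v
  exact ((fderiv_localFun hx hE _).trans
    (congrArg _ (ofCoord_toCoord ((extChartAt (𝓡 m) p).map_target hx) v))).symm

theorem contMDiff_differential {E : M → ℝ} (hE : ContMDiff (𝓡 m) 𝓘(ℝ, ℝ) ∞ E) :
    ContMDiff (𝓡 m) (cotangentModel m) ∞ (differential m E) := by
  intro p
  have hp := mem_extChartAt_source (I := 𝓡 m) p
  have h1 : ContMDiffAt (𝓡 m) 𝓘(ℝ, Euc m × (Euc m →L[ℝ] ℝ)) ∞
      (fun y => (extChartAt (𝓡 m) p y, fderiv ℝ (localFun p E) (extChartAt (𝓡 m) p y))) p := by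
    have h2 : ContDiffAt ℝ ∞ (fun x => (x, fderiv ℝ (localFun p E) x)) (extChartAt (𝓡 m) p p) :=
      contDiffAt_id.prodMk ((contDiffAt_localFun (mem_extChartAt_target p)
        hE.contMDiffAt).fderiv_right (by simp))
    exact ContMDiffAt.comp p h2.contMDiffAt (contMDiffAt_chart hp)
  have h3 := ContMDiffAt.comp p (contMDiffAt_covectorAt p _) h1
  refine h3.congr_of_eventuallyEq ?_
  filter_upwards [(isOpen_extChartAt_source (I := 𝓡 m) p).mem_nhds hp] with y hy
  have h4 := differential_eq_covectorAt (E := E) ((extChartAt (𝓡 m) p).map_source hy)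
    (hE.mdifferentiable (by simp) _)
  rw [(extChartAt (𝓡 m) p).left_inv hy] at h4
  exact h4

theorem surjective_fderiv_localMap {f : M → N} (hx : x ∈ (extChartAt (𝓡 m) p).target)
    (hf : MDifferentiableAt (𝓡 m) (𝓡 n) f ((extChartAt (𝓡 m) p).symm x))
    (hq : f ((extChartAt (𝓡 m) p).symm x) ∈ (extChartAt (𝓡 n) q).source)
    (hs : Function.Surjective (mfderiv (𝓡 m) (𝓡 n) f ((extChartAt (𝓡 m) p).symm x))) :
    Function.Surjective (fderiv ℝ (localMap n p q f) x) := by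
  intro w
  obtain ⟨v, hv⟩ := hs (ofCoord q _ w)
  refine ⟨toCoord p _ v, ?_⟩
  rw [fderiv_localMap hx hf hq, ofCoord_toCoord ((extChartAt (𝓡 m) p).map_target hx), hv,
    toCoord_ofCoord hq]

/-- A functional vanishing on the kernel of a surjection factors through it, here by means of a
linear right inverse. This translates membership of `dE` in the conormal bundle into the existence
of a Lagrange multiplier. -/
theorem covectorAt_mem_conormal_iff {f : M → N} (hx : x ∈ (extChartAt (𝓡 m) p).target)
    (hf : MDifferentiableAt (𝓡 m) (𝓡 n) f ((extChartAt (𝓡 m) p).symm x))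
    (hq : f ((extChartAt (𝓡 m) p).symm x) ∈ (extChartAt (𝓡 n) q).source)
    (hs : Function.Surjective (mfderiv (𝓡 m) (𝓡 n) f ((extChartAt (𝓡 m) p).symm x)))
    (ζ : Euc m →L[ℝ] ℝ) :
    covectorAt p (x, ζ) ∈ conormal m n f ↔
      ∃ β : Euc n →L[ℝ] ℝ, ζ = β ∘L fderiv ℝ (localMap n p q f) x := by
  have hy := (extChartAt (𝓡 m) p).map_target hx
  constructor
  · intro h
    obtain ⟨s, hs'⟩ := LinearMap.exists_rightInverse_of_surjective
      (fderiv ℝ (localMap n p q f) x).toLinearMap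
      (LinearMap.range_eq_top.2 (surjective_fderiv_localMap hx hf hq hs))
    have hs'' : ∀ w, fderiv ℝ (localMap n p q f) x (s w) = w := LinearMap.congr_fun hs'
    refine ⟨ζ ∘L s.toContinuousLinearMap, ?_⟩
    ext v
    have h0 : fderiv ℝ (localMap n p q f) x (v - s (fderiv ℝ (localMap n p q f) x v)) = 0 := by
      rw [map_sub, hs'', sub_self]
    rw [fderiv_localMap hx hf hq] at h0
    have h1 := congrArg (ofCoord q (f ((extChartAt (𝓡 m) p).symm x))) h0
    rw [ofCoord_toCoord hq, map_zero] at h1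
    have h2 := h _ h1
    have h3 : ζ (toCoord p ((extChartAt (𝓡 m) p).symm x) (ofCoord p ((extChartAt (𝓡 m) p).symm x)
      (v - s (fderiv ℝ (localMap n p q f) x v)))) = 0 := h2
    rw [toCoord_ofCoord hy, map_sub, sub_eq_zero] at h3
    exact h3
  · rintro ⟨β, rfl⟩
    have key : ∀ v : TangentSpace (𝓡 m) ((extChartAt (𝓡 m) p).symm x),
        mfderiv (𝓡 m) (𝓡 n) f ((extChartAt (𝓡 m) p).symm x) v = 0 →
        β (fderiv ℝ (localMap n p q f) x (toCoord p ((extChartAt (𝓡 m) p).symm x) v)) = 0 := by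
      intro v hv
      rw [fderiv_localMap hx hf hq, ofCoord_toCoord hy, hv, map_zero, map_zero]
    exact key

end MorseCoordinates

/-! ### From weak transversality to clean parametrizations in charts -/

section CleanParametrization

set_option linter.unusedSectionVars false

open Filter Topology

variable {m n : ℕ} {M : Type v} [TopologicalSpace M] [ChartedSpace (Euc m) M]
  [IsManifold (𝓡 m) ∞ M] {N : Type u} [TopologicalSpace N] [ChartedSpace (Euc n) N]
  [IsManifold (𝓡 n) ∞ N]

theorem eventually_mem_chart {pr : M → N} (h_pr : Continuous pr) {p : M} {q : N}
    {x : Euc m} (hx : x ∈ (extChartAt (𝓡 m) p).target)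
    (hq : pr ((extChartAt (𝓡 m) p).symm x) ∈ (extChartAt (𝓡 n) q).source) :
    ∀ᶠ x in 𝓝 x, x ∈ (extChartAt (𝓡 m) p).target ∧
      pr ((extChartAt (𝓡 m) p).symm x) ∈ (extChartAt (𝓡 n) q).source := by
  filter_upwards [(isOpen_extChartAt_target (I := 𝓡 m) p).mem_nhds hx,
    (h_pr.continuousAt.comp (contMDiffAt_chart_symm hx).continuousAt).preimage_mem_nhds
      ((isOpen_extChartAt_source q).mem_nhds hq)] with x h1 h2 using ⟨h1, h2⟩

theorem snd_velocity_eq_deriv {E' : Type*} [NormedAddCommGroup E'] [NormedSpace ℝ E']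
    (c : ℝ → E') : ((velocity 𝓘(ℝ, E') c).2 : E') = deriv c 0 := by
  unfold velocity
  rw [mfderiv_eq_fderiv]
  rfl

/-- The coordinates of the base point of a covector. -/
theorem contMDiffAt_chart_proj {p : M} {η : CotangentBundle m M}
    (hη : η.proj ∈ (extChartAt (𝓡 m) p).source) :
    ContMDiffAt (cotangentModel m) 𝓘(ℝ, Euc m) ∞
      (fun η : CotangentBundle m M => extChartAt (𝓡 m) p η.proj) η :=
  ContMDiffAt.comp (g := extChartAt (𝓡 m) p) (f := TotalSpace.proj) η (contMDiffAt_chart hη)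
    (Bundle.contMDiffAt_proj (fun x : M => Cotangent m x))

/-- The right side involves the curve only through its value and derivative at `0`; two coordinate
curves with the same first-order data therefore have the same velocity in `T(T*M)`. -/
theorem velocity_covectorAt {p : M} {z : ℝ → Euc m × (Euc m →L[ℝ] ℝ)} {ζ : Euc m →L[ℝ] ℝ}
    {w : Euc m × (Euc m →L[ℝ] ℝ)} (h0 : z 0 = (extChartAt (𝓡 m) p p, ζ)) (hz : HasDerivAt z w 0) :
    velocity (cotangentModel m) (fun t => covectorAt p (z t)) =
      TotalSpace.mk' (Euc m × (Euc m →L[ℝ] ℝ)) (covectorAt p (extChartAt (𝓡 m) p p, ζ))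
        (mfderiv 𝓘(ℝ, Euc m × (Euc m →L[ℝ] ℝ)) (cotangentModel m) (covectorAt p)
          (extChartAt (𝓡 m) p p, ζ) w) := by
  have hd : MDifferentiableAt 𝓘(ℝ, Euc m × (Euc m →L[ℝ] ℝ)) (cotangentModel m) (covectorAt p)
      (z 0) := by
    rw [h0]
    exact (contMDiffAt_covectorAt p ζ).mdifferentiableAt (by simp)
  rw [velocity_comp (I := 𝓘(ℝ, Euc m × (Euc m →L[ℝ] ℝ))) hd
    hz.differentiableAt.mdifferentiableAt, velocity_eq_of_hasDerivAt hz, h0]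
  rfl

/-- The vectors tangent to a clean intersection of `dE(M)` and `(ker Tpr)°` contain the solutions
of the linearized equations. -/
theorem exists_curve_of_linearized {pr : M → N} (h_pr : IsSurjectiveSubmersion m n pr) {E : M → ℝ}
    (hE : IsWeakMorseFamily m n pr E) {p : M} {q : N}
    (hp : differential m E p ∈ conormal m n pr) (hq : pr p ∈ (extChartAt (𝓡 n) q).source)
    {ξ : Euc m} {b β : Euc n →L[ℝ] ℝ}
    (hβ : IsMultiplier (localMap n p q pr) (localFun p E) (extChartAt (𝓡 m) p p) β)
    (hb : fderiv ℝ (fderiv ℝ (localFun p E)) (extChartAt (𝓡 m) p p) ξ =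
      b ∘L fderiv ℝ (localMap n p q pr) (extChartAt (𝓡 m) p p) +
        β ∘L fderiv ℝ (fderiv ℝ (localMap n p q pr)) (extChartAt (𝓡 m) p p) ξ) :
    ∃ x : ℝ → Euc m, x 0 = extChartAt (𝓡 m) p p ∧ HasDerivAt x ξ 0 ∧
      ∀ᶠ t in 𝓝 0, differential m E ((extChartAt (𝓡 m) p).symm (x t)) ∈ conormal m n pr := by
  set x₀ := extChartAt (𝓡 m) p p with hx₀
  have hpx : (extChartAt (𝓡 m) p).symm x₀ = p := extChartAt_to_inv p
  have hx₀t : x₀ ∈ (extChartAt (𝓡 m) p).target := mem_extChartAt_target p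
  have hq' : pr ((extChartAt (𝓡 m) p).symm x₀) ∈ (extChartAt (𝓡 n) q).source := by rwa [hpx]
  have hpd := h_pr.smooth.mdifferentiable (by simp)
  have hEd := hE.smooth.mdifferentiable (by simp)
  set ζ := fderiv ℝ (localFun p E) x₀ with hζ
  have hη : differential m E p = covectorAt p (x₀, ζ) := by
    rw [← differential_eq_covectorAt hx₀t (hEd _), hpx]
  have hEs : ContDiffAt ℝ ∞ (localFun p E) x₀ := contDiffAt_localFun hx₀t hE.smooth.contMDiffAt
  have hPs : ContDiffAt ℝ ∞ (localMap n p q pr) x₀ :=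
    contDiffAt_localMap hx₀t h_pr.smooth.contMDiffAt hq'
  have hEs' : ContDiffAt ℝ ∞ (fderiv ℝ (localFun p E)) x₀ := hEs.fderiv_right (by simp)
  have hPs' : ContDiffAt ℝ ∞ (fderiv ℝ (localMap n p q pr)) x₀ := hPs.fderiv_right (by simp)
  have hline : HasDerivAt (fun t : ℝ => x₀ + t • ξ) ξ 0 := by
    simpa using ((hasDerivAt_id (0 : ℝ)).smul_const ξ).const_add x₀
  have hlines : ContDiff ℝ ∞ (fun t : ℝ => x₀ + t • ξ) := by fun_prop
  have hline0 : x₀ + (0 : ℝ) • ξ = x₀ := by simp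
  have hlinec : Tendsto (fun t : ℝ => x₀ + t • ξ) (𝓝 0) (𝓝 x₀) := by
    have := hline.continuousAt
    rwa [ContinuousAt, hline0] at this
  have hnear := eventually_mem_chart h_pr.smooth.continuous hx₀t hq'
  let ζ' := fderiv ℝ (fderiv ℝ (localFun p E)) x₀ ξ
  let w := mfderiv 𝓘(ℝ, Euc m × (Euc m →L[ℝ] ℝ)) (cotangentModel m) (covectorAt p) (x₀, ζ) (ξ, ζ')
  -- a curve in `dE(M)`
  let z₁ : ℝ → Euc m × (Euc m →L[ℝ] ℝ) := fun t =>
    (x₀ + t • ξ, fderiv ℝ (localFun p E) (x₀ + t • ξ))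
  have hz₁0 : z₁ 0 = (x₀, ζ) := by simp [z₁, hζ]
  have hz₁s : ContDiffAt ℝ ∞ z₁ 0 := by
    refine hlines.contDiffAt.prodMk (ContDiffAt.comp (0 : ℝ) ?_ hlines.contDiffAt)
    rwa [hline0]
  have hz₁d : HasDerivAt z₁ (ξ, ζ') 0 := by
    refine hline.prodMk (HasFDerivAt.comp_hasDerivAt (0 : ℝ) ?_ hline)
    rw [hline0]
    exact (hEs'.differentiableAt (by simp)).hasFDerivAt
  -- a curve in the conormal bundle with the same velocity
  let z₂ : ℝ → Euc m × (Euc m →L[ℝ] ℝ) := fun t =>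
    (x₀ + t • ξ, (β + t • b) ∘L fderiv ℝ (localMap n p q pr) (x₀ + t • ξ))
  have hz₂0 : z₂ 0 = (x₀, ζ) := by
    have : ζ = β ∘L fderiv ℝ (localMap n p q pr) x₀ := hβ
    simp [z₂, this]
  have hz₂s : ContDiffAt ℝ ∞ z₂ 0 := by
    refine hlines.contDiffAt.prodMk (ContDiffAt.clm_comp (by fun_prop)
      (ContDiffAt.comp (0 : ℝ) ?_ hlines.contDiffAt))
    rwa [hline0]
  have hz₂d : HasDerivAt z₂ (ξ, ζ') 0 := by
    have h1 : HasDerivAt (fun t : ℝ => β + t • b) b 0 := by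
      simpa using ((hasDerivAt_id (0 : ℝ)).smul_const b).const_add β
    have h2 : HasDerivAt (fun t : ℝ => fderiv ℝ (localMap n p q pr) (x₀ + t • ξ))
        (fderiv ℝ (fderiv ℝ (localMap n p q pr)) x₀ ξ) 0 := by
      refine HasFDerivAt.comp_hasDerivAt (0 : ℝ) ?_ hline
      rw [hline0]
      exact (hPs'.differentiableAt (by simp)).hasFDerivAt
    have h3 := h1.clm_comp h2
    -- The product rule produces the right side of the linearized equation, so `hb` makes the two
    -- fibre velocities agree.
    have h4 : ζ' = _ := hb
    rw [h4]
    simp only [zero_smul, add_zero] at h3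
    exact hline.prodMk h3
  have hsm : ∀ z : ℝ → Euc m × (Euc m →L[ℝ] ℝ), z 0 = (x₀, ζ) → ContDiffAt ℝ ∞ z 0 →
      ContMDiffAt 𝓘(ℝ, ℝ) (cotangentModel m) ∞ (fun t => covectorAt p (z t)) 0 := by
    intro z hz hz'
    refine ContMDiffAt.comp (I' := 𝓘(ℝ, Euc m × (Euc m →L[ℝ] ℝ))) (g := covectorAt p)
      (f := z) (0 : ℝ) ?_ hz'.contMDiffAt
    rw [hz]
    exact contMDiffAt_covectorAt p ζ
  have hmem : covectorAt p (x₀, ζ) ∈ conormal m n pr ∩ Set.range (differential m E) :=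
    hη ▸ ⟨hp, ⟨p, rfl⟩⟩
  have hw : w ∈ tangentVectors (cotangentModel m)
      (conormal m n pr ∩ Set.range (differential m E)) (covectorAt p (x₀, ζ)) := by
    -- `w` is tangent to the conormal bundle through `z₂` and to `dE(M)` through `z₁`; clean
    -- intersection makes it the velocity of a curve in the intersection, whose projection to `M` is
    -- the required curve.
    rw [hE.weaklyTransverse.2 _ hmem]
    constructor
    · refine ⟨fun t => covectorAt p (z₂ t), congrArg _ hz₂0, hsm z₂ hz₂0 hz₂s, ?_,
        velocity_covectorAt hz₂0 hz₂d⟩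
      filter_upwards [hlinec.eventually hnear] with t ht
      exact (covectorAt_mem_conormal_iff ht.1 (hpd _) ht.2 (h_pr.submersion _) _).2 ⟨_, rfl⟩
    · refine ⟨fun t => covectorAt p (z₁ t), congrArg _ hz₁0, hsm z₁ hz₁0 hz₁s, ?_,
        velocity_covectorAt hz₁0 hz₁d⟩
      filter_upwards [hlinec.eventually hnear] with t ht
      exact ⟨_, differential_eq_covectorAt ht.1 (hEd _)⟩
  obtain ⟨c, hc0, hcs, hcm, hcv⟩ := hw
  have hproj : (covectorAt p (x₀, ζ)).proj ∈ (extChartAt (𝓡 m) p).source := by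
    rw [← hη]
    exact mem_extChartAt_source p
  have hG : ∀ η, η = covectorAt p (x₀, ζ) → MDifferentiableAt (cotangentModel m) 𝓘(ℝ, Euc m)
      (fun η : CotangentBundle m M => extChartAt (𝓡 m) p η.proj) η := by
    rintro _ rfl
    exact (contMDiffAt_chart_proj hproj).mdifferentiableAt (by simp)
  have hv1 := velocity_comp (hG _ hc0) (hcs.mdifferentiableAt (by simp))
  have hv2 := velocity_comp (c := fun t => covectorAt p (z₁ t)) (hG _ (congrArg _ hz₁0))
    ((hsm z₁ hz₁0 hz₁s).mdifferentiableAt (by simp))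
  rw [velocity_covectorAt hz₁0 hz₁d] at hv2
  have hv3 : velocity (cotangentModel m) c = TotalSpace.mk' (Euc m × (Euc m →L[ℝ] ℝ))
    (covectorAt p (x₀, ζ)) w := hcv
  rw [hv3, ← hv2] at hv1
  -- `c` and the lift of the straight line have the same velocity, hence their base curves have the
  -- same derivative, namely `ξ`.
  have hder : deriv (fun t => extChartAt (𝓡 m) p (c t).proj) 0 =
      deriv (fun t => extChartAt (𝓡 m) p (covectorAt p (z₁ t)).proj) 0 := by
    rw [← snd_velocity_eq_deriv, ← snd_velocity_eq_deriv]
    exact congrArg (fun τ : TangentBundle 𝓘(ℝ, Euc m) (Euc m) => (τ.2 : Euc m)) hv1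
  have hcx : DifferentiableAt ℝ (fun t => extChartAt (𝓡 m) p (c t).proj) 0 :=
    ((hG _ hc0).comp (0 : ℝ) (hcs.mdifferentiableAt (by simp))).differentiableAt
  refine ⟨fun t => extChartAt (𝓡 m) p (c t).proj, ?_, ?_, ?_⟩
  · change extChartAt (𝓡 m) p (c 0).proj = x₀
    rw [hc0, ← hη]
    rfl
  · have h1 : deriv (fun t => extChartAt (𝓡 m) p (covectorAt p (z₁ t)).proj) 0 = ξ := by
      refine (hline.congr_of_eventuallyEq ?_).deriv
      filter_upwards [hlinec.eventually hnear] with t ht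
      exact (extChartAt (𝓡 m) p).right_inv ht.1
    rw [← h1, ← hder]
    exact hcx.hasDerivAt
  · have hcc : Tendsto (fun t => (c t).proj) (𝓝 0) (𝓝 (c 0).proj) :=
      (FiberBundle.continuous_proj (Euc m →L[ℝ] ℝ) (fun x : M => Cotangent m x)).continuousAt.comp
        hcs.continuousAt
    have hsrc : (extChartAt (𝓡 m) p).source ∈ 𝓝 (c 0).proj :=
      (isOpen_extChartAt_source p).mem_nhds (by rw [hc0]; exact hproj)
    filter_upwards [hcm, hcc.eventually hsrc] with t ht hts
    obtain ⟨hA, y, hy⟩ := ht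
    have : (extChartAt (𝓡 m) p).symm (extChartAt (𝓡 m) p (c t).proj) = y := by
      rw [(extChartAt (𝓡 m) p).left_inv hts, ← hy]
      rfl
    rw [this, hy]
    exact hA

/-- If an immersion factors through `ψ` in the chart at `c₀`, then `ψ` is an immersion. -/
theorem injective_fderiv_of_factorization {E' H' : Type*} {Q : Type v} [NormedAddCommGroup E']
    [NormedSpace ℝ E'] [TopologicalSpace H'] {I : ModelWithCorners ℝ E' H'} [TopologicalSpace Q]
    [ChartedSpace H' Q] (C : ImmersedSubmanifold I Q) (c₀ : C.carrier) {g : Euc m → Q}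
    {ψ : Euc C.dim → Euc m} (hψ : DifferentiableAt ℝ ψ (extChartAt (𝓡 C.dim) c₀ c₀))
    (hg : MDifferentiableAt 𝓘(ℝ, Euc m) I g (ψ (extChartAt (𝓡 C.dim) c₀ c₀)))
    (h : ∀ᶠ u in 𝓝 (extChartAt (𝓡 C.dim) c₀ c₀),
      g (ψ u) = C.incl ((extChartAt (𝓡 C.dim) c₀).symm u)) :
    Function.Injective (fderiv ℝ ψ (extChartAt (𝓡 C.dim) c₀ c₀)) := by
  rw [injective_iff_map_eq_zero]
  intro v hv
  set u₀ := extChartAt (𝓡 C.dim) c₀ c₀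
  have hu₀ : u₀ ∈ (extChartAt (𝓡 C.dim) c₀).target := mem_extChartAt_target c₀
  have h1 := hg.hasMFDerivAt.comp u₀ hψ.hasFDerivAt.hasMFDerivAt
  have h2 := (h1.congr_of_eventuallyEq (h.mono fun u hu => hu.symm)).mfderiv
  have h3 : mfderiv 𝓘(ℝ, Euc C.dim) I
      (fun u => C.incl ((extChartAt (𝓡 C.dim) c₀).symm u)) u₀ v = 0 := by
    rw [h2]
    exact (congrArg (mfderiv 𝓘(ℝ, Euc m) I g (ψ u₀)) hv).trans (ContinuousLinearMap.map_zero _)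
  have h4 := DFunLike.congr_fun (mfderiv_comp u₀ (C.incl_smooth.mdifferentiable (by simp) _)
    (mdifferentiableAt_chart_symm hu₀)) v
  have h5 : mfderiv 𝓘(ℝ, Euc C.dim) (𝓡 C.dim) (extChartAt (𝓡 C.dim) c₀).symm u₀ v = 0 :=
    C.incl_immersion _ ((h4.symm.trans h3).trans (ContinuousLinearMap.map_zero _).symm)
  rw [mfderiv_chart_symm hu₀] at h5
  have h6 := congrArg (toCoord c₀ ((extChartAt (𝓡 C.dim) c₀).symm u₀)) h5
  rwa [toCoord_ofCoord ((extChartAt (𝓡 C.dim) c₀).map_target hu₀), map_zero] at h6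

/-- The fibrewise critical set of a weak Morse family has clean local parametrizations. -/
theorem exists_cleanParam {pr : M → N} (h_pr : IsSurjectiveSubmersion m n pr) {E : M → ℝ}
    (hE : IsWeakMorseFamily m n pr E) {p : M} {q : N}
    (hp : differential m E p ∈ conormal m n pr) (hq : pr p ∈ (extChartAt (𝓡 n) q).source) :
    ∃ (d : ℕ) (ψ : Euc d → Euc m) (u₀ : Euc d), ψ u₀ = extChartAt (𝓡 m) p p ∧
      IsCleanParam (localMap n p q pr) (localFun p E) ψ u₀ := by
  have hpd := h_pr.smooth.mdifferentiable (by simp)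
  have hEd := hE.smooth.mdifferentiable (by simp)
  have hpx : (extChartAt (𝓡 m) p).symm (extChartAt (𝓡 m) p p) = p := extChartAt_to_inv p
  have hxt : extChartAt (𝓡 m) p p ∈ (extChartAt (𝓡 m) p).target := mem_extChartAt_target p
  have hnear : ∀ᶠ x in 𝓝 (extChartAt (𝓡 m) p p), x ∈ (extChartAt (𝓡 m) p).target ∧
      pr ((extChartAt (𝓡 m) p).symm x) ∈ (extChartAt (𝓡 n) q).source :=
    eventually_mem_chart h_pr.smooth.continuous hxt (by rwa [hpx])
  have hmult : ∀ x, x ∈ (extChartAt (𝓡 m) p).target →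
      pr ((extChartAt (𝓡 m) p).symm x) ∈ (extChartAt (𝓡 n) q).source →
      ((∃ β, IsMultiplier (localMap n p q pr) (localFun p E) x β) ↔
        differential m E ((extChartAt (𝓡 m) p).symm x) ∈ conormal m n pr) := by
    intro x hx hx'
    rw [differential_eq_covectorAt hx (hEd _),
      covectorAt_mem_conormal_iff hx (hpd _) hx' (h_pr.submersion _)]
    rfl
  obtain ⟨U, hU, hpU, C, hCe, hCr⟩ := hE.weaklyTransverse.1 _ ⟨hp, ⟨p, rfl⟩⟩
  obtain ⟨c₀, hc₀⟩ : differential m E p ∈ Set.range C.incl := hCr ▸ ⟨⟨hp, ⟨p, rfl⟩⟩, hpU⟩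
  have hCm : ∀ c, C.incl c ∈ conormal m n pr ∧ differential m E (C.incl c).proj = C.incl c := by
    intro c
    have : C.incl c ∈ Set.range C.incl := ⟨c, rfl⟩
    rw [hCr] at this
    obtain ⟨⟨h1, y, hy⟩, -⟩ := this
    refine ⟨h1, ?_⟩
    rw [← hy]
    rfl
  let φ := (extChartAt (𝓡 C.dim) c₀).symm
  let u₀ := extChartAt (𝓡 C.dim) c₀ c₀
  have hu₀ : u₀ ∈ (extChartAt (𝓡 C.dim) c₀).target := mem_extChartAt_target c₀
  have hφ₀ : φ u₀ = c₀ := extChartAt_to_inv c₀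
  -- The parametrization of the critical set in `M` is the projection of a chart of the clean
  -- intersection in `T*M`. Since `dE` lifts it back, nothing is lost in projecting.
  let ψ : Euc C.dim → Euc m := fun u => extChartAt (𝓡 m) p (C.incl (φ u)).proj
  have hψ₀ : ψ u₀ = extChartAt (𝓡 m) p p := by
    change extChartAt (𝓡 m) p (C.incl (φ u₀)).proj = _
    rw [hφ₀, hc₀]
    rfl
  have hincl : ContMDiffAt 𝓘(ℝ, Euc C.dim) (cotangentModel m) ∞ (fun u => C.incl (φ u)) u₀ :=
    ContMDiffAt.comp u₀ C.incl_smooth.contMDiffAt (contMDiffAt_chart_symm hu₀)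
  have hproj₀ : (C.incl (φ u₀)).proj = p := by
    rw [hφ₀, hc₀]
    rfl
  have hψs : ContDiffAt ℝ ∞ ψ u₀ := by
    refine contMDiffAt_iff_contDiffAt.1 (ContMDiffAt.comp
      (g := fun η : CotangentBundle m M => extChartAt (𝓡 m) p η.proj) u₀
      (contMDiffAt_chart_proj ?_) hincl)
    rw [hproj₀]
    exact mem_extChartAt_source p
  have hψc : Tendsto ψ (𝓝 u₀) (𝓝 (extChartAt (𝓡 m) p p)) := by
    have := hψs.continuousAt
    rwa [ContinuousAt, hψ₀] at this
  have hsrc : ∀ᶠ u in 𝓝 u₀, (C.incl (φ u)).proj ∈ (extChartAt (𝓡 m) p).source := by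
    have h1 : ContinuousAt (fun u => (C.incl (φ u)).proj) u₀ :=
      (FiberBundle.continuous_proj (Euc m →L[ℝ] ℝ)
        (fun x : M => Cotangent m x)).continuousAt.comp hincl.continuousAt
    refine h1.preimage_mem_nhds ((isOpen_extChartAt_source p).mem_nhds ?_)
    rw [hproj₀]
    exact mem_extChartAt_source p
  have hlift : ∀ᶠ u in 𝓝 u₀,
      differential m E ((extChartAt (𝓡 m) p).symm (ψ u)) = C.incl (φ u) := by
    filter_upwards [hsrc] with u hu
    have : (extChartAt (𝓡 m) p).symm (ψ u) = (C.incl (φ u)).proj :=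
      (extChartAt (𝓡 m) p).left_inv hu
    rw [this]
    exact (hCm _).2
  have himage : ∀ W ∈ 𝓝 u₀, ∀ᶠ x in 𝓝 (extChartAt (𝓡 m) p p),
      (differential m E ((extChartAt (𝓡 m) p).symm x) ∈ conormal m n pr) → x ∈ ψ '' W := by
    intro W hW
    have hW' : (extChartAt (𝓡 C.dim) c₀).source ∩ extChartAt (𝓡 C.dim) c₀ ⁻¹' W ∈ 𝓝 c₀ :=
      Filter.inter_mem (extChartAt_source_mem_nhds c₀)
        ((continuousAt_extChartAt c₀).preimage_mem_nhds hW)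
    -- Embeddedness is needed here: a neighbourhood in the intrinsic topology of `C` is cut out by a
    -- neighbourhood in `T*M`, so nearby critical points have nearby parameters.
    rw [hCe.isInducing.nhds_eq_comap, hc₀] at hW'
    obtain ⟨V, hV, hVW⟩ := hW'
    have hcont : ContinuousAt (fun x => differential m E ((extChartAt (𝓡 m) p).symm x))
        (extChartAt (𝓡 m) p p) :=
      ((contMDiff_differential hE.smooth).continuous.continuousAt).comp
        (contMDiffAt_chart_symm hxt).continuousAt
    have hV' : V ∩ U ∈ 𝓝 (differential m E ((extChartAt (𝓡 m) p).symm
        (extChartAt (𝓡 m) p p))) := by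
      rw [hpx]
      exact Filter.inter_mem hV (hU.mem_nhds hpU)
    filter_upwards [hcont.preimage_mem_nhds hV', hnear] with x hx hxn hxc
    have : differential m E ((extChartAt (𝓡 m) p).symm x) ∈ Set.range C.incl :=
      hCr ▸ ⟨⟨hxc, ⟨_, rfl⟩⟩, hx.2⟩
    obtain ⟨c, hc⟩ := this
    have hcV : c ∈ C.incl ⁻¹' V := by
      rw [Set.mem_preimage, hc]
      exact hx.1
    obtain ⟨hc1, hc2⟩ := hVW hcV
    refine ⟨_, hc2, ?_⟩
    change extChartAt (𝓡 m) p (C.incl (φ (extChartAt (𝓡 C.dim) c₀ c))).proj = x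
    rw [(extChartAt (𝓡 C.dim) c₀).left_inv hc1, hc]
    exact (extChartAt (𝓡 m) p).right_inv hxn.1
  have hinj : Function.Injective (fderiv ℝ ψ u₀) := by
    refine injective_fderiv_of_factorization C c₀
      (g := fun x => differential m E ((extChartAt (𝓡 m) p).symm x))
      (hψs.differentiableAt (by simp)) ?_ hlift
    change MDifferentiableAt 𝓘(ℝ, Euc m) (cotangentModel m) _ (ψ u₀)
    rw [hψ₀]
    exact (ContMDiffAt.comp (extChartAt (𝓡 m) p p)
      (contMDiff_differential hE.smooth).contMDiffAt
      (contMDiffAt_chart_symm hxt)).mdifferentiableAt (by simp)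
  refine ⟨C.dim, ψ, u₀, hψ₀, hψs.of_le ENat.LEInfty.out, ?_, ?_, ?_⟩
  · filter_upwards [hlift, hψc.eventually hnear] with u hu hn
    rw [hmult _ hn.1 hn.2, hu]
    exact (hCm _).1
  · intro W hW
    rw [hψ₀]
    filter_upwards [himage W hW, hnear] with x hx hn hβ
    exact hx ((hmult x hn.1 hn.2).1 hβ)
  · intro ξ b β hβ hb
    rw [hψ₀] at hβ hb
    obtain ⟨x, hx0, hxd, hxm⟩ := exists_curve_of_linearized h_pr hE hp hq hβ hb
    obtain ⟨g, hg0, hgs, hgl⟩ := exists_local_left_inverse (n := 1) (by simp)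
      ((hψs.of_le (m := 1) ENat.LEInfty.out).eventually (by simp)) hinj
    have hxc : Tendsto x (𝓝 0) (𝓝 (extChartAt (𝓡 m) p p)) := hx0 ▸ hxd.continuousAt
    -- The curve stays in the critical set, hence in the image of `ψ`, on which `ψ ∘ g` is the
    -- identity. Differentiating `ψ ∘ g ∘ x = x` at `0` puts `ξ` in the range of the derivative of
    -- `ψ`.
    have hxg : ∀ᶠ t in 𝓝 0, ψ (g (x t)) = x t := by
      filter_upwards [hxc.eventually (himage _ hgl), hxm] with t ht1 ht2
      obtain ⟨u, hu, hux⟩ := ht1 ht2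
      have hu' : g (ψ u) = u := hu
      rw [← hux, hu']
    have hgd : HasFDerivAt g (fderiv ℝ g (x 0)) (x 0) := by
      rw [hx0, ← hψ₀]
      exact (hgs.self_of_nhds.differentiableAt (by simp)).hasFDerivAt
    have hgx0 : g (x 0) = u₀ := by rw [hx0, ← hψ₀, hg0]
    have hψd : HasFDerivAt ψ (fderiv ℝ ψ u₀) (g (x 0)) := by
      rw [hgx0]
      exact (hψs.differentiableAt (by simp)).hasFDerivAt
    have h1 := hψd.comp_hasDerivAt (0 : ℝ) (hgd.comp_hasDerivAt (0 : ℝ) hxd)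
    exact ⟨_, (h1.congr_of_eventuallyEq (hxg.mono fun t ht => ht.symm)).unique hxd⟩

end CleanParametrization

/-! ### Pullbacks of the tautological form along maps into `S_E` are closed -/

section Closedness

set_option linter.unusedSectionVars false

open Filter Topology

section Euclidean

variable {V F G : Type*} [NormedAddCommGroup V] [NormedSpace ℝ V] [FiniteDimensional ℝ V]
  [NormedAddCommGroup F] [NormedSpace ℝ F] [FiniteDimensional ℝ F]
  [NormedAddCommGroup G] [NormedSpace ℝ G] [FiniteDimensional ℝ G]

/-- If the pairs `(κ y, μ y)` lift smoothly to critical points, the form `κ^*μ` is closed. -/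
theorem fderiv_symm_of_lift {P : V → F} {e : V → ℝ} {q : F × (F →L[ℝ] ℝ) → V} {κ : G → F}
    {μ : G → F →L[ℝ] ℝ} {y₀ : G} (hκ : ∀ᶠ y in 𝓝 y₀, ContDiffAt ℝ 3 κ y)
    (hμ : ∀ᶠ y in 𝓝 y₀, ContDiffAt ℝ 3 μ y)
    (hq : ∀ᶠ y in 𝓝 y₀, ContDiffAt ℝ 2 q (κ y, μ y) ∧ P (q (κ y, μ y)) = κ y ∧
      IsMultiplier P e (q (κ y, μ y)) (μ y) ∧ ContDiffAt ℝ 3 P (q (κ y, μ y)) ∧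
      ContDiffAt ℝ 3 e (q (κ y, μ y))) (u w : G) :
    fderiv ℝ (fun y => μ y ∘L fderiv ℝ κ y) y₀ u w =
      fderiv ℝ (fun y => μ y ∘L fderiv ℝ κ y) y₀ w u := by
  -- With `Q y = q (κ y, μ y)`, the chain rule gives `d(e ∘ Q) = μ ∘ dP ∘ dQ = μ ∘ dκ`, because `P ∘
  -- Q = κ`. The form thus has the potential `e ∘ Q`.
  have hd : ∀ᶠ y in 𝓝 y₀, HasFDerivAt (fun y => e (q (κ y, μ y))) (μ y ∘L fderiv ℝ κ y) y := by
    filter_upwards [hκ, hμ, hq, hq.eventually_nhds] with y h1 h2 h3 h4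
    have hκd := (h1.differentiableAt (by simp)).hasFDerivAt
    have hQ := (h3.1.differentiableAt (by simp)).hasFDerivAt.comp y
      (hκd.prodMk (h2.differentiableAt (by simp)).hasFDerivAt)
    have hP := (h3.2.2.2.1.differentiableAt (by simp)).hasFDerivAt.comp y hQ
    have hPκ := hκd.unique (hP.congr_of_eventuallyEq (h4.mono fun z hz => hz.2.1.symm))
    have he := (h3.2.2.2.2.differentiableAt (by simp)).hasFDerivAt.comp y hQ
    have hm : fderiv ℝ e (q (κ y, μ y)) = _ := h3.2.2.1
    rw [hm, ContinuousLinearMap.comp_assoc, ← hPκ] at he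
    exact he
  have hκ0 : DifferentiableAt ℝ (fderiv ℝ κ) y₀ :=
    (hκ.self_of_nhds.fderiv_right (m := 2) (by norm_num)).differentiableAt (by simp)
  have hμ0 : DifferentiableAt ℝ μ y₀ := hμ.self_of_nhds.differentiableAt (by simp)
  exact second_derivative_symmetric_of_eventually hd (hμ0.clm_comp hκ0).hasFDerivAt u w

/-- The set is the projection to `G` of a closed subset of the compact set `K ×ˢ C`. Restricting the
critical points to a compact `C` is what makes Baire's theorem applicable. -/
theorem isClosed_setOf_exists_multiplier {P : V → F} {e : V → ℝ} {κ : G → F} {μ : G → F →L[ℝ] ℝ}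
    {K : Set G} {C : Set V} (hK : IsCompact K) (hC : IsCompact C)
    (hκ : ContinuousOn κ K) (hμ : ContinuousOn μ K) (hP : ContinuousOn P C)
    (hP' : ContinuousOn (fderiv ℝ P) C) (he' : ContinuousOn (fderiv ℝ e) C) :
    IsClosed {y | y ∈ K ∧ ∃ x ∈ C, P x = κ y ∧ IsMultiplier P e x (μ y)} := by
  let f : G × V → F × (V →L[ℝ] ℝ) := fun z =>
    (P z.2 - κ z.1, fderiv ℝ e z.2 - μ z.1 ∘L fderiv ℝ P z.2)
  have h1 : Set.MapsTo Prod.fst (K ×ˢ C) K := fun z hz => hz.1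
  have h2 : Set.MapsTo Prod.snd (K ×ˢ C) C := fun z hz => hz.2
  have hf : ContinuousOn f (K ×ˢ C) :=
    ((hP.comp continuousOn_snd h2).sub (hκ.comp continuousOn_fst h1)).prodMk
      ((he'.comp continuousOn_snd h2).sub
        ((hμ.comp continuousOn_fst h1).clm_comp (hP'.comp continuousOn_snd h2)))
  have hcl : IsClosed (K ×ˢ C ∩ f ⁻¹' {0}) :=
    hf.preimage_isClosed_of_isClosed (hK.prod hC).isClosed isClosed_singleton
  have hcp : IsCompact (K ×ˢ C ∩ f ⁻¹' {0}) := (hK.prod hC).of_isClosed_subset hcl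
    Set.inter_subset_left
  convert (hcp.image continuous_fst).isClosed using 1
  ext y
  constructor
  · rintro ⟨hy, x, hx, hxy, hm⟩
    refine ⟨(y, x), ⟨⟨hy, hx⟩, ?_⟩, rfl⟩
    have hm' : fderiv ℝ e x = _ := hm
    simp [f, hxy, hm']
  · rintro ⟨⟨y', x⟩, ⟨⟨hy, hx⟩, hf0⟩, rfl⟩
    exact ⟨hy, x, hx, sub_eq_zero.1 (congrArg Prod.fst hf0), sub_eq_zero.1 (congrArg Prod.snd hf0)⟩

/-- If a nonempty open set is covered by countably many relatively closed conditions, one of them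
holds near some point. -/
theorem exists_eventually_of_countable_cover {ι : Type*} {t : Set ι} (ht : t.Countable)
    {O : Set G} (hO : IsOpen O) (hne : O.Nonempty) {p : ι → G → Prop}
    (hcl : ∀ K ⊆ O, IsCompact K → ∀ i ∈ t, IsClosed {y | y ∈ K ∧ p i y})
    (hcov : ∀ y ∈ O, ∃ i ∈ t, p i y) : ∃ i ∈ t, ∃ y ∈ O, ∀ᶠ y' in 𝓝 y, p i y' := by
  obtain ⟨y₁, hy₁⟩ := hne
  obtain ⟨r, hr, hball⟩ := Metric.isOpen_iff.1 hO y₁ hy₁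
  have hK : Metric.closedBall y₁ (r / 2) ⊆ O :=
    (Metric.closedBall_subset_ball (by linarith)).trans hball
  have hKc : IsCompact (Metric.closedBall y₁ (r / 2)) := isCompact_closedBall _ _
  have := ht.to_subtype
  have : CompleteSpace G := FiniteDimensional.complete ℝ G
  -- The extra index `none` carries the complement of the ball, so that the closed sets cover all of
  -- `G`. It is harmless: an interior point of that complement cannot lie in the ball.
  let f : Option t → Set G := fun o => o.elim (Metric.ball y₁ (r / 2))ᶜ
    fun i => {y | y ∈ Metric.closedBall y₁ (r / 2) ∧ p i y}
  have hf : ∀ o, IsClosed (f o) := by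
    rintro (_ | ⟨i, hi⟩)
    · exact Metric.isOpen_ball.isClosed_compl
    · exact hcl _ hK hKc i hi
  have hU : ⋃ o, f o = Set.univ := by
    refine Set.eq_univ_of_forall fun y => Set.mem_iUnion.2 ?_
    by_cases hy : y ∈ Metric.ball y₁ (r / 2)
    · obtain ⟨i, hi, hp⟩ := hcov y (hK (Metric.ball_subset_closedBall hy))
      exact ⟨some ⟨i, hi⟩, Metric.ball_subset_closedBall hy, hp⟩
    · exact ⟨none, hy⟩
  obtain ⟨y, hyb, hyU⟩ := (dense_iUnion_interior_of_closed hf hU).exists_mem_open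
    (Metric.isOpen_ball (x := y₁) (ε := r / 2)) ⟨y₁, Metric.mem_ball_self (by linarith)⟩
  obtain ⟨o, ho⟩ := Set.mem_iUnion.1 hyb
  rcases o with _ | ⟨i, hi⟩
  · exact absurd hyU (interior_subset ho)
  · refine ⟨i, hi, y, hK (Metric.ball_subset_closedBall hyU), ?_⟩
    filter_upwards [mem_interior_iff_mem_nhds.1 ho] with y' hy' using hy'.2

end Euclidean

/-! ### Smooth lifting of 1-forms with values in `S_E` -/

section Manifold

variable {m n : ℕ} {M : Type v} [TopologicalSpace M] [ChartedSpace (Euc m) M]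
  [IsManifold (𝓡 m) ∞ M] {N : Type u} [TopologicalSpace N] [ChartedSpace (Euc n) N]
  [IsManifold (𝓡 n) ∞ N]

/-- The defining relation of `j_π`, read in coordinates, is the multiplier equation. The charts are
arbitrary because the critical point found over `ν` will be viewed in the chart of some other point
of a countable family. -/
theorem exists_multiplier_of_mem_lagrangianOf {pr : M → N}
    (h_pr : IsSurjectiveSubmersion m n pr) {E : M → ℝ} (hE : IsWeakMorseFamily m n pr E)
    {ν : CotangentBundle n N} (hν : ν ∈ lagrangianOf m n pr E) :
    ∃ p, differential m E p ∈ conormal m n pr ∧ pr p = ν.proj ∧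
      ∀ (p₀ : M) (q : N), p ∈ (extChartAt (𝓡 m) p₀).source → ν.proj ∈ (extChartAt (𝓡 n) q).source →
        localMap n p₀ q pr (extChartAt (𝓡 m) p₀ p) = extChartAt (𝓡 n) q ν.proj ∧
        IsMultiplier (localMap n p₀ q pr) (localFun p₀ E) (extChartAt (𝓡 m) p₀ p)
          (covectorCoord q ν.2) := by
  obtain ⟨_, ⟨⟨p, rfl⟩, hc⟩, β, hβ, rfl⟩ := hν
  refine ⟨p, hc, rfl, fun p₀ q hp hq => ⟨?_, ?_⟩⟩
  · unfold localMap
    rw [(extChartAt (𝓡 m) p₀).left_inv hp]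
    rfl
  · obtain ⟨x, hx, rfl⟩ : ∃ x ∈ (extChartAt (𝓡 m) p₀).target, (extChartAt (𝓡 m) p₀).symm x = p :=
      ⟨_, (extChartAt (𝓡 m) p₀).map_source hp, (extChartAt (𝓡 m) p₀).left_inv hp⟩
    rw [(extChartAt (𝓡 m) p₀).right_inv hx]
    have hq' : pr ((extChartAt (𝓡 m) p₀).symm x) ∈ (extChartAt (𝓡 n) q).source := hq
    ext v
    rw [fderiv_localFun hx (hE.smooth.mdifferentiable (by simp) _)]
    refine (hβ _).symm.trans ?_
    change β _ = β (ofCoord q (pr ((extChartAt (𝓡 m) p₀).symm x))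
      (fderiv ℝ (localMap n p₀ q pr) x v))
    rw [fderiv_localMap hx (h_pr.smooth.mdifferentiable (by simp) _) hq', ofCoord_toCoord hq']
    rfl

/-- If `μ` is a smooth 1-form along `κ` with values in `S_E`, then `κ^*μ` is closed. -/
theorem fderiv_pullback_symm [SecondCountableTopology M] {pr : M → N}
    (h_pr : IsSurjectiveSubmersion m n pr) {E : M → ℝ} (hE : IsWeakMorseFamily m n pr E) {d : ℕ}
    {q : N} {ν : Euc d → CotangentBundle n N} {O : Set (Euc d)} (hO : IsOpen O)
    (hνq : ∀ y ∈ O, (ν y).proj ∈ (extChartAt (𝓡 n) q).source)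
    (hνE : ∀ y ∈ O, ν y ∈ lagrangianOf m n pr E)
    (hκ : ∀ y ∈ O, ContDiffAt ℝ 3 (fun y => extChartAt (𝓡 n) q (ν y).proj) y)
    (hμ : ∀ y ∈ O, ContDiffAt ℝ 3 (fun y => covectorCoord q (ν y).2) y) {y₀ : Euc d}
    (hy₀ : y₀ ∈ O) (u w : Euc d) :
    fderiv ℝ (fun y => covectorCoord q (ν y).2 ∘L
      fderiv ℝ (fun y => extChartAt (𝓡 n) q (ν y).proj) y) y₀ u w =
    fderiv ℝ (fun y => covectorCoord q (ν y).2 ∘L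
      fderiv ℝ (fun y => extChartAt (𝓡 n) q (ν y).proj) y) y₀ w u := by
  set κ : Euc d → Euc n := fun y => extChartAt (𝓡 n) q (ν y).proj with hκdef
  set μ : Euc d → (Euc n →L[ℝ] ℝ) := fun y => covectorCoord q (ν y).2 with hμdef
  set σ : Euc d → (Euc d →L[ℝ] ℝ) := fun y => μ y ∘L fderiv ℝ κ y with hσdef
  have hσ : ∀ y ∈ O, ContDiffAt ℝ 2 σ y := fun y hy =>
    ((hμ y hy).of_le (by norm_num)).clm_comp ((hκ y hy).fderiv_right (by norm_num))
  have hT : ContinuousOn (fun y => fderiv ℝ σ y u w - fderiv ℝ σ y w u) O := by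
    intro y hy
    have h1 : ContinuousAt (fderiv ℝ σ) y :=
      ((hσ y hy).fderiv_right (m := 1) (by norm_num)).continuousAt
    exact (((h1.clm_apply continuousAt_const).clm_apply continuousAt_const).sub
      ((h1.clm_apply continuousAt_const).clm_apply continuousAt_const)).continuousWithinAt
  by_contra hne
  -- If closedness fails at one point it fails on the open set `O'`; one point of `O'` near which
  -- `μ` lifts smoothly then gives the contradiction.
  let O' := O ∩ (fun y => fderiv ℝ σ y u w - fderiv ℝ σ y w u) ⁻¹' {0}ᶜ
  have hO' : IsOpen O' := hT.isOpen_inter_preimage hO isOpen_compl_singleton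
  have hy₀' : y₀ ∈ O' := ⟨hy₀, sub_ne_zero.2 hne⟩
  -- a countable cover of the critical set
  let Crit : Set M := {p | differential m E p ∈ conormal m n pr ∧
    pr p ∈ (extChartAt (𝓡 n) q).source}
  have hloc : ∀ p : M, p ∈ Crit → ∃ (g : Euc n × (Euc n →L[ℝ] ℝ) → Euc m) (C : Set (Euc m)),
      C ∈ 𝓝 (extChartAt (𝓡 m) p p) ∧ IsCompact C ∧ ∀ x ∈ C,
        (x ∈ (extChartAt (𝓡 m) p).target ∧
          pr ((extChartAt (𝓡 m) p).symm x) ∈ (extChartAt (𝓡 n) q).source) ∧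
        ∀ β, IsMultiplier (localMap n p q pr) (localFun p E) x β →
          ContDiffAt ℝ 2 g (localMap n p q pr x, β) ∧
          localMap n p q pr (g (localMap n p q pr x, β)) = localMap n p q pr x ∧
          IsMultiplier (localMap n p q pr) (localFun p E) (g (localMap n p q pr x, β)) β ∧
          ContDiffAt ℝ 3 (localMap n p q pr) (g (localMap n p q pr x, β)) ∧
          ContDiffAt ℝ 3 (localFun p E) (g (localMap n p q pr x, β)) := by
    rintro p ⟨hp, hpq⟩
    have hxt : extChartAt (𝓡 m) p p ∈ (extChartAt (𝓡 m) p).target := mem_extChartAt_target p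
    have hpq' : pr ((extChartAt (𝓡 m) p).symm (extChartAt (𝓡 m) p p)) ∈
        (extChartAt (𝓡 n) q).source := by rwa [extChartAt_to_inv p]
    obtain ⟨d', ψ, u₀, hψ₀, hψ⟩ := exists_cleanParam h_pr hE hp hpq
    obtain ⟨g, hg⟩ := exists_critical_section (P := localMap n p q pr) (e := localFun p E)
      (by rw [hψ₀]; exact (contDiffAt_localMap hxt h_pr.smooth.contMDiffAt hpq').of_le
            ENat.LEInfty.out)
      (by rw [hψ₀]; exact (contDiffAt_localFun hxt hE.smooth.contMDiffAt).of_le ENat.LEInfty.out)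
      (by rw [hψ₀]; exact surjective_fderiv_localMap hxt
            (h_pr.smooth.mdifferentiable (by simp) _) hpq' (h_pr.submersion _)) hψ
    rw [hψ₀] at hg
    obtain ⟨C, hC1, hC2, hC3⟩ := local_compact_nhds
      (Filter.inter_mem (eventually_mem_chart h_pr.smooth.continuous hxt hpq') hg)
    exact ⟨g, C, hC1, hC3, fun x hx => hC2 hx⟩
  choose! g C hC1 hC2 hC3 using hloc
  -- Second countability of `M` reduces the critical set to countably many of the neighbourhoods on
  -- which a smooth section `g p` is available.
  obtain ⟨t, htC, htc, htU⟩ := TopologicalSpace.countable_cover_nhdsWithin (s := Crit)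
    (f := fun p => (extChartAt (𝓡 m) p).source ∩ extChartAt (𝓡 m) p ⁻¹' C p)
    (fun p hp => mem_nhdsWithin_of_mem_nhds (Filter.inter_mem (extChartAt_source_mem_nhds p)
      ((continuousAt_extChartAt p).preimage_mem_nhds (hC1 p hp))))
  -- The critical point `x` in `C p` over each nearby `y` need not depend even continuously on `y`;
  -- its existence only places `(κ y, μ y)` where `g p` is smooth, and `g p` then provides the lift.
  obtain ⟨p, hpt, y, hy, hev⟩ := exists_eventually_of_countable_cover htc hO' ⟨y₀, hy₀'⟩
    (p := fun p y => ∃ x ∈ C p, localMap n p q pr x = κ y ∧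
      IsMultiplier (localMap n p q pr) (localFun p E) x (μ y)) (by
      intro K hK hKc p hp
      have hPs : ∀ x ∈ C p, ContDiffAt ℝ ∞ (localMap n p q pr) x := fun x hx =>
        contDiffAt_localMap (hC3 p (htC hp) x hx).1.1 h_pr.smooth.contMDiffAt
          (hC3 p (htC hp) x hx).1.2
      have hes : ∀ x ∈ C p, ContDiffAt ℝ ∞ (localFun p E) x := fun x hx =>
        contDiffAt_localFun (hC3 p (htC hp) x hx).1.1 hE.smooth.contMDiffAt
      exact isClosed_setOf_exists_multiplier hKc (hC2 p (htC hp))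
        (fun y hy => (hκ y (hK hy).1).continuousAt.continuousWithinAt)
        (fun y hy => (hμ y (hK hy).1).continuousAt.continuousWithinAt)
        (fun x hx => (hPs x hx).continuousAt.continuousWithinAt)
        (fun x hx => ((hPs x hx).fderiv_right (m := 0) (by simp)).continuousAt.continuousWithinAt)
        (fun x hx => ((hes x hx).fderiv_right (m := 0) (by simp)).continuousAt.continuousWithinAt))
    (by
      intro y hy
      obtain ⟨p', hp'1, hp'2, hp'3⟩ :=
        exists_multiplier_of_mem_lagrangianOf h_pr hE (hνE y hy.1)
      have hp'C : p' ∈ Crit := ⟨hp'1, by rw [hp'2]; exact hνq y hy.1⟩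
      obtain ⟨p, hp, hpp'⟩ := Set.mem_iUnion₂.1 (htU hp'C)
      obtain ⟨h1, h2⟩ := hp'3 p q hpp'.1 (hνq y hy.1)
      exact ⟨p, hp, _, hpp'.2, h1, h2⟩)
  refine hy.2 (sub_eq_zero.2 (fderiv_symm_of_lift (P := localMap n p q pr) (e := localFun p E)
    (q := g p) ?_ ?_ ?_ u w))
  · filter_upwards [hO.mem_nhds hy.1] with y hy using hκ y hy
  · filter_upwards [hO.mem_nhds hy.1] with y hy using hμ y hy
  · filter_upwards [hev] with y ⟨x, hx, hxκ, hxm⟩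
    have := (hC3 p (htC hpt) x hx).2 _ hxm
    rwa [hxκ] at this

end Manifold

end Closedness

/-! ### Vector fields in coordinates -/

section VectorFields

set_option linter.unusedSectionVars false

open Filter Topology

variable {n : ℕ} {P : Type u} [TopologicalSpace P] [ChartedSpace (Euc n) P]
  [IsManifold (𝓡 n) ∞ P]

/-- The coordinate expression of a vector field in the chart at `q`. -/
def coordField (q : P) (X : ∀ x : P, TangentSpace (𝓡 n) x) (z : Euc n) : Euc n :=
  toCoord q ((extChartAt (𝓡 n) q).symm z) (X ((extChartAt (𝓡 n) q).symm z))

theorem contMDiffAt_vectorField_iff {q x : P} (hx : x ∈ (extChartAt (𝓡 n) q).source)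
    {X : ∀ x : P, TangentSpace (𝓡 n) x} :
    ContMDiffAt (𝓡 n) (𝓡 n).tangent ∞
        (fun x => (TotalSpace.mk' (Euc n) x (X x) : TangentBundle (𝓡 n) P)) x ↔
      ContMDiffAt (𝓡 n) 𝓘(ℝ, Euc n) ∞ (fun x => toCoord q x (X x)) x := by
  have hx' : x ∈ (chartAt (Euc n) q).source := by rwa [extChartAt_source] at hx
  refine ((trivializationAt (Euc n) (fun x : P => TangentSpace (𝓡 n) x) q).contMDiffAt_section_iff
    (n := ∞) hx').trans (Filter.EventuallyEq.contMDiffAt_iff ?_)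
  filter_upwards [(chartAt (Euc n) q).open_source.mem_nhds hx'] with y hy
  have h1 := TangentBundle.continuousLinearMapAt_trivializationAt (𝕜 := ℝ) (I := 𝓡 n) hy
  have h2 : (trivializationAt (Euc n) (fun x : P => TangentSpace (𝓡 n) x) q).continuousLinearMapAt
    ℝ y (X y) = toCoord q y (X y) := DFunLike.congr_fun h1 (X y)
  rw [← h2, Trivialization.continuousLinearMapAt_apply, Trivialization.coe_linearMapAt_of_mem]
  exact hy

theorem contDiffAt_coordField {q : P} {z : Euc n} (hz : z ∈ (extChartAt (𝓡 n) q).target)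
    {X : ∀ x : P, TangentSpace (𝓡 n) x}
    (hX : ContMDiffAt (𝓡 n) (𝓡 n).tangent ∞
      (fun x => (TotalSpace.mk' (Euc n) x (X x) : TangentBundle (𝓡 n) P))
      ((extChartAt (𝓡 n) q).symm z)) : ContDiffAt ℝ ∞ (coordField q X) z :=
  contMDiffAt_iff_contDiffAt.1 (ContMDiffAt.comp z
    ((contMDiffAt_vectorField_iff ((extChartAt (𝓡 n) q).map_target hz)).1 hX)
    (contMDiffAt_chart_symm hz))

/-- `mlieBracket` at `q` is by definition computed in the chart at `q`, hence the evaluation at the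
centre; the pulled-back fields agree with `coordField` on the whole chart target. -/
theorem toCoord_bracket (q : P) (X Y : ∀ x : P, TangentSpace (𝓡 n) x) :
    toCoord q q (bracket X Y q) =
      VectorField.lieBracket ℝ (coordField q X) (coordField q Y) (extChartAt (𝓡 n) q q) := by
  have hr : Set.range (𝓡 n) = Set.univ := by simp
  have hpull : ∀ V : ∀ x : P, TangentSpace (𝓡 n) x,
      VectorField.mpullbackWithin 𝓘(ℝ, Euc n) (𝓡 n) (extChartAt (𝓡 n) q).symm V Set.univ
        =ᶠ[𝓝 (extChartAt (𝓡 n) q q)] coordField q V := by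
    intro V
    filter_upwards [(isOpen_extChartAt_target (I := 𝓡 n) q).mem_nhds (mem_extChartAt_target q)]
      with z hz
    have h1 := mfderivWithin_extChartAt_symm_comp_mfderiv_extChartAt hz
    have h2 := mfderiv_extChartAt_comp_mfderivWithin_extChartAt_symm hz
    rw [hr] at h1 h2
    rw [VectorField.mpullbackWithin_apply, ContinuousLinearMap.inverse_eq h1 h2]
    rfl
  have hinv : (mfderiv (𝓡 n) 𝓘(ℝ, Euc n) (extChartAt (𝓡 n) q) q).IsInvertible :=
    isInvertible_mfderiv_extChartAt (mem_extChartAt_source q)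
  unfold bracket VectorField.mlieBracket
  rw [VectorField.mlieBracketWithin_apply, hr, Set.preimage_univ, Set.univ_inter]
  let A : (∀ x : P, TangentSpace (𝓡 n) x) → Euc n → Euc n := fun V =>
    VectorField.mpullbackWithin 𝓘(ℝ, Euc n) (𝓡 n) (extChartAt (𝓡 n) q).symm V Set.univ
  have h : VectorField.lieBracketWithin ℝ (A X) (A Y) Set.univ (extChartAt (𝓡 n) q q) =
      VectorField.lieBracket ℝ (coordField q X) (coordField q Y) (extChartAt (𝓡 n) q q) := by
    rw [VectorField.lieBracketWithin_univ]
    exact Filter.EventuallyEq.lieBracket_vectorField_eq (hpull X) (hpull Y)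
  obtain ⟨e, he⟩ := hinv
  unfold toCoord
  rw [← he, ContinuousLinearMap.inverse_equiv]
  exact (e.apply_symm_apply _).trans h

theorem fderiv_comp_eq_dirDeriv {d : ℕ} {κ : Euc d → P} {y : Euc d} {f : P → ℝ}
    (hκ : MDifferentiableAt 𝓘(ℝ, Euc d) (𝓡 n) κ y)
    (hf : MDifferentiableAt (𝓡 n) 𝓘(ℝ, ℝ) f (κ y)) (u : Euc d) :
    fderiv ℝ (fun y => f (κ y)) y u = dirDeriv f (κ y) (mfderiv 𝓘(ℝ, Euc d) (𝓡 n) κ y u) := by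
  have h := DFunLike.congr_fun (mfderiv_comp y hf hκ) u
  rw [← mfderiv_eq_fderiv]
  exact h

/-- The coordinate expression of a map from a vector space. -/
theorem fderiv_chart_comp {d : ℕ} {κ : Euc d → P} {y : Euc d} {q : P}
    (hκ : MDifferentiableAt 𝓘(ℝ, Euc d) (𝓡 n) κ y)
    (hq : κ y ∈ (extChartAt (𝓡 n) q).source) (u : Euc d) :
    fderiv ℝ (fun y => extChartAt (𝓡 n) q (κ y)) y u =
      toCoord q (κ y) (mfderiv 𝓘(ℝ, Euc d) (𝓡 n) κ y u) := by
  have h := DFunLike.congr_fun (mfderiv_comp y (mdifferentiableAt_chart hq) hκ) u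
  rw [← mfderiv_eq_fderiv]
  exact h

/-- Fields that are `κ`-related to constant fields commute along `κ`. -/
theorem bracket_eq_zero_of_related {d : ℕ} {κ : Euc d → P} {y : Euc d}
    (hκ : ∀ᶠ y' in 𝓝 y, ContMDiffAt 𝓘(ℝ, Euc d) (𝓡 n) ∞ κ y') {X Y : ∀ x : P, TangentSpace (𝓡 n) x}
    (hX : ContMDiffAt (𝓡 n) (𝓡 n).tangent ∞
      (fun x => (TotalSpace.mk' (Euc n) x (X x) : TangentBundle (𝓡 n) P)) (κ y))
    (hY : ContMDiffAt (𝓡 n) (𝓡 n).tangent ∞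
      (fun x => (TotalSpace.mk' (Euc n) x (Y x) : TangentBundle (𝓡 n) P)) (κ y)) {u v : Euc d}
    (hXu : ∀ᶠ y' in 𝓝 y, X (κ y') = mfderiv 𝓘(ℝ, Euc d) (𝓡 n) κ y' u)
    (hYv : ∀ᶠ y' in 𝓝 y, Y (κ y') = mfderiv 𝓘(ℝ, Euc d) (𝓡 n) κ y' v) :
    bracket X Y (κ y) = 0 := by
  have hq : κ y ∈ (extChartAt (𝓡 n) (κ y)).source := mem_extChartAt_source _
  have hz : extChartAt (𝓡 n) (κ y) (κ y) ∈ (extChartAt (𝓡 n) (κ y)).target :=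
    mem_extChartAt_target _
  have hinv : (extChartAt (𝓡 n) (κ y)).symm (extChartAt (𝓡 n) (κ y) (κ y)) = κ y :=
    extChartAt_to_inv _
  set κ' : Euc d → Euc n := fun y' => extChartAt (𝓡 n) (κ y) (κ y') with hκ'
  have hκs : ContDiffAt ℝ 2 κ' y := contMDiffAt_iff_contDiffAt.1
    ((ContMDiffAt.comp y (contMDiffAt_chart hq) hκ.self_of_nhds).of_le ENat.LEInfty.out)
  have hnear : ∀ᶠ y' in 𝓝 y, κ y' ∈ (extChartAt (𝓡 n) (κ y)).source ∧
      MDifferentiableAt 𝓘(ℝ, Euc d) (𝓡 n) κ y' := by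
    filter_upwards [hκ.self_of_nhds.continuousAt.preimage_mem_nhds
      ((isOpen_extChartAt_source (I := 𝓡 n) (κ y)).mem_nhds hq), hκ]
      with y' h1 h2 using ⟨h1, h2.mdifferentiableAt (by simp)⟩
  have hrel : ∀ (V : ∀ x : P, TangentSpace (𝓡 n) x) (w : Euc d),
      (∀ᶠ y' in 𝓝 y, V (κ y') = mfderiv 𝓘(ℝ, Euc d) (𝓡 n) κ y' w) →
      ∀ᶠ y' in 𝓝 y, coordField (κ y) V (κ' y') = fderiv ℝ κ' y' w := by
    intro V w hV
    filter_upwards [hV, hnear] with y' h1 h2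
    rw [fderiv_chart_comp h2.2 h2.1, ← h1]
    unfold coordField
    rw [hκ', (extChartAt (𝓡 n) (κ y)).left_inv h2.1]
  -- Differentiating `V ∘ κ' = dκ' w` expresses the derivative of `V` along `κ'` through second
  -- derivatives of `κ'`, whose symmetry cancels the two halves of the bracket.
  have hder : ∀ (V : ∀ x : P, TangentSpace (𝓡 n) x) (w : Euc d),
      ContMDiffAt (𝓡 n) (𝓡 n).tangent ∞
        (fun x => (TotalSpace.mk' (Euc n) x (V x) : TangentBundle (𝓡 n) P)) (κ y) →
      (∀ᶠ y' in 𝓝 y, V (κ y') = mfderiv 𝓘(ℝ, Euc d) (𝓡 n) κ y' w) →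
      ∀ t, fderiv ℝ (coordField (κ y) V) (κ' y) (fderiv ℝ κ' y t) =
        fderiv ℝ (fderiv ℝ κ') y t w := by
    intro V w hV hw t
    have h1 : DifferentiableAt ℝ (coordField (κ y) V) (κ' y) :=
      (contDiffAt_coordField hz (by rwa [hinv])).differentiableAt (by simp)
    have h2 := h1.hasFDerivAt.comp y (hκs.differentiableAt (by simp)).hasFDerivAt
    have h3 : HasFDerivAt (fun y' => fderiv ℝ κ' y' w) _ y :=
      ((hκs.fderiv_right (m := 1) (by norm_num)).differentiableAt (by simp)).hasFDerivAt.clm_apply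
        (hasFDerivAt_const w y)
    have h4 := h2.unique (h3.congr_of_eventuallyEq (hrel V w hw))
    simpa using DFunLike.congr_fun h4 t
  have hsymm : fderiv ℝ (fderiv ℝ κ') y u v = fderiv ℝ (fderiv ℝ κ') y v u :=
    hκs.isSymmSndFDerivAt (by simp) u v
  have hzero : toCoord (κ y) (κ y) (bracket X Y (κ y)) = 0 := by
    rw [toCoord_bracket, VectorField.lieBracket]
    have e1 : coordField (κ y) X (κ' y) = fderiv ℝ κ' y u := (hrel X u hXu).self_of_nhds
    have e2 : coordField (κ y) Y (κ' y) = fderiv ℝ κ' y v := (hrel Y v hYv).self_of_nhds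
    change fderiv ℝ (coordField (κ y) Y) (κ' y) (coordField (κ y) X (κ' y)) -
      fderiv ℝ (coordField (κ y) X) (κ' y) (coordField (κ y) Y (κ' y)) = 0
    rw [e1, e2, hder Y v hY hYv, hder X u hX hXu, hsymm, sub_self]
  have := congrArg (ofCoord (κ y) (κ y)) hzero
  rwa [ofCoord_toCoord hq, map_zero] at this

end VectorFields

/-! ### The induced form is closed -/

section DiracForm

set_option linter.unusedSectionVars false

open Filter Topology

variable {n : ℕ} {N : Type u} [TopologicalSpace N] [ChartedSpace (Euc n) N]
  [IsManifold (𝓡 n) ∞ N]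

theorem contMDiffAt_eval {α : ∀ x : N, Cotangent n x} {X : ∀ x : N, TangentSpace (𝓡 n) x} {x : N}
    (hα : ContMDiffAt (𝓡 n) (cotangentModel n) ∞
      (fun x => (TotalSpace.mk' (Euc n →L[ℝ] ℝ) x (α x) : CotangentBundle n N)) x)
    (hX : ContMDiffAt (𝓡 n) (𝓡 n).tangent ∞
      (fun x => (TotalSpace.mk' (Euc n) x (X x) : TangentBundle (𝓡 n) N)) x) :
    ContMDiffAt (𝓡 n) 𝓘(ℝ, ℝ) ∞ (fun x => eval (α x) (X x)) x := by
  have h1 := (contMDiffAt_cotangent_iff.1 hα).2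
  have h2 := (contMDiffAt_vectorField_iff (mem_extChartAt_source x)).1 hX
  refine (h1.clm_apply h2).congr_of_eventuallyEq ?_
  filter_upwards [extChartAt_source_mem_nhds (I := 𝓡 n) x] with y hy
  exact (congrArg (α y) (ofCoord_toCoord hy (X y))).symm

theorem DiracStructure.char_eq_span (D : DiracStructure n N) {x : N}
    {X : Fin n → TangentSpace (𝓡 n) x} {α : Fin n → Cotangent n x}
    (h : D.fiber x = Submodule.span ℝ (Set.range fun i => (X i, α i))) :
    D.char x = Submodule.span ℝ (Set.range X) := by
  rw [DiracStructure.char, h, Submodule.map_span, ← Set.range_comp]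
  rfl

/-- Near a point where the rank of `pr₁(D)` along `κ` is maximal, the images under `Tκ` of the
constant fields extend to vector fields underlying local sections of `D`. -/
theorem DiracStructure.exists_adapted_sections (D : DiracStructure n N) {d : ℕ} {κ : Euc d → N}
    {y₁ : Euc d} (hκ : ∀ᶠ y in 𝓝 y₁, ContMDiffAt 𝓘(ℝ, Euc d) (𝓡 n) ∞ κ y)
    (hinj : Function.Injective (mfderiv 𝓘(ℝ, Euc d) (𝓡 n) κ y₁))
    (hF : ∀ᶠ y in 𝓝 y₁, ∀ w, mfderiv 𝓘(ℝ, Euc d) (𝓡 n) κ y w ∈ D.char (κ y))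
    (hrank : ∀ᶠ y in 𝓝 y₁,
      Module.finrank ℝ (D.char (κ y)) ≤ Module.finrank ℝ (D.char (κ y₁))) :
    ∃ (U : Set N) (X : Euc d → ∀ x : N, TangentSpace (𝓡 n) x)
      (α : Euc d → ∀ x : N, Cotangent n x), IsOpen U ∧ κ y₁ ∈ U ∧
      (∀ w, SmoothVectorFieldOn (X w) U) ∧ (∀ w, SmoothOneFormOn (α w) U) ∧
      (∀ w, ∀ x ∈ U, (X w x, α w x) ∈ D.fiber x) ∧
      ∀ᶠ y in 𝓝 y₁, ∀ w, X w (κ y) = mfderiv 𝓘(ℝ, Euc d) (𝓡 n) κ y w := by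
  obtain ⟨U, hU, hyU, X, α, hX, hα, hspan⟩ := D.smooth (κ y₁)
  set q := κ y₁ with hq
  have hqs : q ∈ (extChartAt (𝓡 n) q).source := mem_extChartAt_source q
  have hκc : Tendsto κ (𝓝 y₁) (𝓝 q) := hκ.self_of_nhds.continuousAt
  have hnear : ∀ᶠ x in 𝓝 q, x ∈ U ∧ x ∈ (extChartAt (𝓡 n) q).source := by
    filter_upwards [hU.mem_nhds hyU, (isOpen_extChartAt_source q).mem_nhds hqs]
      with x h1 h2 using ⟨h1, h2⟩
  set κ' : Euc d → Euc n := fun y => extChartAt (𝓡 n) q (κ y) with hκ'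
  have hκs : ∀ᶠ y in 𝓝 y₁, ContDiffAt ℝ ∞ κ' y := by
    filter_upwards [hκ, hκc.eventually hnear] with y h1 h2
    exact contMDiffAt_iff_contDiffAt.1 (ContMDiffAt.comp y (contMDiffAt_chart h2.2) h1)
  have hκd : ∀ᶠ y in 𝓝 y₁, ∀ w, fderiv ℝ κ' y w =
      toCoord q (κ y) (mfderiv 𝓘(ℝ, Euc d) (𝓡 n) κ y w) := by
    filter_upwards [hκ, hκc.eventually hnear] with y h1 h2 w
    exact fderiv_chart_comp (h1.mdifferentiableAt (by simp)) h2.2 w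
  -- the frame of `D` in coordinates
  let B : Euc d → (Fin n → ℝ) →L[ℝ] Euc n := fun y =>
    ∑ i, (ContinuousLinearMap.proj i : (Fin n → ℝ) →L[ℝ] ℝ).smulRight
      (toCoord q (κ y) (X i (κ y)))
  have hBapp : ∀ y c, B y c = toCoord q (κ y) (∑ i, c i • X i (κ y)) := by
    intro y c
    simp only [B, sum_apply, ContinuousLinearMap.smulRight_apply,
      ContinuousLinearMap.proj_apply, map_sum, map_smul]
  have hBs : ∀ᶠ y in 𝓝 y₁, ContDiffAt ℝ ∞ B y := by
    filter_upwards [hκ, hκc.eventually hnear] with y h1 h2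
    refine ContDiffAt.sum fun i _ => ContDiffAt.smulRight contDiffAt_const ?_
    exact contMDiffAt_iff_contDiffAt.1 (ContMDiffAt.comp y
      ((contMDiffAt_vectorField_iff h2.2).1 ((hX i).contMDiffAt (hU.mem_nhds h2.1))) h1)
  have hBr : ∀ᶠ y in 𝓝 y₁, Module.finrank ℝ (LinearMap.range (B y).toLinearMap) =
      Module.finrank ℝ (D.char (κ y)) := by
    filter_upwards [hκc.eventually hnear] with y h2
    have hi : Function.Injective (toCoord q (κ y)).toLinearMap := fun v w h => by
      rw [← ofCoord_toCoord h2.2 v, ← ofCoord_toCoord h2.2 w]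
      exact congrArg _ h
    have : LinearMap.range (B y).toLinearMap =
        (D.char (κ y)).map (toCoord q (κ y)).toLinearMap := by
      rw [D.char_eq_span (hspan _ h2.1)]
      ext z
      constructor
      · rintro ⟨c, rfl⟩
        refine ⟨∑ i, c i • X i (κ y), Submodule.sum_mem _ fun i _ => Submodule.smul_mem _ _
          (Submodule.subset_span ⟨i, rfl⟩), ?_⟩
        exact (hBapp y c).symm
      · rintro ⟨v, hv, rfl⟩
        obtain ⟨c, rfl⟩ := (Submodule.mem_span_range_iff_exists_fun ℝ).1 hv
        exact ⟨c, hBapp y c⟩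
    rw [this]
    exact (Submodule.equivMapOfInjective _ hi _).finrank_eq.symm
  -- Local maximality of the rank allows frame coefficients of a vector in `F` to be chosen smoothly
  -- along `κ`, although the spanning vector parts may be linearly dependent.
  obtain ⟨S, hS1, hS2⟩ := exists_generalized_inverse hBs (by
    filter_upwards [hBr, hrank] with y h1 h2
    rw [h1, hBr.self_of_nhds]
    exact h2)
  -- a left inverse of `κ`
  have hinj' : Function.Injective (fderiv ℝ κ' y₁) := by
    rw [injective_iff_map_eq_zero]
    intro v hv
    rw [hκd.self_of_nhds] at hv
    have h1 := congrArg (ofCoord q q) hv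
    rw [ofCoord_toCoord hqs, map_zero] at h1
    exact hinj (h1.trans (ContinuousLinearMap.map_zero _).symm)
  obtain ⟨ρ, hρ0, hρs, hρl⟩ := exists_local_left_inverse (n := ∞) (by simp) hκs hinj'
  let r : N → Euc d := fun x => ρ (extChartAt (𝓡 n) q x)
  have hrc : Tendsto (extChartAt (𝓡 n) q) (𝓝 q) (𝓝 (κ' y₁)) :=
    (contMDiffAt_chart hqs).continuousAt
  have hρc : Tendsto ρ (𝓝 (κ' y₁)) (𝓝 y₁) := by
    have := hρs.self_of_nhds.continuousAt
    rwa [ContinuousAt, hρ0] at this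
  have hev : ∀ᶠ x in 𝓝 q, (x ∈ U ∧ x ∈ (extChartAt (𝓡 n) q).source) ∧
      ContDiffAt ℝ ∞ ρ (extChartAt (𝓡 n) q x) ∧ ContDiffAt ℝ ∞ S (r x) ∧
      ContDiffAt ℝ ∞ κ' (r x) := by
    filter_upwards [hnear, hrc.eventually hρs, (hρc.comp hrc).eventually hS1,
      (hρc.comp hrc).eventually hκs] with x h1 h2 h3 h4 using ⟨h1, h2, h3, h4⟩
  obtain ⟨U', hU'sub, hU', hqU'⟩ := mem_nhds_iff.1 hev
  -- The coefficients of `Tκ w` are defined along `κ` by `S` and extended to a neighbourhood in `N`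
  -- through the retraction `r`. The same coefficients applied to the pairs `(X i, α i)` keep the
  -- extension in `D`.
  let a : Euc d → Fin n → N → ℝ := fun w i x => S (r x) (fderiv ℝ κ' (r x) w) i
  have ha : ∀ w i, ContMDiffOn (𝓡 n) 𝓘(ℝ, ℝ) ∞ (a w i) U' := by
    intro w i x hx
    obtain ⟨⟨-, h1⟩, h2, h3, h4⟩ := hU'sub hx
    have h5 : ContDiffAt ℝ ∞ (fun y => S y (fderiv ℝ κ' y w) i) (r x) :=
      contDiffAt_pi.1 (h3.clm_apply ((h4.fderiv_right (m := ∞) (by simp)).clm_apply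
        contDiffAt_const)) i
    have h6 : ContDiffAt ℝ ∞ (fun z => S (ρ z) (fderiv ℝ κ' (ρ z) w) i)
        (extChartAt (𝓡 n) q x) := ContDiffAt.comp (g := fun y => S y (fderiv ℝ κ' y w) i) _ h5 h2
    exact (ContMDiffAt.comp x h6.contMDiffAt (contMDiffAt_chart h1)).contMDiffWithinAt
  have hsub : U' ⊆ U := fun x hx => (hU'sub hx).1.1
  refine ⟨U', fun w x => ∑ i, a w i x • X i x, fun w x => ∑ i, a w i x • α i x, hU', hqU',
    fun w => ?_, fun w => ?_, fun w x hx => ?_, ?_⟩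
  · exact ContMDiffOn.sum_section fun i _ => (ha w i).smul_section ((hX i).mono hsub)
  · exact ContMDiffOn.sum_section (V := fun x : N => Cotangent n x)
      fun i _ => (ha w i).smul_section (V := fun x : N => Cotangent n x) ((hα i).mono hsub)
  · have : ((∑ i, a w i x • X i x, ∑ i, a w i x • α i x) :
        TangentSpace (𝓡 n) x × Cotangent n x) = ∑ i, a w i x • (X i x, α i x) := by
      ext1
      · simp [Prod.fst_sum]
      · simp [Prod.snd_sum]
    rw [this, hspan x (hsub hx)]
    exact Submodule.sum_mem _ fun i _ => Submodule.smul_mem _ _ (Submodule.subset_span ⟨i, rfl⟩)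
  · filter_upwards [hκd, hρl, hS2, hF, hκc.eventually hnear] with y h1 h2 h3 h4 h5 w
    have hr : r (κ y) = y := h2
    have h6 := h4 w
    rw [D.char_eq_span (hspan _ h5.1)] at h6
    obtain ⟨c, hc⟩ := (Submodule.mem_span_range_iff_exists_fun ℝ).1 h6
    have h7 : B y c = fderiv ℝ κ' y w := by rw [hBapp, hc, h1]
    have h8 := h3 c
    rw [h7, hBapp, h1] at h8
    have h9 := congrArg (ofCoord q (κ y)) h8
    rw [ofCoord_toCoord h5.2, ofCoord_toCoord h5.2] at h9
    refine Eq.trans ?_ h9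
    simp only [a, hr, h1]

/-- The adapted fields commute along `κ`, so the Courant bracket of the sections for `u` and `v` is
`(0, γ)`, and `γ` kills the field for `w` because `D` is isotropic. Expanded with vanishing
brackets, `γ` on that field is the cyclic sum, since the sections pair along `κ` to the values of
`Ω`. -/
theorem DiracStructure.fderiv_form_cyclic_of_rank (D : DiracStructure n N) (hD : D.Integrable)
    {d : ℕ} {κ : Euc d → N}
    {y₁ : Euc d} (hκ : ∀ᶠ y in 𝓝 y₁, ContMDiffAt 𝓘(ℝ, Euc d) (𝓡 n) ∞ κ y)
    (hinj : Function.Injective (mfderiv 𝓘(ℝ, Euc d) (𝓡 n) κ y₁))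
    (hF : ∀ᶠ y in 𝓝 y₁, ∀ w, mfderiv 𝓘(ℝ, Euc d) (𝓡 n) κ y w ∈ D.char (κ y))
    (hrank : ∀ᶠ y in 𝓝 y₁,
      Module.finrank ℝ (D.char (κ y)) ≤ Module.finrank ℝ (D.char (κ y₁)))
    {Ω : Euc d → Euc d → Euc d → ℝ}
    (hΩ : ∀ᶠ y in 𝓝 y₁, ∀ (u w : Euc d) (α : Cotangent n (κ y)),
      (mfderiv 𝓘(ℝ, Euc d) (𝓡 n) κ y u, α) ∈ D.fiber (κ y) →
      Ω y u w = eval α (mfderiv 𝓘(ℝ, Euc d) (𝓡 n) κ y w)) (u v w : Euc d) :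
    fderiv ℝ (fun y => Ω y v w) y₁ u - fderiv ℝ (fun y => Ω y u w) y₁ v +
      fderiv ℝ (fun y => Ω y u v) y₁ w = 0 := by
  obtain ⟨U, X, α, hU, hyU, hX, hα, hmem, hrel⟩ := D.exists_adapted_sections hκ hinj hF hrank
  have hκc : Tendsto κ (𝓝 y₁) (𝓝 (κ y₁)) := hκ.self_of_nhds.continuousAt
  have hXat := fun w => (hX w).contMDiffAt (hU.mem_nhds hyU)
  have hαat := fun w => (hα w).contMDiffAt (hU.mem_nhds hyU)
  have hbr : ∀ a b, bracket (X a) (X b) (κ y₁) = 0 := fun a b =>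
    bracket_eq_zero_of_related hκ (hXat a) (hXat b) (hrel.mono fun y h => h a)
      (hrel.mono fun y h => h b)
  have hder : ∀ a b c, dirDeriv (fun x => eval (α a x) (X b x)) (κ y₁) (X c (κ y₁)) =
      fderiv ℝ (fun y => Ω y a b) y₁ c := by
    intro a b c
    rw [hrel.self_of_nhds c, ← fderiv_comp_eq_dirDeriv
      (hκ.self_of_nhds.mdifferentiableAt (by simp))
      ((contMDiffAt_eval (hαat a) (hXat b)).mdifferentiableAt (by simp))]
    have : (fun y => eval (α a (κ y)) (X b (κ y))) =ᶠ[𝓝 y₁] fun y => Ω y a b := by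
      filter_upwards [hrel, hΩ, hκc.eventually (hU.mem_nhds hyU)] with y h1 h2 h3
      have h4 := hmem a _ h3
      rw [h1] at h4
      rw [h2 a b _ h4, h1]
    rw [this.fderiv_eq]
  obtain ⟨γ, hγ1, hγ2⟩ := hD U hU (X u) (X v) (α u) (α v) (hX u) (hα u) (hX v) (hα v)
    (hmem u) (hmem v) (κ y₁) hyU
  have h1 := hγ2 U hU hyU (X w) (hX w)
  rw [hbr] at hγ1
  have h2 := (D.lagrangian _ _).1 hγ1 _ (hmem w _ hyU)
  have hz : ∀ β : Cotangent n (κ y₁), eval β 0 = 0 := fun β => β.map_zero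
  simp only [hz, add_zero] at h2
  unfold lieDerivativeOneForm extDerivative at h1
  rw [h2, hbr, hbr, hz, hz, hder, hder, hder] at h1
  linarith

/-- The 2-form induced by an integrable Dirac structure is closed. -/
theorem DiracStructure.fderiv_form_cyclic (D : DiracStructure n N) (hD : D.Integrable)
    {d : ℕ} {κ : Euc d → N} {O : Set (Euc d)} (hO : IsOpen O)
    (hκ : ∀ y ∈ O, ContMDiffAt 𝓘(ℝ, Euc d) (𝓡 n) ∞ κ y)
    (hinj : ∀ y ∈ O, Function.Injective (mfderiv 𝓘(ℝ, Euc d) (𝓡 n) κ y))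
    (hF : ∀ y ∈ O, ∀ w, mfderiv 𝓘(ℝ, Euc d) (𝓡 n) κ y w ∈ D.char (κ y))
    {Ω : Euc d → Euc d → Euc d → ℝ}
    (hΩ : ∀ y ∈ O, ∀ (u w : Euc d) (α : Cotangent n (κ y)),
      (mfderiv 𝓘(ℝ, Euc d) (𝓡 n) κ y u, α) ∈ D.fiber (κ y) →
      Ω y u w = eval α (mfderiv 𝓘(ℝ, Euc d) (𝓡 n) κ y w))
    (hΩs : ∀ y ∈ O, ∀ u w, ContDiffAt ℝ ∞ (fun y => Ω y u w) y) {y₀ : Euc d} (hy₀ : y₀ ∈ O)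
    (u v w : Euc d) :
    fderiv ℝ (fun y => Ω y v w) y₀ u - fderiv ℝ (fun y => Ω y u w) y₀ v +
      fderiv ℝ (fun y => Ω y u v) y₀ w = 0 := by
  have hc : ∀ a b c, ContinuousOn (fun y => fderiv ℝ (fun y => Ω y a b) y c) O := by
    intro a b c y hy
    exact (((hΩs y hy a b).fderiv_right (m := 0) (by simp)).continuousAt.clm_apply
      continuousAt_const).continuousWithinAt
  have hT := ((hc v w u).sub (hc u w v)).add (hc u v w)
  by_contra hne
  have hO' := hT.isOpen_inter_preimage hO (isOpen_compl_singleton (x := (0 : ℝ)))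
  have hbound : ∀ y, Module.finrank ℝ (D.char (κ y)) ≤ n := by
    intro y
    have : FiniteDimensional ℝ (TangentSpace (𝓡 n) (κ y)) :=
      inferInstanceAs (FiniteDimensional ℝ (Euc n))
    refine (Submodule.finrank_le _).trans (le_of_eq ?_)
    exact (finrank_euclideanSpace_fin : Module.finrank ℝ (Euc n) = n)
  obtain ⟨y₁, hy₁, hmax⟩ : ∃ y₁ ∈ O ∩ (fun y => fderiv ℝ (fun y => Ω y v w) y u -
      fderiv ℝ (fun y => Ω y u w) y v + fderiv ℝ (fun y => Ω y u v) y w) ⁻¹' {0}ᶜ,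
      ∀ y ∈ O ∩ (fun y => fderiv ℝ (fun y => Ω y v w) y u -
      fderiv ℝ (fun y => Ω y u w) y v + fderiv ℝ (fun y => Ω y u v) y w) ⁻¹' {0}ᶜ,
      Module.finrank ℝ (D.char (κ y)) ≤ Module.finrank ℝ (D.char (κ y₁)) := by
    -- The rank is maximized over the open set of failure by minimizing `n - rank`; `hbound` makes
    -- the truncated subtraction faithful.
    obtain ⟨y₁, hy₁, hmin⟩ := (measure fun y => n - Module.finrank ℝ (D.char (κ y))).wf.has_min
      (O ∩ (fun y => fderiv ℝ (fun y => Ω y v w) y u - fderiv ℝ (fun y => Ω y u w) y v +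
        fderiv ℝ (fun y => Ω y u v) y w) ⁻¹' {0}ᶜ) ⟨y₀, hy₀, hne⟩
    refine ⟨y₁, hy₁, fun y hy => ?_⟩
    have h1 : ¬ (n - Module.finrank ℝ (D.char (κ y)) < n - Module.finrank ℝ (D.char (κ y₁))) :=
      hmin y hy
    have := hbound y
    omega
  refine hy₁.2 (D.fderiv_form_cyclic_of_rank hD ?_ (hinj _ hy₁.1) ?_ ?_ ?_ u v w)
  · filter_upwards [hO.mem_nhds hy₁.1] with y hy using hκ y hy
  · filter_upwards [hO.mem_nhds hy₁.1] with y hy using hF y hy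
  · filter_upwards [hO'.mem_nhds hy₁] with y hy using hmax y hy
  · filter_upwards [hO.mem_nhds hy₁.1] with y hy using hΩ y hy

end DiracForm

/-! ### The induced form in coordinates -/

section FormCoordinates

set_option linter.unusedSectionVars false

open Filter Topology

set_option synthInstance.maxHeartbeats 200000 in
/-- A bilinear form on `ℝ^d` is determined by its coefficients. -/
theorem exists_bilinear {d : ℕ} {Ω : Euc d → Euc d → Euc d → ℝ} {O : Set (Euc d)}
    (hadd : ∀ y ∈ O, ∀ a b c, Ω y (a + b) c = Ω y a c + Ω y b c)
    (hsmul : ∀ y ∈ O, ∀ (r : ℝ) a c, Ω y (r • a) c = r * Ω y a c)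
    (hanti : ∀ y ∈ O, ∀ a b, Ω y a b = -Ω y b a)
    (hΩ : ∀ y ∈ O, ∀ a b, ContDiffAt ℝ ∞ (fun y => Ω y a b) y) :
    ∃ B : Euc d → Euc d →L[ℝ] Euc d →L[ℝ] ℝ,
      (∀ y ∈ O, ∀ a b, B y a b = Ω y a b) ∧ ∀ y ∈ O, ContDiffAt ℝ ∞ B y := by
  let e : Fin d → Euc d := fun i => EuclideanSpace.single i (1 : ℝ)
  let c : Fin d → Euc d →L[ℝ] ℝ := fun i => EuclideanSpace.proj i
  have hdec : ∀ a : Euc d, a = ∑ i, c i a • e i := by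
    intro a
    ext j
    simp [c, e, Finset.sum_apply, Pi.single_apply]
  have hL : ∀ y ∈ O, ∀ b, ∃ f : Euc d →ₗ[ℝ] ℝ, ∀ a, f a = Ω y a b := fun y hy b =>
    ⟨{ toFun := fun a => Ω y a b
       map_add' := fun a₁ a₂ => hadd y hy a₁ a₂ b
       map_smul' := fun r a => hsmul y hy r a b }, fun a => rfl⟩
  have hexp : ∀ y ∈ O, ∀ a b, Ω y a b = ∑ i, c i a * Ω y (e i) b := by
    intro y hy a b
    obtain ⟨f, hf⟩ := hL y hy b
    have h := congrArg f (hdec a)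
    rw [map_sum, hf] at h
    simp only [map_smul, smul_eq_mul] at h
    simpa only [hf] using h
  refine ⟨fun y => ∑ i, ∑ j, (c i).smulRight (Ω y (e i) (e j) • c j), ?_, ?_⟩
  · intro y hy a b
    have h1 : Ω y a b = ∑ i, ∑ j, Ω y (e i) (e j) * (c i a * c j b) := by
      rw [hexp y hy a b]
      refine Finset.sum_congr rfl fun i _ => ?_
      -- Linearity is assumed in the first slot only; antisymmetry transfers the expansion to the
      -- second.
      rw [hanti y hy, hexp y hy b, ← Finset.sum_neg_distrib, Finset.mul_sum]
      refine Finset.sum_congr rfl fun j _ => ?_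
      rw [hanti y hy (e j) (e i)]
      ring
    rw [h1]
    simp only [sum_apply, ContinuousLinearMap.smulRight_apply, smul_apply, smul_eq_mul]
    exact Finset.sum_congr rfl fun i _ => Finset.sum_congr rfl fun j _ => by ring
  · intro y hy
    refine ContDiffAt.sum fun i _ => ContDiffAt.sum fun j _ => ?_
    exact ContDiffAt.smulRight contDiffAt_const ((hΩ y hy _ _).smul contDiffAt_const)

/-- A closed two-form is invariant under a vector field whose contraction with it is closed. -/
theorem fderiv_form_invariant {d : ℕ} {B : Euc d → Euc d →L[ℝ] Euc d →L[ℝ] ℝ} {X : Euc d → Euc d}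
    {z : Euc d} (hB : DifferentiableAt ℝ B z) (hX : DifferentiableAt ℝ X z)
    (hanti : ∀ᶠ y in 𝓝 z, ∀ a b, B y a b = -B y b a)
    (hclosed : ∀ u v w, fderiv ℝ (fun y => B y v w) z u - fderiv ℝ (fun y => B y u w) z v +
      fderiv ℝ (fun y => B y u v) z w = 0)
    (hσ : ∀ u w, fderiv ℝ (fun y => B y (X y)) z u w = fderiv ℝ (fun y => B y (X y)) z w u)
    (u w : Euc d) :
    fderiv ℝ B z (X z) u w + B z (fderiv ℝ X z u) w + B z u (fderiv ℝ X z w) = 0 := by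
  have h1 : ∀ a b c, fderiv ℝ (fun y => B y a b) z c = fderiv ℝ B z c a b := by
    intro a b c
    have := (hB.hasFDerivAt.clm_apply (hasFDerivAt_const a z)).clm_apply (hasFDerivAt_const b z)
    rw [this.fderiv]
    simp
  have h2 : ∀ c b, fderiv ℝ (fun y => B y (X y)) z c b =
      fderiv ℝ B z c (X z) b + B z (fderiv ℝ X z c) b := by
    intro c b
    rw [(hB.hasFDerivAt.clm_apply hX.hasFDerivAt).fderiv]
    simp [add_comm]
  -- This is Cartan's formula at a point: closedness with the frozen vector `X z` in the middle
  -- slot, and symmetry of the derivative of `i_X B`. After antisymmetry moves the arguments, their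
  -- sum is the claim.
  have h3 := hclosed u (X z) w
  have h4 := hσ u w
  have h5 := hanti.self_of_nhds u (fderiv ℝ X z w)
  simp only [h1] at h3
  rw [h2, h2] at h4
  rw [h5]
  have h6 : fderiv ℝ B z w (X z) u = -fderiv ℝ B z w u (X z) := by
    rw [← h1, ← h1, ← neg_eq_iff_eq_neg]
    have : (fun y => B y u (X z)) =ᶠ[𝓝 z] fun y => -B y (X z) u := by
      filter_upwards [hanti] with y hy using hy _ _
    rw [this.fderiv_eq, fderiv_fun_neg, neg_apply]
  linarith

variable {m n : ℕ} {M : Type v} [TopologicalSpace M] [ChartedSpace (Euc m) M]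
  [IsManifold (𝓡 m) ∞ M] {N : Type u} [TopologicalSpace N] [ChartedSpace (Euc n) N]
  [IsManifold (𝓡 n) ∞ N] {d : ℕ} {H : Type u} [TopologicalSpace H] [ChartedSpace (Euc d) H]
  [IsManifold (𝓡 d) ∞ H]

theorem contMDiffAt_ofCoord {q y : H} (hy : y ∈ (extChartAt (𝓡 d) q).source) (a : Euc d) :
    ContMDiffAt (𝓡 d) (𝓡 d).tangent ∞
      (fun x => (TotalSpace.mk' (Euc d) x (ofCoord q x a) : TangentBundle (𝓡 d) H)) y := by
  rw [contMDiffAt_vectorField_iff hy]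
  refine ContMDiffAt.congr_of_eventuallyEq (f := fun _ => a) contMDiffAt_const ?_
  filter_upwards [(isOpen_extChartAt_source (I := 𝓡 d) q).mem_nhds hy] with x hx
    using toCoord_ofCoord hx a

theorem IsSmoothTwoTensor.contDiffAt_coord
    {Ω : ∀ x : H, TangentSpace (𝓡 d) x → TangentSpace (𝓡 d) x → ℝ} (hΩ : IsSmoothTwoTensor Ω)
    {q : H} {z : Euc d} (hz : z ∈ (extChartAt (𝓡 d) q).target) (a b : Euc d) :
    ContDiffAt ℝ ∞ (fun z => Ω ((extChartAt (𝓡 d) q).symm z)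
      (ofCoord q ((extChartAt (𝓡 d) q).symm z) a)
      (ofCoord q ((extChartAt (𝓡 d) q).symm z) b)) z := by
  have h := hΩ _ (isOpen_extChartAt_source (I := 𝓡 d) q) (fun x => ofCoord q x a)
    (fun x => ofCoord q x b) (fun x hx => (contMDiffAt_ofCoord hx a).contMDiffWithinAt)
    (fun x hx => (contMDiffAt_ofCoord hx b).contMDiffWithinAt)
  have hz' := (extChartAt (𝓡 d) q).map_target hz
  exact contMDiffAt_iff_contDiffAt.1 (ContMDiffAt.comp z
    (h.contMDiffAt ((isOpen_extChartAt_source (I := 𝓡 d) q).mem_nhds hz'))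
    (contMDiffAt_chart_symm hz))

section Induced

variable (D : DiracStructure n N) {f : H → N}

theorem DiracStructure.exists_covector {x : N} {v : TangentSpace (𝓡 n) x} (hv : v ∈ D.char x) :
    ∃ α : Cotangent n x, (v, α) ∈ D.fiber x := by
  obtain ⟨b, hb, hbv⟩ := hv
  have hbv' : b.1 = v := hbv
  exact ⟨b.2, by rw [← hbv']; exact hb⟩

theorem DiracStructure.inducedForm_add
    (hF : ∀ y w, mfderiv (𝓡 d) (𝓡 n) f y w ∈ D.char (f y)) (y : H) (a b c : TangentSpace (𝓡 d) y) :
    D.inducedForm f y (a + b) c = D.inducedForm f y a c + D.inducedForm f y b c := by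
  obtain ⟨α, hα⟩ := D.exists_covector (hF y a)
  obtain ⟨β, hβ⟩ := D.exists_covector (hF y b)
  have h := (D.fiber (f y)).add_mem hα hβ
  rw [D.inducedForm_eq f y a c α hα (hF y c), D.inducedForm_eq f y b c β hβ (hF y c),
    D.inducedForm_eq f y (a + b) c (α + β) (by rw [map_add]; exact h) (hF y c)]
  rfl

theorem DiracStructure.inducedForm_smul
    (hF : ∀ y w, mfderiv (𝓡 d) (𝓡 n) f y w ∈ D.char (f y)) (y : H) (r : ℝ)
    (a c : TangentSpace (𝓡 d) y) :
    D.inducedForm f y (r • a) c = r * D.inducedForm f y a c := by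
  obtain ⟨α, hα⟩ := D.exists_covector (hF y a)
  have h := (D.fiber (f y)).smul_mem r hα
  rw [D.inducedForm_eq f y a c α hα (hF y c),
    D.inducedForm_eq f y (r • a) c (r • α) (by rw [map_smul]; exact h) (hF y c)]
  rfl

/-- Isotropy of `D` applied to lifts of the two vectors. -/
theorem DiracStructure.inducedForm_antisymm
    (hF : ∀ y w, mfderiv (𝓡 d) (𝓡 n) f y w ∈ D.char (f y)) (y : H) (a b : TangentSpace (𝓡 d) y) :
    D.inducedForm f y a b = -D.inducedForm f y b a := by
  obtain ⟨α, hα⟩ := D.exists_covector (hF y a)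
  obtain ⟨β, hβ⟩ := D.exists_covector (hF y b)
  have h := (D.lagrangian _ _).1 hα _ hβ
  rw [D.inducedForm_eq f y a b α hα (hF y b), D.inducedForm_eq f y b a β hβ (hF y a)]
  exact eq_neg_of_add_eq_zero_left h

end Induced

/-- The coordinate expression of the induced form, and its invariance under `X`. -/
theorem DiracStructure.exists_invariant_formCoord [SecondCountableTopology M]
    (D : DiracStructure n N) (hD : D.Integrable)
    {pr : M → N} (h_pr : IsSurjectiveSubmersion m n pr) {E : M → ℝ}
    (hE : IsWeakMorseFamily m n pr E) {f : H → N} (hf : ContMDiff (𝓡 d) (𝓡 n) ∞ f)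
    (hinj : ∀ y, Function.Injective (mfderiv (𝓡 d) (𝓡 n) f y))
    (hF : ∀ y w, mfderiv (𝓡 d) (𝓡 n) f y w ∈ D.char (f y))
    (hs : IsSmoothTwoTensor (n := d) (D.inducedForm f)) {X : ∀ y : H, TangentSpace (𝓡 d) y}
    (hX : SmoothVectorFieldOn X Set.univ) {μ : ∀ y : H, Cotangent n (f y)}
    (hμ : ContMDiff (𝓡 d) (cotangentModel n) ∞
      (fun y => (TotalSpace.mk' (Euc n →L[ℝ] ℝ) (f y) (μ y) : CotangentBundle n N)))
    (hμE : ∀ y, (TotalSpace.mk' (Euc n →L[ℝ] ℝ) (f y) (μ y) : CotangentBundle n N) ∈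
      lagrangianOf m n pr E)
    (hXμ : ∀ (y : H) (w : TangentSpace (𝓡 d) y),
      D.inducedForm f y (X y) w = eval (μ y) (mfderiv (𝓡 d) (𝓡 n) f y w)) (q : H) :
    ∃ B : Euc d → Euc d →L[ℝ] Euc d →L[ℝ] ℝ,
      (∀ y ∈ (extChartAt (𝓡 d) q).source, ∀ v w, D.inducedForm f y v w =
        B (extChartAt (𝓡 d) q y) (toCoord q y v) (toCoord q y w)) ∧
      ContDiffAt ℝ ∞ B (extChartAt (𝓡 d) q q) ∧
      ∀ u w, fderiv ℝ B (extChartAt (𝓡 d) q q) (coordField q X (extChartAt (𝓡 d) q q)) u w +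
        B (extChartAt (𝓡 d) q q) (fderiv ℝ (coordField q X) (extChartAt (𝓡 d) q q) u) w +
        B (extChartAt (𝓡 d) q q) u (fderiv ℝ (coordField q X) (extChartAt (𝓡 d) q q) w) = 0 := by
  set φ := (extChartAt (𝓡 d) q).symm with hφ
  set O := (extChartAt (𝓡 d) q).target with hOdef
  have hO : IsOpen O := isOpen_extChartAt_target q
  set z₀ := extChartAt (𝓡 d) q q with hz₀
  have hz₀O : z₀ ∈ O := mem_extChartAt_target q
  have hφO : ∀ z ∈ O, φ z ∈ (extChartAt (𝓡 d) q).source := fun z hz =>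
    (extChartAt (𝓡 d) q).map_target hz
  obtain ⟨B, hB, hBs⟩ := exists_bilinear
    (Ω := fun z a b => D.inducedForm f (φ z) (ofCoord q (φ z) a) (ofCoord q (φ z) b)) (O := O)
    (fun z _ a b c => by
      simp only [map_add]
      exact D.inducedForm_add hF _ _ _ _)
    (fun z _ r a c => by
      simp only [map_smul]
      exact D.inducedForm_smul hF _ _ _ _)
    (fun z _ a b => D.inducedForm_antisymm hF _ _ _)
    (fun z hz a b => hs.contDiffAt_coord hz a b)
  have hanti : ∀ z ∈ O, ∀ a b, B z a b = -B z b a := by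
    intro z hz a b
    rw [hB z hz, hB z hz]
    exact D.inducedForm_antisymm hF _ _ _
  set κ : Euc d → N := fun z => f (φ z) with hκdef
  have hκ : ∀ z ∈ O, ContMDiffAt 𝓘(ℝ, Euc d) (𝓡 n) ∞ κ z := fun z hz =>
    ContMDiffAt.comp z (hf (φ z)) (contMDiffAt_chart_symm hz)
  have hTκ : ∀ z ∈ O, ∀ a : Euc d, mfderiv 𝓘(ℝ, Euc d) (𝓡 n) κ z a =
      mfderiv (𝓡 d) (𝓡 n) f (φ z) (ofCoord q (φ z) a) := by
    intro z hz a
    have h := DFunLike.congr_fun (mfderiv_comp z ((hf (φ z)).mdifferentiableAt (by simp))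
      (mdifferentiableAt_chart_symm hz)) a
    exact h.trans (congrArg (mfderiv (𝓡 d) (𝓡 n) f (φ z)) (mfderiv_chart_symm hz a))
  refine ⟨B, ?_, hBs z₀ hz₀O, ?_⟩
  · intro y hy v w
    rw [hB _ ((extChartAt (𝓡 d) q).map_source hy)]
    -- `φ` of the chart value equals `y` only propositionally, so the dependent statement is
    -- generalized over the base point before substitution.
    have key : ∀ y', y' = y → D.inducedForm f y v w =
        D.inducedForm f y' (ofCoord q y' (toCoord q y v)) (ofCoord q y' (toCoord q y w)) := by
      rintro _ rfl
      rw [ofCoord_toCoord hy, ofCoord_toCoord hy]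
    exact key _ ((extChartAt (𝓡 d) q).left_inv hy)
  · have hcl : ∀ u v w, fderiv ℝ (fun y => B y v w) z₀ u - fderiv ℝ (fun y => B y u w) z₀ v +
        fderiv ℝ (fun y => B y u v) z₀ w = 0 := by
      intro u v w
      refine D.fderiv_form_cyclic hD (κ := κ) (Ω := fun y a b => B y a b) hO hκ ?_ ?_ ?_ ?_ hz₀O
        u v w
      · intro z hz a b hab
        have hab' : mfderiv (𝓡 d) (𝓡 n) f (φ z) (ofCoord q (φ z) a) =
            mfderiv (𝓡 d) (𝓡 n) f (φ z) (ofCoord q (φ z) b) :=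
          (hTκ z hz a).symm.trans (hab.trans (hTκ z hz b))
        have h := congrArg (toCoord q (φ z)) (hinj _ hab')
        exact (toCoord_ofCoord (hφO z hz) a).symm.trans
          (h.trans (toCoord_ofCoord (hφO z hz) b))
      · intro z hz w
        have h := hF (φ z) (ofCoord q (φ z) w)
        rw [← hTκ z hz w] at h
        exact h
      · intro z hz u w α hα
        rw [hTκ z hz u] at hα
        have h := D.inducedForm_eq f (φ z) (ofCoord q (φ z) u) (ofCoord q (φ z) w) α hα
          (hF (φ z) _)
        refine (hB z hz u w).trans (h.trans ?_)
        exact congrArg (eval α) (hTκ z hz w).symm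
      · intro z hz u w
        exact ((hBs z hz).clm_apply contDiffAt_const).clm_apply contDiffAt_const
    have hXs : ContDiffAt ℝ ∞ (coordField q X) z₀ :=
      contDiffAt_coordField hz₀O ((hX.contMDiffAt Filter.univ_mem))
    refine fderiv_form_invariant ((hBs z₀ hz₀O).differentiableAt (by simp))
      (hXs.differentiableAt (by simp)) ?_ hcl ?_
    · filter_upwards [hO.mem_nhds hz₀O] with z hz using hanti z hz
    · intro u w
      set p : N := f (φ z₀) with hp
      set ν : Euc d → CotangentBundle n N :=
        fun z => TotalSpace.mk' (Euc n →L[ℝ] ℝ) (f (φ z)) (μ (φ z)) with hν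
      have hνs : ContMDiffAt 𝓘(ℝ, Euc d) (cotangentModel n) ∞ ν z₀ :=
        ContMDiffAt.comp z₀ (hμ (φ z₀)) (contMDiffAt_chart_symm hz₀O)
      have hpsrc : p ∈ (extChartAt (𝓡 n) p).source := mem_extChartAt_source p
      have e1 : ∀ᶠ z in 𝓝 z₀, ContDiffAt ℝ 3 (fun z => extChartAt (𝓡 n) p (ν z).proj) z :=
        ContDiffAt.eventually ((contMDiffAt_iff_contDiffAt.1 (ContMDiffAt.comp z₀
          (contMDiffAt_chart hpsrc) (hκ z₀ hz₀O))).of_le ENat.LEInfty.out) (by simp)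
      have e2 : ∀ᶠ z in 𝓝 z₀, ContDiffAt ℝ 3 (fun z => covectorCoord p (ν z).2) z :=
        ContDiffAt.eventually ((contMDiffAt_iff_contDiffAt.1
          (contMDiffAt_cotangent_iff.1 hνs).2).of_le ENat.LEInfty.out) (by simp)
      have e3 : ∀ᶠ z in 𝓝 z₀, (ν z).proj ∈ (extChartAt (𝓡 n) p).source :=
        (hκ z₀ hz₀O).continuousAt.preimage_mem_nhds
          ((isOpen_extChartAt_source (I := 𝓡 n) p).mem_nhds hpsrc)
      have e4 : ∀ᶠ z in 𝓝 z₀, z ∈ O := hO.mem_nhds hz₀O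
      obtain ⟨O', hO'sub, hO', hz₀'⟩ := _root_.mem_nhds_iff.1 (e1.and (e2.and (e3.and e4)))
      have hsym := fderiv_pullback_symm h_pr hE hO' (fun z hz => (hO'sub hz).2.2.1)
        (fun z _ => hμE (φ z)) (fun z hz => (hO'sub hz).1) (fun z hz => (hO'sub hz).2.1) hz₀' u w
      -- The hypothesis `i_X ω = μ` on the leaf, in coordinates: the contraction is `μ ∘ dκ`, whose
      -- derivative is symmetric by `hsym`.
      have heq : (fun z => B z (coordField q X z)) =ᶠ[𝓝 z₀] fun z =>
          covectorCoord p (ν z).2 ∘L fderiv ℝ (fun z => extChartAt (𝓡 n) p (ν z).proj) z := by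
        filter_upwards [hO'.mem_nhds hz₀'] with z hz
        have hzO : z ∈ O := (hO'sub hz).2.2.2
        have hzp : κ z ∈ (extChartAt (𝓡 n) p).source := (hO'sub hz).2.2.1
        ext a
        have h1 : B z (coordField q X z) a =
            D.inducedForm f (φ z) (X (φ z)) (ofCoord q (φ z) a) := by
          refine (hB z hzO _ a).trans ?_
          exact congrArg (fun t => D.inducedForm f (φ z) t (ofCoord q (φ z) a))
            (ofCoord_toCoord (hφO z hzO) _)
        rw [h1, hXμ]
        have h2 := fderiv_chart_comp ((hκ z hzO).mdifferentiableAt (by simp)) hzp a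
        rw [hTκ z hzO a] at h2
        have h3 := congrArg (ofCoord p (κ z)) h2
        rw [ofCoord_toCoord hzp] at h3
        exact (congrArg (eval (μ (φ z))) h3).symm
      rw [heq.fderiv_eq]
      exact hsym

end FormCoordinates

/-! ### Lie derivative and flow -/

section Flow

set_option linter.unusedSectionVars false

open Filter Topology

set_option synthInstance.maxHeartbeats 200000 in
/-- An infinitesimally invariant two-form is constant along the flow. -/
theorem hasDerivAt_form_flow {d : ℕ} {B : Euc d → Euc d →L[ℝ] Euc d →L[ℝ] ℝ} {X : Euc d → Euc d}
    {ψ : ℝ × Euc d → Euc d} {t₀ : ℝ} {x₀ : Euc d} (hψ : ContDiffAt ℝ 2 ψ (t₀, x₀))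
    (hflow : ∀ᶠ p in 𝓝 (t₀, x₀), fderiv ℝ ψ p (1, 0) = X (ψ p))
    (hB : DifferentiableAt ℝ B (ψ (t₀, x₀))) (hX : DifferentiableAt ℝ X (ψ (t₀, x₀)))
    (hinv : ∀ u w, fderiv ℝ B (ψ (t₀, x₀)) (X (ψ (t₀, x₀))) u w +
      B (ψ (t₀, x₀)) (fderiv ℝ X (ψ (t₀, x₀)) u) w +
      B (ψ (t₀, x₀)) u (fderiv ℝ X (ψ (t₀, x₀)) w) = 0) (v w : Euc d) :
    HasDerivAt (fun t => B (ψ (t, x₀)) (fderiv ℝ ψ (t, x₀) (0, v)) (fderiv ℝ ψ (t, x₀) (0, w)))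
      0 t₀ := by
  have hψ1 : DifferentiableAt ℝ ψ (t₀, x₀) := hψ.differentiableAt (by simp)
  have hψ2 : DifferentiableAt ℝ (fderiv ℝ ψ) (t₀, x₀) :=
    (hψ.fderiv_right (m := 1) (by norm_num)).differentiableAt (by simp)
  have hc : HasDerivAt (fun t : ℝ => (t, x₀)) ((1 : ℝ), (0 : Euc d)) t₀ :=
    (hasDerivAt_id t₀).prodMk (hasDerivAt_const t₀ x₀)
  have h1 : HasDerivAt (fun t => ψ (t, x₀)) (X (ψ (t₀, x₀))) t₀ := by
    rw [← hflow.self_of_nhds]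
    exact hψ1.hasFDerivAt.comp_hasDerivAt t₀ hc
  have h2 : HasDerivAt (fun t => B (ψ (t, x₀))) (fderiv ℝ B (ψ (t₀, x₀)) (X (ψ (t₀, x₀)))) t₀ :=
    HasFDerivAt.comp_hasDerivAt (E := Euc d →L[ℝ] Euc d →L[ℝ] ℝ) t₀ hB.hasFDerivAt h1
  have h3 : HasDerivAt (fun t => fderiv ℝ ψ (t, x₀)) (fderiv ℝ (fderiv ℝ ψ) (t₀, x₀) (1, 0)) t₀ :=
    hψ2.hasFDerivAt.comp_hasDerivAt t₀ hc
  -- The variational equation: exchanging the time and space derivatives of the flow equation.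
  have h4 : ∀ a : Euc d, fderiv ℝ (fderiv ℝ ψ) (t₀, x₀) (1, 0) (0, a) =
      fderiv ℝ X (ψ (t₀, x₀)) (fderiv ℝ ψ (t₀, x₀) (0, a)) := by
    intro a
    have hs : fderiv ℝ (fderiv ℝ ψ) (t₀, x₀) (1, 0) (0, a) =
        fderiv ℝ (fderiv ℝ ψ) (t₀, x₀) (0, a) (1, 0) := hψ.isSymmSndFDerivAt (by simp) _ _
    have h5 : HasFDerivAt (fun p => fderiv ℝ ψ p ((1 : ℝ), (0 : Euc d))) _ (t₀, x₀) :=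
      hψ2.hasFDerivAt.clm_apply (hasFDerivAt_const _ _)
    have h6 := (hX.hasFDerivAt.comp (t₀, x₀) hψ1.hasFDerivAt).congr_of_eventuallyEq hflow
    rw [hs]
    simpa using DFunLike.congr_fun (h5.unique h6) (0, a)
  have h7 : ∀ a : Euc d, HasDerivAt (fun t => fderiv ℝ ψ (t, x₀) (0, a))
      (fderiv ℝ X (ψ (t₀, x₀)) (fderiv ℝ ψ (t₀, x₀) (0, a))) t₀ := by
    intro a
    have := h3.clm_apply (hasDerivAt_const t₀ ((0 : ℝ), a))
    rw [h4, map_zero, add_zero] at this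
    exact this
  -- The product rule yields the three terms of `hinv`, evaluated at the transported vectors.
  have h8 := (h2.clm_apply (h7 v)).clm_apply (h7 w)
  exact h8.congr_deriv (Eq.trans rfl
    (hinv (fderiv ℝ ψ (t₀, x₀) (0, v)) (fderiv ℝ ψ (t₀, x₀) (0, w))))

variable {d : ℕ} {H : Type u} [TopologicalSpace H] [ChartedSpace (Euc d) H]
  [IsManifold (𝓡 d) ∞ H]

theorem coordField_chart {q x : H} (hx : x ∈ (extChartAt (𝓡 d) q).source)
    (V : ∀ x : H, TangentSpace (𝓡 d) x) :
    coordField q V (extChartAt (𝓡 d) q x) = toCoord q x (V x) := by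
  have key : ∀ y, y = x → toCoord q y (V y) = toCoord q x (V x) := by
    rintro _ rfl; rfl
  exact key _ ((extChartAt (𝓡 d) q).left_inv hx)

/-- In coordinates the derivatives of `Y` and `Z` coming from `X(Ω(Y, Z))` cancel against those in
the two brackets; what remains is the invariance expression `hinv` at the values of `Y` and `Z`. -/
theorem lieDerivative_eq_zero {q : H} {X Y Z : ∀ x : H, TangentSpace (𝓡 d) x}
    {Ω : ∀ x : H, TangentSpace (𝓡 d) x → TangentSpace (𝓡 d) x → ℝ}
    {B : Euc d → Euc d →L[ℝ] Euc d →L[ℝ] ℝ}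
    (hΩ : ∀ y ∈ (extChartAt (𝓡 d) q).source, ∀ v w,
      Ω y v w = B (extChartAt (𝓡 d) q y) (toCoord q y v) (toCoord q y w))
    (hB : DifferentiableAt ℝ B (extChartAt (𝓡 d) q q))
    (hinv : ∀ u w,
      fderiv ℝ B (extChartAt (𝓡 d) q q) (coordField q X (extChartAt (𝓡 d) q q)) u w +
      B (extChartAt (𝓡 d) q q) (fderiv ℝ (coordField q X) (extChartAt (𝓡 d) q q) u) w +
      B (extChartAt (𝓡 d) q q) u (fderiv ℝ (coordField q X) (extChartAt (𝓡 d) q q) w) = 0)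
    (hY : ContMDiffAt (𝓡 d) (𝓡 d).tangent ∞
      (fun x => (TotalSpace.mk' (Euc d) x (Y x) : TangentBundle (𝓡 d) H)) q)
    (hZ : ContMDiffAt (𝓡 d) (𝓡 d).tangent ∞
      (fun x => (TotalSpace.mk' (Euc d) x (Z x) : TangentBundle (𝓡 d) H)) q) :
    lieDerivative X Ω Y Z q = 0 := by
  have hq : q ∈ (extChartAt (𝓡 d) q).source := mem_extChartAt_source q
  have hz : extChartAt (𝓡 d) q q ∈ (extChartAt (𝓡 d) q).target := mem_extChartAt_target q
  have hd : ∀ V : ∀ x : H, TangentSpace (𝓡 d) x, ContMDiffAt (𝓡 d) (𝓡 d).tangent ∞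
      (fun x => (TotalSpace.mk' (Euc d) x (V x) : TangentBundle (𝓡 d) H)) q →
      DifferentiableAt ℝ (coordField q V) (extChartAt (𝓡 d) q q) := fun V hV =>
    (contDiffAt_coordField hz (by rwa [extChartAt_to_inv])).differentiableAt (by simp)
  set z := extChartAt (𝓡 d) q q with hzdef
  have hg := (hB.hasFDerivAt.clm_apply (hd Y hY).hasFDerivAt).clm_apply (hd Z hZ).hasFDerivAt
  have heq : (fun x => Ω x (Y x) (Z x)) =ᶠ[𝓝 q]
      (fun z => B z (coordField q Y z) (coordField q Z z)) ∘ extChartAt (𝓡 d) q := by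
    filter_upwards [(isOpen_extChartAt_source (I := 𝓡 d) q).mem_nhds hq] with x hx
    rw [hΩ x hx, Function.comp_apply, coordField_chart hx, coordField_chart hx]
  have h1 : dirDeriv (fun x => Ω x (Y x) (Z x)) q (X q) =
      fderiv ℝ (fun z => B z (coordField q Y z) (coordField q Z z)) z (toCoord q q (X q)) := by
    have h2 := (hg.hasMFDerivAt.comp q
      (mdifferentiableAt_chart hq).hasMFDerivAt).congr_of_eventuallyEq heq
    rw [hg.fderiv]
    exact DFunLike.congr_fun h2.mfderiv (X q)
  have hbr : ∀ V : ∀ x : H, TangentSpace (𝓡 d) x, toCoord q q (bracket X V q) =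
      fderiv ℝ (coordField q V) z (coordField q X z) -
        fderiv ℝ (coordField q X) z (coordField q V z) := toCoord_bracket q X
  have hXq := coordField_chart hq X
  have hYq := coordField_chart hq Y
  have hZq := coordField_chart hq Z
  have h3 := hinv (coordField q Y z) (coordField q Z z)
  unfold lieDerivative
  rw [h1, hΩ q hq, hΩ q hq, hbr, hbr, hg.fderiv, ← hXq, ← hYq, ← hZq]
  simp only [map_sub, sub_apply, add_apply, ContinuousLinearMap.comp_apply,
    ContinuousLinearMap.flip_apply] at h3 ⊢
  linarith

/-- The flow of `X` preserves a two-form that is infinitesimally invariant in all charts. -/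
theorem flow_preserves {X : ∀ x : H, TangentSpace (𝓡 d) x}
    {Ω : ∀ x : H, TangentSpace (𝓡 d) x → TangentSpace (𝓡 d) x → ℝ}
    (hX : SmoothVectorFieldOn X Set.univ)
    (hΩ : ∀ q : H, ∃ B : Euc d → Euc d →L[ℝ] Euc d →L[ℝ] ℝ,
      (∀ y ∈ (extChartAt (𝓡 d) q).source, ∀ v w,
        Ω y v w = B (extChartAt (𝓡 d) q y) (toCoord q y v) (toCoord q y w)) ∧
      ContDiffAt ℝ ∞ B (extChartAt (𝓡 d) q q) ∧
      ∀ u w, fderiv ℝ B (extChartAt (𝓡 d) q q) (coordField q X (extChartAt (𝓡 d) q q)) u w +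
        B (extChartAt (𝓡 d) q q) (fderiv ℝ (coordField q X) (extChartAt (𝓡 d) q q) u) w +
        B (extChartAt (𝓡 d) q q) u (fderiv ℝ (coordField q X) (extChartAt (𝓡 d) q q) w) = 0)
    {J : Set ℝ} {U : Set H} {Φ : ℝ → H → H} (hJ : IsOpen J) (hJc : J.OrdConnected)
    (h0 : (0 : ℝ) ∈ J) (hU : IsOpen U)
    (hΦ : ContMDiffOn (𝓘(ℝ, ℝ).prod (𝓡 d)) (𝓡 d) ∞ (fun p : ℝ × H => Φ p.1 p.2) (J ×ˢ U))
    (hΦ0 : ∀ y ∈ U, Φ 0 y = y)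
    (hint : ∀ y ∈ U, IsMIntegralCurveOn (I := 𝓡 d) (fun t => Φ t y) X J)
    {t : ℝ} (ht : t ∈ J) {y : H} (hy : y ∈ U) (v w : TangentSpace (𝓡 d) y) :
    Ω (Φ t y) (mfderiv (𝓡 d) (𝓡 d) (Φ t) y v) (mfderiv (𝓡 d) (𝓡 d) (Φ t) y w) = Ω y v w := by
  have hΦat : ∀ s ∈ J, ∀ y' ∈ U,
      ContMDiffAt (𝓘(ℝ, ℝ).prod (𝓡 d)) (𝓡 d) ∞ (fun p : ℝ × H => Φ p.1 p.2) (s, y') :=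
    fun s hs y' hy' => hΦ.contMDiffAt ((hJ.prod hU).mem_nhds ⟨hs, hy'⟩)
  have hΦd : ∀ s ∈ J, ∀ y' ∈ U, MDifferentiableAt (𝓡 d) (𝓡 d) (Φ s) y' := by
    intro s hs y' hy'
    have h : ContMDiffAt (𝓡 d) (𝓡 d) ∞ (fun y => Φ s y) y' :=
      ContMDiffAt.comp (g := fun p : ℝ × H => Φ p.1 p.2) (f := fun y => (s, y)) y'
        (hΦat s hs y' hy') (contMDiffAt_const.prodMk contMDiffAt_id)
    exact h.mdifferentiableAt (by simp)
  have hder : ∀ t₀ ∈ J, HasDerivAt (fun s => Ω (Φ s y) (mfderiv (𝓡 d) (𝓡 d) (Φ s) y v)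
      (mfderiv (𝓡 d) (𝓡 d) (Φ s) y w)) 0 t₀ := by
    intro t₀ ht₀
    -- Invariance is available at chart centres only, so for each time `t₀` the target chart is
    -- recentred at `Φ t₀ y`, while the source chart stays at `y`.
    obtain ⟨B, hB, hBs, hinv⟩ := hΩ (Φ t₀ y)
    set q := Φ t₀ y with hq
    have hqs : q ∈ (extChartAt (𝓡 d) q).source := mem_extChartAt_source q
    set x₀ : Euc d := extChartAt (𝓡 d) y y with hx₀
    have hx₀t : x₀ ∈ (extChartAt (𝓡 d) y).target := mem_extChartAt_target y
    have hinvy : (extChartAt (𝓡 d) y).symm x₀ = y := extChartAt_to_inv y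
    have hΨ : ContMDiffAt 𝓘(ℝ, ℝ × Euc d) (𝓡 d) ∞
        (fun p : ℝ × Euc d => Φ p.1 ((extChartAt (𝓡 d) y).symm p.2)) (t₀, x₀) := by
      refine ContMDiffAt.comp (I' := 𝓘(ℝ, ℝ).prod (𝓡 d)) (g := fun p : ℝ × H => Φ p.1 p.2)
        (f := fun p : ℝ × Euc d => (p.1, (extChartAt (𝓡 d) y).symm p.2)) (t₀, x₀)
        (hΦat t₀ ht₀ _ (by rw [hinvy]; exact hy)) ?_
      refine ContMDiffAt.prodMk contDiff_fst.contMDiff.contMDiffAt ?_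
      exact ContMDiffAt.comp (I' := 𝓘(ℝ, Euc d)) (g := (extChartAt (𝓡 d) y).symm) (f := Prod.snd)
        (t₀, x₀) (contMDiffAt_chart_symm hx₀t) contDiff_snd.contMDiff.contMDiffAt
    set ψ : ℝ × Euc d → Euc d :=
      fun p => extChartAt (𝓡 d) q (Φ p.1 ((extChartAt (𝓡 d) y).symm p.2)) with hψdef
    have hΨ0 : Φ t₀ ((extChartAt (𝓡 d) y).symm x₀) = q := by rw [hinvy]
    have hψ0 : ψ (t₀, x₀) = extChartAt (𝓡 d) q q := congrArg (extChartAt (𝓡 d) q) hΨ0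
    have hψ : ContDiffAt ℝ ∞ ψ (t₀, x₀) := contMDiffAt_iff_contDiffAt.1
      (ContMDiffAt.comp (g := extChartAt (𝓡 d) q)
        (f := fun p : ℝ × Euc d => Φ p.1 ((extChartAt (𝓡 d) y).symm p.2)) (t₀, x₀)
        (contMDiffAt_chart (by rw [hΨ0]; exact hqs)) hΨ)
    have hψ2 : ContDiffAt ℝ 2 ψ (t₀, x₀) := hψ.of_le ENat.LEInfty.out
    have hnear : ∀ᶠ p : ℝ × Euc d in 𝓝 (t₀, x₀), p.1 ∈ J ∧
        (extChartAt (𝓡 d) y).symm p.2 ∈ U ∧ p.2 ∈ (extChartAt (𝓡 d) y).target ∧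
        Φ p.1 ((extChartAt (𝓡 d) y).symm p.2) ∈ (extChartAt (𝓡 d) q).source ∧
        DifferentiableAt ℝ ψ p := by
      have e1 : ∀ᶠ p : ℝ × Euc d in 𝓝 (t₀, x₀), p.1 ∈ J :=
        continuousAt_fst.preimage_mem_nhds (hJ.mem_nhds ht₀)
      have e2 : ∀ᶠ p : ℝ × Euc d in 𝓝 (t₀, x₀), p.2 ∈ (extChartAt (𝓡 d) y).target :=
        continuousAt_snd.preimage_mem_nhds ((isOpen_extChartAt_target (I := 𝓡 d) y).mem_nhds hx₀t)
      have e3 : ∀ᶠ p : ℝ × Euc d in 𝓝 (t₀, x₀), (extChartAt (𝓡 d) y).symm p.2 ∈ U := by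
        have hcont : ContinuousAt (fun p : ℝ × Euc d => (extChartAt (𝓡 d) y).symm p.2) (t₀, x₀) :=
          ContinuousAt.comp (g := (extChartAt (𝓡 d) y).symm) (f := Prod.snd)
            (contMDiffAt_chart_symm hx₀t).continuousAt continuousAt_snd
        exact hcont.preimage_mem_nhds (hU.mem_nhds (by rw [hinvy]; exact hy))
      have e4 : ∀ᶠ p : ℝ × Euc d in 𝓝 (t₀, x₀),
          Φ p.1 ((extChartAt (𝓡 d) y).symm p.2) ∈ (extChartAt (𝓡 d) q).source :=
        hΨ.continuousAt.preimage_mem_nhds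
          ((isOpen_extChartAt_source (I := 𝓡 d) q).mem_nhds (by rw [hΨ0]; exact hqs))
      have e5 : ∀ᶠ p : ℝ × Euc d in 𝓝 (t₀, x₀), ContDiffAt ℝ 2 ψ p :=
        hψ2.eventually (by simp)
      filter_upwards [e1, e2, e3, e4, e5] with p h1 h2 h3 h4 h5
        using ⟨h1, h3, h2, h4, h5.differentiableAt (by simp)⟩
    have hflow : ∀ᶠ p in 𝓝 (t₀, x₀), fderiv ℝ ψ p (1, 0) = coordField q X (ψ p) := by
      filter_upwards [hnear] with p hp
      obtain ⟨hp1, hp2, -, hp4, hp5⟩ := hp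
      obtain ⟨s, x⟩ := p
      rw [coordField_chart hp4 X]
      have h1 := (hint _ hp2 s hp1).hasMFDerivAt (hJ.mem_nhds hp1)
      have h2 := ((mdifferentiableAt_chart hp4).hasMFDerivAt.comp s h1).hasFDerivAt
      have h3 : HasFDerivAt (fun t : ℝ => (t, x)) _ s :=
        (hasFDerivAt_id (𝕜 := ℝ) s).prodMk (hasFDerivAt_const x s)
      have h4 := hp5.hasFDerivAt.comp s h3
      have h5 := DFunLike.congr_fun (h4.unique h2) 1
      have h6 : fderiv ℝ ψ (s, x) (1, 0) = toCoord q (Φ s ((extChartAt (𝓡 d) y).symm x))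
          ((1 : ℝ) • X (Φ s ((extChartAt (𝓡 d) y).symm x))) := h5
      rw [one_smul] at h6
      exact h6
    have hspace : ∀ᶠ s in 𝓝 t₀, Φ s y ∈ (extChartAt (𝓡 d) q).source ∧
        ψ (s, x₀) = extChartAt (𝓡 d) q (Φ s y) ∧
        ∀ a : TangentSpace (𝓡 d) y, toCoord q (Φ s y) (mfderiv (𝓡 d) (𝓡 d) (Φ s) y a) =
          fderiv ℝ ψ (s, x₀) (0, toCoord y y a) := by
      have hc : ContinuousAt (fun s : ℝ => (s, x₀)) t₀ := by fun_prop
      filter_upwards [hc.eventually hnear] with s hs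
      obtain ⟨hs1, hs2, hs3, hs4, hs5⟩ := hs
      refine ⟨by rw [hinvy] at hs4; exact hs4, by simp only [hψdef, hinvy], fun a => ?_⟩
      have hκ := (hΦd s hs1 _ hs2).hasMFDerivAt.comp x₀
        (mdifferentiableAt_chart_symm hs3).hasMFDerivAt
      have h1 := fderiv_chart_comp (κ := fun x => Φ s ((extChartAt (𝓡 d) y).symm x))
        hκ.mdifferentiableAt hs4 (toCoord y y a)
      have h2 : mfderiv 𝓘(ℝ, Euc d) (𝓡 d) (fun x => Φ s ((extChartAt (𝓡 d) y).symm x)) x₀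
          (toCoord y y a) = mfderiv (𝓡 d) (𝓡 d) (Φ s) ((extChartAt (𝓡 d) y).symm x₀)
            (ofCoord y ((extChartAt (𝓡 d) y).symm x₀) (toCoord y y a)) :=
        (DFunLike.congr_fun hκ.mfderiv (toCoord y y a)).trans
          (congrArg (mfderiv (𝓡 d) (𝓡 d) (Φ s) _) (mfderiv_chart_symm hs3 _))
      have h3 : HasFDerivAt (fun x : Euc d => (s, x)) _ x₀ :=
        (hasFDerivAt_const (𝕜 := ℝ) s x₀).prodMk (hasFDerivAt_id x₀)
      have h4 := (hs5.hasFDerivAt.comp x₀ h3).fderiv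
      have h5 : fderiv ℝ (fun x => ψ (s, x)) x₀ (toCoord y y a) =
          fderiv ℝ ψ (s, x₀) (0, toCoord y y a) := DFunLike.congr_fun h4 (toCoord y y a)
      have key : ∀ y', y' = y → toCoord q (Φ s y') (mfderiv (𝓡 d) (𝓡 d) (Φ s) y'
          (ofCoord y y' (toCoord y y a))) =
          toCoord q (Φ s y) (mfderiv (𝓡 d) (𝓡 d) (Φ s) y a) := by
        rintro _ rfl
        rw [ofCoord_toCoord (mem_extChartAt_source _)]
      rw [← h5, ← key _ hinvy]
      exact (h1.trans (congrArg (toCoord q _) h2)).symm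
    have hmain := hasDerivAt_form_flow (B := B) (X := coordField q X) hψ2 hflow
      (by rw [hψ0]; exact hBs.differentiableAt (by simp))
      (by
        rw [hψ0]
        exact (contDiffAt_coordField (mem_extChartAt_target q)
          (hX.contMDiffAt Filter.univ_mem)).differentiableAt (by simp))
      (by rw [hψ0]; exact hinv) (toCoord y y v) (toCoord y y w)
    refine hmain.congr_of_eventuallyEq ?_
    filter_upwards [hspace] with s hs
    rw [hB _ hs.1, hs.2.1, hs.2.2, hs.2.2]
  -- The pulled-back form is constant in time on the interval `J`, so it equals its value at time
  -- `0`, where the flow is the identity near `y`.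
  have hconst := hJ.is_const_of_deriv_eq_zero hJc.isPreconnected
    (fun s hs => (hder s hs).differentiableAt.differentiableWithinAt)
    (fun s hs => (hder s hs).deriv) ht h0
  refine hconst.trans ?_
  have hid : Φ 0 =ᶠ[𝓝 y] id := by
    filter_upwards [hU.mem_nhds hy] with y' hy' using hΦ0 y' hy'
  have hT : ∀ a : TangentSpace (𝓡 d) y,
      (mfderiv (𝓡 d) (𝓡 d) (Φ 0) y a : Euc d) = (a : Euc d) := by
    intro a
    have h := ((hasMFDerivAt_id (I := 𝓡 d) y).congr_of_eventuallyEq hid).mfderiv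
    exact DFunLike.congr_fun h a
  have key : ∀ y', y' = y → ∀ a b : Euc d, a = v → b = w → Ω y' a b = Ω y v w := by
    rintro _ rfl _ _ rfl rfl; rfl
  exact key _ (hΦ0 y hy) _ _ (hT v) (hT w)

end Flow

end DiracSystem

end

theorem mainTheorem2
    {m n : ℕ}
    {M : Type v} [TopologicalSpace M] [T2Space M] [SecondCountableTopology M]
    [ChartedSpace (DiracSystem.Euc m) M] [IsManifold (𝓡 m) ∞ M]
    {N : Type u} [TopologicalSpace N] [T2Space N] [SecondCountableTopology N]
    [ChartedSpace (DiracSystem.Euc n) N] [IsManifold (𝓡 n) ∞ N]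
    -- the integrable Dirac structure and the weak Morse family
    (D : DiracSystem.DiracStructure n N) (hD : D.Integrable)
    (pr : M → N) (h_pr : DiracSystem.IsSurjectiveSubmersion m n pr)
    (E : M → ℝ) (hE : DiracSystem.IsWeakMorseFamily m n pr E)
    -- the integrability algorithm, with final constraint manifold `Nk kf`, and a point `z` of it
    (Nk : ℕ → DiracSystem.ImmersedSubmanifold (𝓡 n) N) (kf : ℕ)
    (halg : DiracSystem.AlgorithmStabilizes
      (DiracSystem.implicitEquation D (DiracSystem.lagrangianOf m n pr E)) Nk kf)
    (z : (Nk kf).carrier)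
    -- the leaf through `z`, its inclusion into `N`, and its presymplectic form
    (H : DiracSystem.ImmersedSubmanifold (𝓡 (Nk kf).dim) (Nk kf).carrier)
    (hH : DiracSystem.IsLeaf (DiracSystem.restrictedDistribution D (Nk kf)) z H)
    (ι : H.carrier → N) (hι : ι = (Nk kf).incl ∘ H.incl)
    (Ω : ∀ y : H.carrier, TangentSpace (𝓡 H.dim) y → TangentSpace (𝓡 H.dim) y → ℝ)
    (hΩ : Ω = D.inducedForm ι) (hΩ_smooth : DiracSystem.IsSmoothTwoTensor Ω)
    -- the vector field `X` and the 1-form `μ` along the leaf with values in `S_E`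
    (X : ∀ y : H.carrier, TangentSpace (𝓡 H.dim) y)
    (hX : DiracSystem.SmoothVectorFieldOn X Set.univ)
    (μ : ∀ y : H.carrier, DiracSystem.Cotangent n (ι y))
    (hμ_smooth : ContMDiff (𝓡 H.dim) (DiracSystem.cotangentModel n) ∞
      (fun y => (TotalSpace.mk' (DiracSystem.Euc n →L[ℝ] ℝ) (ι y) (μ y) :
        DiracSystem.CotangentBundle n N)))
    (hμ_mem : ∀ y, (TotalSpace.mk' (DiracSystem.Euc n →L[ℝ] ℝ) (ι y) (μ y) :
        DiracSystem.CotangentBundle n N) ∈ DiracSystem.lagrangianOf m n pr E)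
    (hXμ : ∀ (y : H.carrier) (w : TangentSpace (𝓡 H.dim) y),
      Ω y (X y) w = DiracSystem.eval (μ y) (mfderiv (𝓡 H.dim) (𝓡 n) ι y w)) :
    -- `£_X Ω = 0`
    (∀ U : Set H.carrier, IsOpen U → ∀ Y Z : ∀ y : H.carrier, TangentSpace (𝓡 H.dim) y,
      DiracSystem.SmoothVectorFieldOn Y U → DiracSystem.SmoothVectorFieldOn Z U →
        ∀ y ∈ U, DiracSystem.lieDerivative X Ω Y Z y = 0) ∧
    -- the (local) flow `Φ` of `X` preserves `Ω`
    (∀ (J : Set ℝ) (U : Set H.carrier) (Φ : ℝ → H.carrier → H.carrier),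
      IsOpen J → J.OrdConnected → (0 : ℝ) ∈ J → IsOpen U →
      ContMDiffOn (𝓘(ℝ, ℝ).prod (𝓡 H.dim)) (𝓡 H.dim) ∞ (fun p : ℝ × H.carrier => Φ p.1 p.2)
        (J ×ˢ U) →
      (∀ y ∈ U, Φ 0 y = y) →
      (∀ y ∈ U, IsMIntegralCurveOn (I := 𝓡 H.dim) (fun t => Φ t y) X J) →
      ∀ t ∈ J, ∀ y ∈ U, ∀ v w : TangentSpace (𝓡 H.dim) y,
        Ω (Φ t y) (mfderiv (𝓡 H.dim) (𝓡 H.dim) (Φ t) y v)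
          (mfderiv (𝓡 H.dim) (𝓡 H.dim) (Φ t) y w) = Ω y v w) := by
  subst hι hΩ
  have hinc : ∀ y, MDifferentiableAt (𝓡 (Nk kf).dim) (𝓡 n) (Nk kf).incl y := fun y =>
    ((Nk kf).incl_smooth y).mdifferentiableAt (by simp)
  have hHinc : ∀ y, MDifferentiableAt (𝓡 H.dim) (𝓡 (Nk kf).dim) H.incl y := fun y =>
    (H.incl_smooth y).mdifferentiableAt (by simp)
  have hT : ∀ (y : H.carrier) (w : TangentSpace (𝓡 H.dim) y),
      mfderiv (𝓡 H.dim) (𝓡 n) ((Nk kf).incl ∘ H.incl) y w =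
        mfderiv (𝓡 (Nk kf).dim) (𝓡 n) (Nk kf).incl (H.incl y)
          (mfderiv (𝓡 H.dim) (𝓡 (Nk kf).dim) H.incl y w) := fun y w =>
    DFunLike.congr_fun (mfderiv_comp y (hinc (H.incl y)) (hHinc y)) w
  have hinj : ∀ y, Function.Injective (mfderiv (𝓡 H.dim) (𝓡 n) ((Nk kf).incl ∘ H.incl) y) :=
    fun y a b hab => H.incl_immersion y ((Nk kf).incl_immersion (H.incl y)
      ((hT y a).symm.trans (hab.trans (hT y b))))
  have hF : ∀ (y : H.carrier) (w : TangentSpace (𝓡 H.dim) y),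
      mfderiv (𝓡 H.dim) (𝓡 n) ((Nk kf).incl ∘ H.incl) y w ∈
        D.char (((Nk kf).incl ∘ H.incl) y) := by
    intro y w
    have h : mfderiv (𝓡 (Nk kf).dim) (𝓡 n) (Nk kf).incl (H.incl y)
        (mfderiv (𝓡 H.dim) (𝓡 (Nk kf).dim) H.incl y w) ∈ D.char ((Nk kf).incl (H.incl y)) :=
      (hH.integral.tangent y _).1 ⟨w, rfl⟩
    rw [hT y w]
    exact h
  -- The composite inclusion into `N` is an immersion tangent to `F`; this is what the local
  -- invariance statement needs from the leaf.
  have hloc := D.exists_invariant_formCoord hD h_pr hE ((Nk kf).incl_smooth.comp H.incl_smooth)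
    hinj hF hΩ_smooth hX hμ_smooth hμ_mem hXμ
  refine ⟨?_, ?_⟩
  · intro U hU Y Z hY hZ y hy
    obtain ⟨B, hB, hBs, hinv⟩ := hloc y
    exact DiracSystem.lieDerivative_eq_zero hB (hBs.differentiableAt (by simp)) hinv
      (hY.contMDiffAt (hU.mem_nhds hy)) (hZ.contMDiffAt (hU.mem_nhds hy))
  · intro J U Φ hJ hJc h0 hU hΦ hΦ0 hint t ht y hy v w
    exact DiracSystem.flow_preserves hX hloc hJ hJc h0 hU hΦ hΦ0 hint ht hy v w
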